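/- **Notation.** Let $A$ be a C*-algebra, $A_+$ its positive cone, $\widetilde A$ its unitization. A *trace* on $A$ is a map $\phi:A_+\to[0,\infty]$ that is additive, homogeneous for scalars in $[0,\infty)$ (with $0\cdot\infty=0$) and invariant under conjugation by unitaries of $\widetilde A$. $T(A)$ is the cone of lower semicontinuous traces and $T_F(A)$ the cone of finite traces (addition and multiplication by strictly positive reals are pointwise). A trace is extended to positive matrices over $A$ by $\phi((x_{ij}))=\sum_i\phi(x_{ii})$. $K_0(A)^+$ is the semigroup generated by the classes of projections in matrix algebras over $A$, $\Sigma A$ the set of classes of projections of $A$, and for $p,q\in K_0(A)^+$, $q\le p$ means $p-q\in K_0(A)^+$. $A$ has the *ideal property* if each closed two-sided ideal is generated, as a closed two-sided ideal, by the projections in it. Assume that $A$ has the ideal property and that the evaluation of lower semicontinuous traces at $K_0$-classes is well defined, i.e. $\phi(p)=\phi(q)$ for every $\phi\in T(A)$ and all projections $p,q$ in matrix algebras over $A$ with $[p]=[q]$ in $K_0(A)$. **The invariants.** The *extended Elliott invariant* is $\mathcal E(A)=((K_0(A),K_0(A)^+),\Sigma A,K_1(A),T(A))$ with the pairing $s(p)(\phi)=\phi(p)$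 for $p\in K_0(A)^+$. The *Stevens invariant* is $\mathcal S(A)=((K_0(A),K_0(A)^+),\Sigma A,K_1(A),\{T_F(pAp)\}_{p\in K_0(A)^+})$, where $pAp$ is formed with a projection in a matrix algebra over $A$ representing $p$, with the restriction maps $\lambda_{p,q}:T_F(pAp)\to T_F(qAq)$ for $q\le p$ and the pairings $s_p$ which evaluate traces at the classes $e\in K_0(A)^+$ with $e\le np$ for some $n$; restriction and evaluation are carried out on any $\phi\in T(A)$ that extends the given finite trace. **The constructions.** Tuples of Elliott type are $((G_0,G_0^+),\Sigma G,G_1,X)$ with a linear pairing $s$ of $G_0^+$ with a cone $X$, valued in $[0,\infty]$; tuples of Stevens type are $((G_0,G_0^+),\Sigma G,G_1,\{\Delta_p\}_{p\in G_0^+})$ with cones $\Delta_p$, finite linear pairings $s_p$, and functorial linear maps $\lambda_{p,q}:\Delta_p\to\Delta_q$ ($q\le p$) compatible with the pairings. Isomorphisms are isomorphisms of the ordered scaled groups $G_0$ and of the groups $G_1$, together with (contravariant) linear bijections of the cones that are compatible with the pairings and the maps $\lambda_{p,q}$. * $\mathcal G$ keeps $(G_0,G_0^+),\Sigma G,G_1$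 and sets $\Delta_p=\{\tau\in X: s(p)(\tau)<\infty\}/\!\sim$, where $\tau\sim\sigma$ if $f(\tau)=f(\sigma)$ for all affine $f:X\to[0,\infty]$ that are finite on $\{s(p)<\infty\}$; further $s_p(e)([\tau])=s(e)(\tau)$, and $\lambda_{p,q}$ is induced by inclusion. * $\mathcal F$ keeps $(G_0,G_0^+),\Sigma G,G_1$ and takes for $X$ the families $\{\tau_p\}_{p\in\Lambda}$ with $\Lambda$ a (nonempty) hereditary subsemigroup of $G_0^+$, $\tau_p\in\Delta_p$ and $\lambda_{p,q}(\tau_p)=\tau_q$ for $q\le p$ in $\Lambda$, with $\{\tau_p\}_{\Lambda_1}+\{\phi_p\}_{\Lambda_2}=\{\tau_p+\phi_p\}_{\Lambda_1\cap\Lambda_2}$, termwise scalar multiplication, and $s(q)(\{\tau_p\}_{p\in\Lambda})=s_q(q)(\tau_q)$ if $q\in\Lambda$, $=\infty$ otherwise. **Theorem 1.1.** Under these assumptions $\mathcal E(A)$ and $\mathcal S(A)$ are tuples of Elliott and of Stevens type (with $K_0(A)$ partially ordered by $K_0(A)^+$), and they determine each other: $$\mathcal G(\mathcal E(A))\cong\mathcal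 S(A),\qquad \mathcal F(\mathcal S(A))\cong\mathcal E(A).$$ Both isomorphisms can be taken to be the identity on $K_0(A)$ and $K_1(A)$; on the cones the first is $[\phi]\mapsto\phi|_{pAp}$, and the second matches $\phi\in T(A)$ with the family $\{\phi|_{pAp}\}_{p\in\Lambda}$, $\Lambda=\{p:\phi(p)<\infty\}$. -/

import Mathlib

open scoped ENNReal NNReal Matrix

universe u v

noncomputable section

/-! ## Projections in matrix algebras, `K₀` and `K₁` -/

/-- A projection in some matrix algebra `M_n(R)`; these form `P_∞(R)`. -/
structure MatProj (R : Type u) [NonUnitalRing R] [StarRing R] where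
  size : ℕ
  mat : Matrix (Fin size) (Fin size) R
  isProj : IsStarProjection mat

namespace MatProj

variable {R : Type u} {S : Type v} [NonUnitalRing R] [StarRing R] [NonUnitalRing S] [StarRing S]

/-- Murray–von Neumann equivalence, through a rectangular matrix. -/
def MvN (p q : MatProj R) : Prop :=
  ∃ w : Matrix (Fin q.size) (Fin p.size) R, wᴴ * w = p.mat ∧ w * wᴴ = q.mat

end MatProj

/-- The block diagonal matrix `diag(x, y)`. -/
def blockDiag {R : Type u} [Zero R] {m n : ℕ} (x : Matrix (Fin m) (Fin m) R)
    (y : Matrix (Fin n) (Fin n) R) : Matrix (Fin (m + n)) (Fin (m + n)) R :=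
  (Matrix.fromBlocks x 0 0 y).submatrix finSumFinEquiv.symm finSumFinEquiv.symm

namespace MatProj

variable {R : Type u} {S : Type v} [NonUnitalRing R] [StarRing R] [NonUnitalRing S] [StarRing S]

/-- The orthogonal sum `p ⊕ q`. -/
def dsum (p q : MatProj R) : MatProj R where
  size := p.size + q.size
  mat := blockDiag p.mat q.mat
  isProj := by
    have hp := p.isProj.isIdempotentElem.eq
    have hq := q.isProj.isIdempotentElem.eq
    have hp' : p.matᴴ = p.mat := p.isProj.isSelfAdjoint
    have hq' : q.matᴴ = q.mat := q.isProj.isSelfAdjoint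
    constructor
    · show blockDiag _ _ * blockDiag _ _ = blockDiag _ _
      rw [blockDiag, Matrix.submatrix_mul_equiv, Matrix.fromBlocks_multiply]
      simp [hp, hq]
    · show (blockDiag _ _)ᴴ = blockDiag _ _
      rw [blockDiag, Matrix.conjTranspose_submatrix, Matrix.fromBlocks_conjTranspose]
      simp [hp', hq']

/-- Entrywise application of a `*`-homomorphism to a projection. -/
def map (f : R →⋆ₙ+* S) (p : MatProj R) : MatProj S where
  size := p.size
  mat := p.mat.map f
  isProj := by
    have hp := p.isProj.isIdempotentElem.eq
    have hp' : p.matᴴ = p.mat := p.isProj.isSelfAdjoint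
    constructor
    · show p.mat.map f * p.mat.map f = p.mat.map f
      rw [← Matrix.map_mul, hp]
    · show (p.mat.map f)ᴴ = p.mat.map f
      rw [← Matrix.conjTranspose_map f (fun a => map_star f a), hp']

theorem map_dsum (f : R →⋆ₙ+* S) (p q : MatProj R) :
    (p.dsum q).map f = (p.map f).dsum (q.map f) := by
  have h : (blockDiag p.mat q.mat).map f = blockDiag (p.mat.map f) (q.mat.map f) := by
    rw [blockDiag, blockDiag, ← Matrix.submatrix_map, Matrix.fromBlocks_map]
    simp [Matrix.map_zero]
  simp only [map, dsum, h]

theorem MvN.map (f : R →⋆ₙ+* S) {p q : MatProj R} (h : MvN p q) : MvN (p.map f) (q.map f) := by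
  obtain ⟨w, h1, h2⟩ := h
  refine ⟨w.map f, ?_, ?_⟩
  · show (w.map f)ᴴ * w.map f = p.mat.map f
    rw [← Matrix.conjTranspose_map f (fun a => map_star f a), ← Matrix.map_mul, h1]
  · show w.map f * (w.map f)ᴴ = q.mat.map f
    rw [← Matrix.conjTranspose_map f (fun a => map_star f a), ← Matrix.map_mul, h2]

end MatProj

section KTheory

variable (R : Type u) [NonUnitalRing R] [StarRing R]

/-- The relations `[p] = [q]` for `p ∼ q` and `[p ⊕ q] = [p] + [q]`. -/
def kZeroRel : AddSubgroup (FreeAbelianGroup (MatProj R)) :=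
  AddSubgroup.closure
    ({x | ∃ p q : MatProj R, p.MvN q ∧ x = FreeAbelianGroup.of p - FreeAbelianGroup.of q} ∪
     {x | ∃ p q : MatProj R, x = FreeAbelianGroup.of (p.dsum q) -
        (FreeAbelianGroup.of p + FreeAbelianGroup.of q)})

/-- The Grothendieck group of the Murray–von Neumann semigroup of `R`, by generators and
relations. For a unital `C⋆`-algebra this is `K₀(R)`. -/
abbrev KZeroUnital : Type u := FreeAbelianGroup (MatProj R) ⧸ kZeroRel R

variable {R} {S : Type v} [NonUnitalRing S] [StarRing S]

/-- The class of a projection. -/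
def KZeroUnital.of (p : MatProj R) : KZeroUnital R :=
  QuotientAddGroup.mk (FreeAbelianGroup.of p)

theorem KZeroUnital.of_mvN {p q : MatProj R} (h : p.MvN q) :
    KZeroUnital.of p = KZeroUnital.of q := by
  refine (QuotientAddGroup.eq_iff_sub_mem).2 (AddSubgroup.subset_closure ?_)
  exact Or.inl ⟨p, q, h, rfl⟩

theorem KZeroUnital.of_dsum (p q : MatProj R) :
    KZeroUnital.of (p.dsum q) = KZeroUnital.of p + KZeroUnital.of q := by
  refine (QuotientAddGroup.eq_iff_sub_mem).2 (AddSubgroup.subset_closure ?_)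
  exact Or.inr ⟨p, q, rfl⟩

theorem KZeroUnital.of_eq_zero (p : MatProj R) (h : p.mat = 0) : KZeroUnital.of p = 0 := by
  have h1 : p.MvN (p.dsum p) := by
    refine ⟨0, by simp [h], ?_⟩
    show _ = blockDiag p.mat p.mat
    simp only [h, blockDiag, Matrix.fromBlocks_zero, Matrix.zero_mul]
    rfl
  have h2 := KZeroUnital.of_mvN h1
  rw [KZeroUnital.of_dsum] at h2
  exact left_eq_add.mp h2

/-- Functoriality of `KZeroUnital`. -/
def KZeroUnital.map (f : R →⋆ₙ+* S) : KZeroUnital R →+ KZeroUnital S :=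
  QuotientAddGroup.lift (kZeroRel R)
    (FreeAbelianGroup.lift fun p => KZeroUnital.of (p.map f)) (by
      rw [kZeroRel, AddSubgroup.closure_le]
      rintro x (⟨p, q, h, rfl⟩ | ⟨p, q, rfl⟩)
      · simp [AddMonoidHom.mem_ker, KZeroUnital.of_mvN (h.map f)]
      · simp [AddMonoidHom.mem_ker, MatProj.map_dsum, KZeroUnital.of_dsum])

theorem KZeroUnital.map_of (f : R →⋆ₙ+* S) (p : MatProj R) :
    KZeroUnital.map f (KZeroUnital.of p) = KZeroUnital.of (p.map f) := by
  simp [KZeroUnital.map, KZeroUnital.of]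

end KTheory

section CStarKTheory

variable (A : Type u) [NonUnitalCStarAlgebra A]

/-- The inclusion of `A` in its unitization. -/
def unitizationInr : A →⋆ₙ+* Unitization ℂ A where
  toFun := Unitization.inr
  map_mul' := Unitization.inr_mul ℂ
  map_zero' := Unitization.inr_zero ℂ
  map_add' := Unitization.inr_add ℂ
  map_star' := Unitization.inr_star

/-- The scalar part of an element of the unitization. -/
def unitizationFst : Unitization ℂ A →⋆ₙ+* ℂ where
  toFun x := x.fst
  map_mul' := Unitization.fst_mul
  map_zero' := Unitization.fst_zero
  map_add' := Unitization.fst_add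
  map_star' := Unitization.fst_star

/-- `K₀(A)`: the kernel of `K₀(Ã) → K₀(ℂ)`. -/
abbrev KZero : Type u :=
  (KZeroUnital.map (unitizationFst A)).ker

variable {A}

/-- The class in `K₀(A)` of a projection in a matrix algebra over `A`. -/
def KZero.of (p : MatProj A) : KZero A :=
  ⟨KZeroUnital.of (p.map (unitizationInr A)), by
    rw [AddMonoidHom.mem_ker, KZeroUnital.map_of]
    apply KZeroUnital.of_eq_zero
    ext i j
    exact Unitization.fst_inr ℂ (p.mat i j)⟩

theorem KZero.of_dsum (p q : MatProj A) : KZero.of (p.dsum q) = KZero.of p + KZero.of q := by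
  apply Subtype.ext
  simp [KZero.of, MatProj.map_dsum, KZeroUnital.of_dsum]

theorem KZero.of_eq_zero (p : MatProj A) (h : p.mat = 0) : KZero.of p = 0 := by
  apply Subtype.ext
  apply KZeroUnital.of_eq_zero
  simp only [MatProj.map, h]
  exact Matrix.map_zero _ (map_zero _)

variable (A)

/-- `K₀(A)⁺`: the semigroup generated by the classes of projections in matrix algebras. -/
def kZeroPos : AddSubmonoid (KZero A) := AddSubmonoid.closure (Set.range KZero.of)

/-- The scale `Σ A`: the classes of the projections in `A` itself. -/
def kZeroScale : Set (KZero A) := {x | ∃ p : MatProj A, p.size = 1 ∧ x = KZero.of p}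

theorem exists_rep (x : kZeroPos A) : ∃ p : MatProj A, KZero.of p = x := by
  obtain ⟨x, hx⟩ := x
  refine AddSubmonoid.closure_induction (motive := fun x _ => ∃ p : MatProj A, KZero.of p = x)
    ?_ ?_ ?_ hx
  · rintro _ ⟨p, rfl⟩
    exact ⟨p, rfl⟩
  · exact ⟨⟨0, 0, ⟨by simp [IsIdempotentElem], by simp [IsSelfAdjoint]⟩⟩,
      KZero.of_eq_zero _ rfl⟩
  · rintro _ _ _ _ ⟨p, rfl⟩ ⟨q, rfl⟩
    exact ⟨p.dsum q, KZero.of_dsum p q⟩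

/-- A projection in a matrix algebra over `A` which represents the class `x`. -/
def rep {A : Type u} [NonUnitalCStarAlgebra A] (x : kZeroPos A) : MatProj A :=
  (exists_rep A x).choose

theorem rep_spec {A : Type u} [NonUnitalCStarAlgebra A] (x : kZeroPos A) :
    KZero.of (rep x) = x :=
  (exists_rep A x).choose_spec

/-- A unitary in some matrix algebra over the unitization of `A`. -/
abbrev MatUnitary : Type u :=
  Σ n : ℕ, unitary (Matrix (Fin n) (Fin n) (Unitization ℂ A))

/-- The relations `[u] = [v]` for `u`, `v` homotopic in the unitaries of the same matrix algebra,
`[diag(u, v)] = [u] + [v]` and `[1] = 0`. -/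
def kOneRel : AddSubgroup (FreeAbelianGroup (MatUnitary A)) :=
  AddSubgroup.closure
    ({x | ∃ (n : ℕ) (w z : unitary (Matrix (Fin n) (Fin n) (Unitization ℂ A))), Joined w z ∧
        x = FreeAbelianGroup.of (⟨n, w⟩ : MatUnitary A) -
          FreeAbelianGroup.of (⟨n, z⟩ : MatUnitary A)} ∪
     {x | ∃ (m n : ℕ) (w : unitary (Matrix (Fin m) (Fin m) (Unitization ℂ A)))
        (z : unitary (Matrix (Fin n) (Fin n) (Unitization ℂ A)))
        (y : unitary (Matrix (Fin (m + n)) (Fin (m + n)) (Unitization ℂ A))),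
        (y : Matrix (Fin (m + n)) (Fin (m + n)) (Unitization ℂ A)) = blockDiag w.1 z.1 ∧
        x = FreeAbelianGroup.of (⟨m + n, y⟩ : MatUnitary A) -
          (FreeAbelianGroup.of (⟨m, w⟩ : MatUnitary A) +
            FreeAbelianGroup.of (⟨n, z⟩ : MatUnitary A))} ∪
     {x | ∃ n : ℕ, x = FreeAbelianGroup.of (⟨n, 1⟩ : MatUnitary A)})

/-- `K₁(A)`: homotopy classes of unitaries in matrix algebras over the unitization, by its
standard presentation. -/
abbrev KOne : Type u := FreeAbelianGroup (MatUnitary A) ⧸ kOneRel A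

end CStarKTheory

/-! ## Cones -/

/-- Strictly positive real scalars. -/
abbrev PosReal : Type := {t : ℝ // 0 < t}

/-- An abstract (not necessarily cancellative) cone: closed under addition and under
multiplication by strictly positive real scalars. -/
class RealCone (X : Type u) extends AddCommSemigroup X, SMul PosReal X where
  one_smul' : ∀ x : X, (1 : PosReal) • x = x
  mul_smul' : ∀ (s t : PosReal) (x : X), (s * t) • x = s • t • x
  smul_add' : ∀ (t : PosReal) (x y : X), t • (x + y) = t • x + t • y
  add_smul' : ∀ (s t : PosReal) (x : X), (s + t) • x = s • x + t • x

/-- Affine maps from a cone to `[0, ∞]`. -/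
def IsAffine {X : Type u} [RealCone X] (f : X → ℝ≥0∞) : Prop :=
  ∀ (s t : PosReal), s.1 + t.1 = 1 → ∀ x y : X,
    f (s • x + t • y) = ENNReal.ofReal s.1 * f x + ENNReal.ofReal t.1 * f y

/-! ## Traces -/

section Traces

variable (B : Type u) [NonUnitalCStarAlgebra B]

/-- The positive elements of a `C⋆`-algebra. -/
def PosElt : Type u := {x : B // ∃ y : B, x = star y * y}

instance : TopologicalSpace (PosElt B) := inferInstanceAs (TopologicalSpace {x : B // ∃ y : B, x = star y * y})

/-- Traces: `[0, ∞]`-valued weights on the positive elements which are invariant under the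
unitaries of the unitization. -/
structure CTrace where
  toFun : PosElt B → ℝ≥0∞
  map_smul' : ∀ (c : ℝ≥0) (x y : PosElt B), y.1 = ((c : ℝ) : ℂ) • x.1 →
    toFun y = c * toFun x
  map_add' : ∀ x y z : PosElt B, z.1 = x.1 + y.1 → toFun z = toFun x + toFun y
  map_unitary' : ∀ w ∈ unitary (Unitization ℂ B), ∀ x y : PosElt B,
    (y.1 : Unitization ℂ B) = star w * (x.1 : Unitization ℂ B) * w → toFun y = toFun x

variable {B}

theorem CTrace.ext {φ ψ : CTrace B} (h : φ.toFun = ψ.toFun) : φ = ψ := by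
  cases φ
  cases ψ
  congr

instance : Add (CTrace B) where
  add φ ψ :=
    { toFun := fun x => φ.toFun x + ψ.toFun x
      map_smul' := fun c x y h => by
        rw [φ.map_smul' c x y h, ψ.map_smul' c x y h, mul_add]
      map_add' := fun x y z h => by
        rw [φ.map_add' x y z h, ψ.map_add' x y z h, add_add_add_comm]
      map_unitary' := fun w hw x y h => by
        rw [φ.map_unitary' w hw x y h, ψ.map_unitary' w hw x y h] }

instance : SMul PosReal (CTrace B) where
  smul t φ :=
    { toFun := fun x => ENNReal.ofReal t.1 * φ.toFun x
      map_smul' := fun c x y h => by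
        rw [φ.map_smul' c x y h, mul_left_comm]
      map_add' := fun x y z h => by
        rw [φ.map_add' x y z h, mul_add]
      map_unitary' := fun w hw x y h => by
        rw [φ.map_unitary' w hw x y h] }

theorem CTrace.add_apply (φ ψ : CTrace B) (x : PosElt B) :
    (φ + ψ).toFun x = φ.toFun x + ψ.toFun x := rfl

theorem CTrace.smul_apply (t : PosReal) (φ : CTrace B) (x : PosElt B) :
    (t • φ).toFun x = ENNReal.ofReal t.1 * φ.toFun x := rfl

instance : RealCone (CTrace B) where
  add_assoc _ _ _ := CTrace.ext (funext fun _ => add_assoc _ _ _)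
  add_comm _ _ := CTrace.ext (funext fun _ => add_comm _ _)
  one_smul' _ := CTrace.ext (funext fun _ => by simp [CTrace.smul_apply])
  mul_smul' s t _ := CTrace.ext (funext fun _ => by
    simp [CTrace.smul_apply, ENNReal.ofReal_mul s.2.le, mul_assoc])
  smul_add' _ _ _ := CTrace.ext (funext fun _ => mul_add _ _ _)
  add_smul' s t _ := CTrace.ext (funext fun _ => by
    simp [CTrace.smul_apply, CTrace.add_apply, ENNReal.ofReal_add s.2.le t.2.le, add_mul])

variable (B)

/-- `T(B)`: the cone of lower semicontinuous traces. -/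
def LscTrace : Type u := {φ : CTrace B // LowerSemicontinuous φ.toFun}

/-- `T_F(B)`: the cone of finite traces. -/
def FinTrace : Type u := {φ : CTrace B // ∀ x, φ.toFun x ≠ ∞}

variable {B}

theorem lsc_smul (t : PosReal) {φ : CTrace B} (h : LowerSemicontinuous φ.toFun) :
    LowerSemicontinuous (t • φ).toFun :=
  (ENNReal.continuous_const_mul ENNReal.ofReal_ne_top).comp_lowerSemicontinuous h
    (fun _ _ hab => mul_le_mul_right hab _)

instance : RealCone (LscTrace B) where
  add φ ψ := ⟨φ.1 + ψ.1, φ.2.add ψ.2⟩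
  smul t φ := ⟨t • φ.1, lsc_smul t φ.2⟩
  add_assoc _ _ _ := Subtype.ext (add_assoc _ _ _)
  add_comm _ _ := Subtype.ext (add_comm _ _)
  one_smul' _ := Subtype.ext (RealCone.one_smul' _)
  mul_smul' _ _ _ := Subtype.ext (RealCone.mul_smul' _ _ _)
  smul_add' _ _ _ := Subtype.ext (RealCone.smul_add' _ _ _)
  add_smul' _ _ _ := Subtype.ext (RealCone.add_smul' _ _ _)

instance : RealCone (FinTrace B) where
  add φ ψ := ⟨φ.1 + ψ.1, fun x => ENNReal.add_ne_top.2 ⟨φ.2 x, ψ.2 x⟩⟩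
  smul t φ := ⟨t • φ.1, fun x => ENNReal.mul_ne_top ENNReal.ofReal_ne_top (φ.2 x)⟩
  add_assoc _ _ _ := Subtype.ext (add_assoc _ _ _)
  add_comm _ _ := Subtype.ext (add_comm _ _)
  one_smul' _ := Subtype.ext (RealCone.one_smul' _)
  mul_smul' _ _ _ := Subtype.ext (RealCone.mul_smul' _ _ _)
  smul_add' _ _ _ := Subtype.ext (RealCone.smul_add' _ _ _)
  add_smul' _ _ _ := Subtype.ext (RealCone.add_smul' _ _ _)

instance : Inhabited (FinTrace B) where
  default := ⟨{ toFun := fun _ => 0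
                map_smul' := by simp
                map_add' := by simp
                map_unitary' := by simp }, by simp⟩

end Traces

section MatrixTraces

variable {A : Type u} [NonUnitalCStarAlgebra A]

theorem exists_eq_star_mul_self_sum {n : ℕ} (f : Fin n → A) :
    ∃ y : A, ∑ k, star (f k) * f k = star y * y := by
  let _ := CStarAlgebra.spectralOrder A
  have := CStarAlgebra.spectralOrderedRing A
  exact CStarAlgebra.nonneg_iff_eq_star_mul_self.1
    (Finset.sum_nonneg fun k _ => star_mul_self_nonneg (f k))

variable [PartialOrder A] [StarOrderedRing A]

/-- The diagonal entries of a positive matrix are positive. -/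
def diagEntry {n : ℕ} (x : PosElt (CStarMatrix (Fin n) (Fin n) A)) (i : Fin n) : PosElt A :=
  ⟨x.1 i i, by
    obtain ⟨x, y, rfl⟩ := x
    obtain ⟨z, hz⟩ := exists_eq_star_mul_self_sum (fun k => y k i)
    exact ⟨z, by rw [← hz]; simp [CStarMatrix.mul_apply, CStarMatrix.star_apply]⟩⟩

/-- The extension of a trace on `A` to positive matrices over `A`. -/
def CTrace.onMatrix (φ : CTrace A) {n : ℕ} (x : PosElt (CStarMatrix (Fin n) (Fin n) A)) : ℝ≥0∞ :=
  ∑ i, φ.toFun (diagEntry x i)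

/-- The projection `p`, as an element of the `C⋆`-algebra `M_n(A)`. -/
def MatProj.elt (p : MatProj A) : CStarMatrix (Fin p.size) (Fin p.size) A :=
  CStarMatrix.ofMatrix p.mat

/-- The projection `p`, as a positive element of the `C⋆`-algebra `M_n(A)`. -/
def MatProj.posElt (p : MatProj A) : PosElt (CStarMatrix (Fin p.size) (Fin p.size) A) :=
  ⟨p.elt, p.elt, by
    have h1 : p.elt * p.elt = p.elt := p.isProj.isIdempotentElem.eq
    have h2 : star p.elt = p.elt := p.isProj.isSelfAdjoint
    rw [h2, h1]⟩

/-- The value of a trace on `A` at a projection in a matrix algebra over `A`. -/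
def CTrace.atProj (φ : CTrace A) (p : MatProj A) : ℝ≥0∞ := φ.onMatrix p.posElt

/-- The hereditary `C⋆`-subalgebra `p M_n(A) p`. -/
def MatProj.corner (p : MatProj A) :
    NonUnitalStarSubalgebra ℂ (CStarMatrix (Fin p.size) (Fin p.size) A) where
  carrier := {x | p.elt * x = x ∧ x * p.elt = x}
  add_mem' := fun {a b} ha hb => ⟨by rw [mul_add, ha.1, hb.1], by rw [add_mul, ha.2, hb.2]⟩
  zero_mem' := ⟨mul_zero _, zero_mul _⟩
  mul_mem' := fun {a b} ha hb => ⟨by rw [← mul_assoc, ha.1], by rw [mul_assoc, hb.2]⟩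
  smul_mem' := fun c x hx => ⟨by rw [mul_smul_comm, hx.1], by rw [smul_mul_assoc, hx.2]⟩
  star_mem' := fun {a} ha => by
    have h2 : star p.elt = p.elt := p.isProj.isSelfAdjoint
    exact ⟨by rw [← congrArg star ha.2, star_mul, h2, ← mul_assoc,
        show p.elt * p.elt = p.elt from p.isProj.isIdempotentElem.eq],
      by rw [← congrArg star ha.1, star_mul, h2, mul_assoc,
        show p.elt * p.elt = p.elt from p.isProj.isIdempotentElem.eq]⟩

instance (p : MatProj A) :
    IsClosed (p.corner : Set (CStarMatrix (Fin p.size) (Fin p.size) A)) :=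
  (isClosed_eq (continuous_const.mul continuous_id) continuous_id).inter
    (isClosed_eq (continuous_id.mul continuous_const) continuous_id)

/-- A positive element of `p M_n(A) p` is a positive element of `M_n(A)`. -/
def MatProj.incl (p : MatProj A) (x : PosElt p.corner) :
    PosElt (CStarMatrix (Fin p.size) (Fin p.size) A) :=
  ⟨x.1.1, by
    obtain ⟨x, y, rfl⟩ := x
    exact ⟨y.1, rfl⟩⟩

/-- `τ` is the restriction of `φ` to `p M_n(A) p`. -/
def IsRestriction (φ : LscTrace A) {p : MatProj A} (τ : FinTrace p.corner) : Prop :=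
  ∀ x : PosElt p.corner, τ.1.toFun x = φ.1.onMatrix (p.incl x)

end MatrixTraces

/-! ## The two kinds of tuples -/

/-- The `K`-theoretic part `((G₀, G₀⁺), Σ G, G₁)` of both invariants. -/
structure KTuple : Type (u + 1) where
  G0 : Type u
  [grp0 : AddCommGroup G0]
  pos : AddSubmonoid G0
  scale : Set G0
  G1 : Type u
  [grp1 : AddCommGroup G1]

attribute [instance] KTuple.grp0 KTuple.grp1

namespace KTuple

variable (K : KTuple.{u})

/-- The order on the positive cone: `q ≤ p` if `p - q` is positive. -/
def Le (q p : K.pos) : Prop := (p : K.G0) - q ∈ K.pos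

/-- `e` belongs to `G₀^{p+}`, that is, `0 ≤ e ≤ n p` for some `n`. -/
def Dominated (e p : K.pos) : Prop := ∃ n : ℕ, K.Le e (n • p)

/-- `(G₀, G₀⁺)` is a partially ordered group and `Σ G ⊆ G₀⁺`. -/
structure IsOrdered : Prop where
  antisymm : ∀ x ∈ K.pos, -x ∈ K.pos → x = 0
  scale_subset : K.scale ⊆ K.pos

theorem le_refl (p : K.pos) : K.Le p p := by
  simp [Le, K.pos.zero_mem]

theorem dominated_of_le {q p : K.pos} (h : K.Le q p) : K.Dominated q p := ⟨1, by simpa using h⟩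

theorem dominated_self (p : K.pos) : K.Dominated p p := K.dominated_of_le (K.le_refl p)

theorem Dominated.trans_le {e q p : K.pos} (h : K.Dominated e q) (h' : K.Le q p) :
    K.Dominated e p := by
  obtain ⟨n, hn⟩ := h
  refine ⟨n, ?_⟩
  have h2 := K.pos.add_mem hn (K.pos.nsmul_mem h' n)
  simp only [Le, AddSubmonoidClass.coe_nsmul, smul_sub] at h2 ⊢
  simpa using h2

theorem Dominated.add {e f p : K.pos} (h : K.Dominated e p) (h' : K.Dominated f p) :
    K.Dominated (e + f) p := by
  obtain ⟨n, hn⟩ := h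
  obtain ⟨m, hm⟩ := h'
  refine ⟨n + m, ?_⟩
  have h2 := K.pos.add_mem hn hm
  simp only [Le, AddSubmonoidClass.coe_nsmul, AddSubmonoid.coe_add, add_smul] at h2 ⊢
  convert h2 using 1
  abel

end KTuple

/-- Tuples of the kind to which the extended Elliott invariant belongs, with the pairing
`G₀⁺ × X → [0, ∞]`. -/
structure ElliottTuple : Type (u + 1) extends KTuple.{u} where
  X : Type u
  [coneX : RealCone X]
  pairing : pos → X → ℝ≥0∞

attribute [instance] ElliottTuple.coneX

/-- The laws of an Elliott tuple that its constructions and its morphisms refer to: the pairing is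
a positive linear map from `G₀⁺` to the affine (indeed linear) maps `X → [0, ∞]`. -/
structure ElliottTuple.IsObject (E : ElliottTuple.{u}) : Prop where
  ordered : E.toKTuple.IsOrdered
  pairing_zero : ∀ x, E.pairing 0 x = 0
  pairing_add : ∀ p q x, E.pairing (p + q) x = E.pairing p x + E.pairing q x
  pairing_add_right : ∀ p x y, E.pairing p (x + y) = E.pairing p x + E.pairing p y
  pairing_smul_right : ∀ p (t : PosReal) x, E.pairing p (t • x) = ENNReal.ofReal t.1 * E.pairing p x

/-- Tuples of the kind to which the Stevens invariant belongs: a cone `Δ_p` for each `p ∈ G₀⁺`,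
restriction maps `λ_{p,q} : Δ_p → Δ_q` for `q ≤ p`, and the pairing of `G₀^{p+}` with `Δ_p`. The
group `G₀^p` is `G₀^{p+} - G₀^{p+}`, so an additive pairing extends uniquely to it. -/
structure StevensTuple : Type (u + 1) extends KTuple.{u} where
  Δ : pos → Type u
  [coneΔ : ∀ p, RealCone (Δ p)]
  pairing : ∀ p e : pos, toKTuple.Dominated e p → Δ p → ℝ≥0
  res : ∀ p q : pos, toKTuple.Le q p → Δ p → Δ q

attribute [instance] StevensTuple.coneΔ

/-- The laws of a Stevens tuple that its constructions and its morphisms refer to: the pairings are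
positive linear maps and the restriction maps are linear, functorial and compatible with the
pairings. -/
structure StevensTuple.IsObject (S : StevensTuple.{u}) : Prop where
  ordered : S.toKTuple.IsOrdered
  pairing_add : ∀ p e f (he : S.Dominated e p) (hf : S.Dominated f p) τ,
    S.pairing p (e + f) (he.add _ hf) τ = S.pairing p e he τ + S.pairing p f hf τ
  pairing_add_right : ∀ p e (he : S.Dominated e p) τ σ,
    S.pairing p e he (τ + σ) = S.pairing p e he τ + S.pairing p e he σ
  pairing_smul_right : ∀ p e (he : S.Dominated e p) (t : PosReal) τ,
    S.pairing p e he (t • τ) = t.1.toNNReal * S.pairing p e he τ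
  res_add : ∀ p q (h : S.Le q p) τ σ, S.res p q h (τ + σ) = S.res p q h τ + S.res p q h σ
  res_smul : ∀ p q (h : S.Le q p) (t : PosReal) τ, S.res p q h (t • τ) = t • S.res p q h τ
  res_self : ∀ p τ, S.res p p (S.le_refl p) τ = τ
  res_res : ∀ p q r (hqp : S.Le q p) (hrq : S.Le r q) (hrp : S.Le r p) τ,
    S.res q r hrq (S.res p q hqp τ) = S.res p r hrp τ
  pairing_res : ∀ p q e (h : S.Le q p) (he : S.Dominated e q) τ,
    S.pairing p e (he.trans_le _ h) τ = S.pairing q e he (S.res p q h τ)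

/-! ## Isomorphisms -/

/-- Isomorphisms of the `K`-theoretic parts. -/
structure KIso (P Q : KTuple.{u}) where
  θ0 : P.G0 ≃+ Q.G0
  map_pos : ∀ x, x ∈ P.pos ↔ θ0 x ∈ Q.pos
  map_scale : ∀ x, x ∈ P.scale ↔ θ0 x ∈ Q.scale
  θ1 : P.G1 ≃+ Q.G1

namespace KIso

variable {P Q : KTuple.{u}} (θ : KIso P Q)

/-- The bijection of positive cones induced by an isomorphism. -/
def onPos (p : P.pos) : Q.pos := ⟨θ.θ0 p, (θ.map_pos p).1 p.2⟩

theorem le {q p : P.pos} (h : P.Le q p) : Q.Le (θ.onPos q) (θ.onPos p) := by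
  have := (θ.map_pos _).1 h
  simpa [KTuple.Le, onPos] using this

theorem dominated {e p : P.pos} (h : P.Dominated e p) :
    Q.Dominated (θ.onPos e) (θ.onPos p) := by
  obtain ⟨n, hn⟩ := h
  refine ⟨n, ?_⟩
  have := (θ.map_pos _).1 hn
  simpa [KTuple.Le, onPos] using this

end KIso

/-- Isomorphisms of tuples of Elliott type: the cones are mapped contravariantly. -/
structure ElliottIso (P Q : ElliottTuple.{u}) extends KIso P.toKTuple Q.toKTuple where
  ζ : Q.X ≃ P.X
  ζ_add : ∀ x y, ζ (x + y) = ζ x + ζ y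
  ζ_smul : ∀ (t : PosReal) x, ζ (t • x) = t • ζ x
  compat : ∀ p x, Q.pairing (toKIso.onPos p) x = P.pairing p (ζ x)

/-- Isomorphisms of tuples of Stevens type: the cones are mapped contravariantly. -/
structure StevensIso (P Q : StevensTuple.{u}) extends KIso P.toKTuple Q.toKTuple where
  ξ : ∀ p, Q.Δ (toKIso.onPos p) ≃ P.Δ p
  ξ_add : ∀ p τ σ, ξ p (τ + σ) = ξ p τ + ξ p σ
  ξ_smul : ∀ p (t : PosReal) τ, ξ p (t • τ) = t • ξ p τ
  res_compat : ∀ p q (h : P.Le q p) τ,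
    P.res p q h (ξ p τ) = ξ q (Q.res _ _ (toKIso.le h) τ)
  pairing_compat : ∀ p e (h : P.Dominated e p) τ,
    Q.pairing _ _ (toKIso.dominated h) τ = P.pairing p e h (ξ p τ)

/-! ## The construction `G` of a Stevens tuple from an Elliott tuple -/

namespace ElliottTuple

variable {E : ElliottTuple.{u}}

/-- `Δ'_p`: the elements of `X` at which the pairing with `p` is finite. -/
def FinPart (E : ElliottTuple.{u}) (p : E.pos) : Type u := {τ : E.X // E.pairing p τ < ∞}

/-- `τ ∼ σ` if every affine map `X → [0, ∞]` that is finite on `Δ'_p` takes the same value at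
`τ` and `σ`. -/
def finSetoid (E : ElliottTuple.{u}) (p : E.pos) : Setoid (E.FinPart p) where
  r τ σ := ∀ f : E.X → ℝ≥0∞, IsAffine f → (∀ ρ : E.FinPart p, f ρ.1 < ∞) → f τ.1 = f σ.1
  iseqv := ⟨fun _ _ _ _ => rfl, fun h f hf hf' => (h f hf hf').symm,
    fun h h' f hf hf' => (h f hf hf').trans (h' f hf hf')⟩

/-- `Δ_p = Δ'_p / ∼`. -/
def QuotPart (E : ElliottTuple.{u}) (p : E.pos) : Type u := Quotient (E.finSetoid p)

/-- The class in `Δ_p` of an element of `Δ'_p`. -/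
def QuotPart.mk {p : E.pos} (τ : E.FinPart p) : E.QuotPart p := Quotient.mk (E.finSetoid p) τ

theorem IsObject.finPart_add (hE : E.IsObject) {p : E.pos} (τ σ : E.FinPart p) :
    E.pairing p (τ.1 + σ.1) < ∞ := by
  rw [hE.pairing_add_right]
  exact ENNReal.add_lt_top.2 ⟨τ.2, σ.2⟩

theorem IsObject.finPart_smul (hE : E.IsObject) {p : E.pos} (t : PosReal) (τ : E.FinPart p) :
    E.pairing p (t • τ.1) < ∞ := by
  rw [hE.pairing_smul_right]
  exact ENNReal.mul_lt_top ENNReal.ofReal_lt_top τ.2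

theorem IsObject.affine_pairing (hE : E.IsObject) (p : E.pos) : IsAffine (E.pairing p) := by
  intro s t _ x y
  rw [hE.pairing_add_right, hE.pairing_smul_right, hE.pairing_smul_right]

theorem IsObject.pairing_nsmul (hE : E.IsObject) (n : ℕ) (p : E.pos) (x : E.X) :
    E.pairing (n • p) x = n * E.pairing p x := by
  induction n with
  | zero => simp [hE.pairing_zero]
  | succ n ih => rw [succ_nsmul, hE.pairing_add, ih]; push_cast; ring

theorem IsObject.pairing_mono (hE : E.IsObject) {q p : E.pos} (h : E.Le q p) (x : E.X) :
    E.pairing q x ≤ E.pairing p x := by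
  have h1 : p = q + ⟨(p : E.G0) - q, h⟩ := Subtype.ext (by simp)
  rw [h1, hE.pairing_add]
  exact le_self_add

theorem IsObject.pairing_lt_top (hE : E.IsObject) {e p : E.pos} (h : E.Dominated e p)
    (τ : E.FinPart p) : E.pairing e τ.1 < ∞ := by
  obtain ⟨n, hn⟩ := h
  refine (hE.pairing_mono hn τ.1).trans_lt ?_
  rw [hE.pairing_nsmul]
  exact ENNReal.mul_lt_top (by simp) τ.2

/-- A translate of an affine map is affine. -/
theorem isAffine_add_right {X : Type u} [RealCone X] {f : X → ℝ≥0∞} (hf : IsAffine f) (z : X) :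
    IsAffine fun x => f (x + z) := by
  intro s t hst x y
  have h1 : z = s • z + t • z := by
    rw [← RealCone.add_smul']
    have : s + t = 1 := Subtype.ext hst
    rw [this, RealCone.one_smul']
  have h2 : s • x + t • y + z = s • (x + z) + t • (y + z) := by
    rw [RealCone.smul_add', RealCone.smul_add', add_add_add_comm, ← h1]
  show f (s • x + t • y + z) = _
  rw [h2, hf s t hst]

theorem isAffine_comp_smul {X : Type u} [RealCone X] {f : X → ℝ≥0∞} (hf : IsAffine f)
    (c : PosReal) : IsAffine fun x => f (c • x) := by
  intro s t hst x y
  have h2 : c • (s • x + t • y) = s • (c • x) + t • (c • y) := by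
    rw [RealCone.smul_add', ← RealCone.mul_smul', ← RealCone.mul_smul', ← RealCone.mul_smul',
      ← RealCone.mul_smul', mul_comm c s, mul_comm c t]
  show f (c • (s • x + t • y)) = _
  rw [h2, hf s t hst]

theorem IsObject.rel_add (hE : E.IsObject) {p : E.pos} {τ τ' σ σ' : E.FinPart p}
    (h : E.finSetoid p τ τ') (h' : E.finSetoid p σ σ') :
    E.finSetoid p ⟨τ.1 + σ.1, hE.finPart_add τ σ⟩ ⟨τ'.1 + σ'.1, hE.finPart_add τ' σ'⟩ := by
  intro f hf hfin
  have h1 := h (fun x => f (x + σ.1)) (isAffine_add_right hf _)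
    (fun ρ => hfin ⟨ρ.1 + σ.1, hE.finPart_add ρ σ⟩)
  have h2 := h' (fun x => f (x + τ'.1)) (isAffine_add_right hf _)
    (fun ρ => hfin ⟨ρ.1 + τ'.1, hE.finPart_add ρ τ'⟩)
  simp only at h1 h2 ⊢
  rw [h1, add_comm τ'.1, h2, add_comm]

theorem IsObject.rel_smul (hE : E.IsObject) {p : E.pos} (t : PosReal) {τ τ' : E.FinPart p}
    (h : E.finSetoid p τ τ') :
    E.finSetoid p ⟨t • τ.1, hE.finPart_smul t τ⟩ ⟨t • τ'.1, hE.finPart_smul t τ'⟩ :=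
  fun f hf hfin => h (fun x => f (t • x)) (isAffine_comp_smul hf t)
    (fun ρ => hfin ⟨t • ρ.1, hE.finPart_smul t ρ⟩)

/-- The cone structure of `Δ_p`, induced by that of `X`. -/
@[reducible]
def quotCone (hE : E.IsObject) (p : E.pos) : RealCone (E.QuotPart p) where
  add := Quotient.map₂ (fun τ σ => ⟨τ.1 + σ.1, hE.finPart_add τ σ⟩)
    (fun _ _ h _ _ h' => hE.rel_add h h')
  smul t := Quotient.map (fun τ => ⟨t • τ.1, hE.finPart_smul t τ⟩) (fun _ _ h => hE.rel_smul t h)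
  add_assoc := by
    rintro ⟨τ⟩ ⟨σ⟩ ⟨ρ⟩
    exact congrArg QuotPart.mk (Subtype.ext (add_assoc _ _ _))
  add_comm := by
    rintro ⟨τ⟩ ⟨σ⟩
    exact congrArg QuotPart.mk (Subtype.ext (add_comm _ _))
  one_smul' := by
    rintro ⟨τ⟩
    exact congrArg QuotPart.mk (Subtype.ext (RealCone.one_smul' _))
  mul_smul' := by
    rintro s t ⟨τ⟩
    exact congrArg QuotPart.mk (Subtype.ext (RealCone.mul_smul' _ _ _))
  smul_add' := by
    rintro t ⟨τ⟩ ⟨σ⟩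
    exact congrArg QuotPart.mk (Subtype.ext (RealCone.smul_add' _ _ _))
  add_smul' := by
    rintro s t ⟨τ⟩
    exact congrArg QuotPart.mk (Subtype.ext (RealCone.add_smul' _ _ _))

/-- The construction `G`: the `K`-theoretic part is kept, `Δ_p = Δ'_p / ∼`, the pairing is
`([τ], e) ↦ s(e)(τ)`, and the restriction maps are induced by the inclusions `Δ'_p ⊆ Δ'_q`. -/
def toStevens (E : ElliottTuple.{u}) (hE : E.IsObject) : StevensTuple.{u} where
  toKTuple := E.toKTuple
  Δ := E.QuotPart
  coneΔ := quotCone hE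
  pairing _ e he := Quotient.lift (fun τ => (E.pairing e τ.1).toNNReal) (fun _ _ h =>
    congrArg ENNReal.toNNReal (h _ (hE.affine_pairing e) fun ρ => hE.pairing_lt_top he ρ))
  res _ _ hqp := Quotient.map (fun τ => ⟨τ.1, (hE.pairing_mono hqp τ.1).trans_lt τ.2⟩)
    (fun _ _ h f hf hfin => h f hf fun ρ => hfin ⟨ρ.1, (hE.pairing_mono hqp ρ.1).trans_lt ρ.2⟩)

end ElliottTuple

/-! ## The construction `F` of an Elliott tuple from a Stevens tuple -/

/-- Ideals of `G₀⁺`: hereditary subsemigroups. -/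
structure PosIdeal (K : KTuple.{u}) where
  carrier : Set K.pos
  nonempty : carrier.Nonempty
  add_mem : ∀ {p q}, p ∈ carrier → q ∈ carrier → p + q ∈ carrier
  mem_of_le : ∀ {q p}, K.Le q p → p ∈ carrier → q ∈ carrier

namespace PosIdeal

variable {K : KTuple.{u}}

theorem zero_mem (Λ : PosIdeal K) : 0 ∈ Λ.carrier := by
  obtain ⟨p, hp⟩ := Λ.nonempty
  exact Λ.mem_of_le (by simp [KTuple.Le]) hp

/-- The intersection of two ideals. -/
def inter (Λ Λ' : PosIdeal K) : PosIdeal K where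
  carrier := Λ.carrier ∩ Λ'.carrier
  nonempty := ⟨0, Λ.zero_mem, Λ'.zero_mem⟩
  add_mem h h' := ⟨Λ.add_mem h.1 h'.1, Λ'.add_mem h.2 h'.2⟩
  mem_of_le h h' := ⟨Λ.mem_of_le h h'.1, Λ'.mem_of_le h h'.2⟩

theorem ext {Λ Λ' : PosIdeal K} (h : ∀ p, p ∈ Λ.carrier ↔ p ∈ Λ'.carrier) : Λ = Λ' := by
  cases Λ
  cases Λ'
  congr
  exact Set.ext h

end PosIdeal

namespace StevensTuple

/-- The families `{τ_p}_{p ∈ Λ}` with `Λ` an ideal of `G₀⁺`, `τ_p ∈ Δ_p`, and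
`λ_{p,q}(τ_p) = τ_q` for `q ≤ p`. -/
structure Family (S : StevensTuple.{u}) : Type u where
  Λ : PosIdeal S.toKTuple
  τ : ∀ p, p ∈ Λ.carrier → S.Δ p
  compat : ∀ p q (hp : p ∈ Λ.carrier) (h : S.Le q p),
    S.res p q h (τ p hp) = τ q (Λ.mem_of_le h hp)

variable {S : StevensTuple.{u}}

theorem Family.ext {a b : S.Family} (h : ∀ p, p ∈ a.Λ.carrier ↔ p ∈ b.Λ.carrier)
    (h' : ∀ p (ha : p ∈ a.Λ.carrier) (hb : p ∈ b.Λ.carrier), a.τ p ha = b.τ p hb) : a = b := by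
  obtain ⟨Λ, τ, hτ⟩ := a
  obtain ⟨Λ', τ', hτ'⟩ := b
  obtain rfl : Λ = Λ' := PosIdeal.ext h
  obtain rfl : τ = τ' := funext fun p => funext fun hp => h' p hp hp
  rfl

/-- The cone of families: the sum is defined on the intersection of the index sets. -/
@[reducible]
def familyCone (hS : S.IsObject) : RealCone S.Family where
  add a b :=
    { Λ := a.Λ.inter b.Λ
      τ := fun p hp => a.τ p hp.1 + b.τ p hp.2
      compat := fun p q hp h => by rw [hS.res_add, a.compat, b.compat] }
  smul t a :=
    { Λ := a.Λ
      τ := fun p hp => t • a.τ p hp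
      compat := fun p q hp h => by rw [hS.res_smul, a.compat] }
  add_assoc a b c := Family.ext (fun _ => and_assoc) fun _ _ _ => add_assoc _ _ _
  add_comm a b := Family.ext (fun _ => and_comm) fun _ _ _ => add_comm _ _
  one_smul' a := Family.ext (fun _ => Iff.rfl) fun _ _ _ => RealCone.one_smul' _
  mul_smul' s t a := Family.ext (fun _ => Iff.rfl) fun _ _ _ => RealCone.mul_smul' _ _ _
  smul_add' t a b := Family.ext (fun _ => Iff.rfl) fun _ _ _ => RealCone.smul_add' _ _ _
  add_smul' s t a := Family.ext (fun _ => (and_self_iff).symm) fun _ _ _ => RealCone.add_smul' _ _ _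

open Classical in
/-- The construction `F`: the `K`-theoretic part is kept, `X` is the cone of compatible families,
and `s(q)({τ_p}_{p ∈ Λ})` is `s_q(q)(τ_q)` if `q ∈ Λ` and `∞` otherwise. -/
def toElliott (S : StevensTuple.{u}) (hS : S.IsObject) : ElliottTuple.{u} where
  toKTuple := S.toKTuple
  X := S.Family
  coneX := familyCone hS
  pairing q a :=
    if h : q ∈ a.Λ.carrier then (S.pairing q q (S.dominated_self q) (a.τ q h) : ℝ≥0∞) else ∞

end StevensTuple

/-! ## The invariants of a `C⋆`-algebra -/

section Invariants

variable (A : Type u) [NonUnitalCStarAlgebra A] [PartialOrder A] [StarOrderedRing A]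

/-- The ideal property: every closed two-sided ideal is generated, as a closed two-sided ideal,
by the projections which it contains. -/
def IdealProperty : Prop :=
  ∀ I J : TwoSidedIdeal A, IsClosed (I : Set A) → IsClosed (J : Set A) →
    (∀ p : A, IsStarProjection p → p ∈ I → p ∈ J) → I ≤ J

/-- Evaluation of lower semicontinuous traces at `K₀`-classes of projections is well defined. -/
def PairingWellDefined : Prop :=
  ∀ p q : MatProj A, KZero.of p = KZero.of q → ∀ φ : LscTrace A, φ.1.atProj p = φ.1.atProj q

/-- The ordered, scaled `K₀`-group and the `K₁`-group of `A`. -/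
def cstarKTuple : KTuple.{u} where
  G0 := KZero A
  pos := kZeroPos A
  scale := kZeroScale A
  G1 := KOne A

/-- The extended Elliott invariant `((K₀(A), K₀(A)⁺), Σ A, K₁(A), T(A))`, with the pairing which
evaluates a trace at a `K₀`-class. -/
def extendedElliott : ElliottTuple.{u} where
  toKTuple := cstarKTuple A
  X := LscTrace A
  pairing p φ := φ.1.atProj (rep p)

open Classical in
/-- The Stevens invariant `((K₀(A), K₀(A)⁺), Σ A, K₁(A), {T_F(p A p)})`. For `p ∈ K₀(A)⁺` the
algebra `p A p` is formed with a projection `rep p` in a matrix algebra over `A` which represents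
`p`. A finite trace on `p A p` is restricted to `q A q`, or evaluated at a class `e ≤ n p`, by
means of a lower semicontinuous trace on `A` which extends it. -/
def stevens : StevensTuple.{u} where
  toKTuple := cstarKTuple A
  Δ p := FinTrace (rep (A := A) p).corner
  coneΔ _ := inferInstance
  pairing p e _ τ :=
    if h : ∃ φ : LscTrace A, IsRestriction φ (p := rep (A := A) p) τ then
      (h.choose.1.atProj (rep (A := A) e)).toNNReal
    else 0
  res p q _ τ :=
    if h : ∃ σ : FinTrace (rep (A := A) q).corner, ∃ φ : LscTrace A,
      IsRestriction φ (p := rep (A := A) p) τ ∧ IsRestriction φ σ then h.choose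
    else default

end Invariants

end

/-!
Write `J_p` for the closed ideal of `A` generated by the entries of a projection `p` in a matrix
algebra over `A`, and `J_Λ` for the one generated by the projections with class in an ideal `Λ` of
`K₀(A)⁺`. Such ideals are handled through cones of positive elements which are stable under
`s ↦ c⋆ s c` (`ConjCone`): a positive `x` is in the closed ideal generated by the cone if and only
if for every `ε > 0` it satisfies `x ≤ s + ε` for some `s` in the cone, and then it is the limit of
elements `c⋆ s c ≤ x` (`exists_conj_approx`). The function which is `0` on a closed ideal and `∞`
off it is a lower semicontinuous trace; pairing it with `K₀` shows that `K₀(A)⁺` is partially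
ordered, and that `[e] ≤ n [p]` implies `J_e ⊆ J_p`.

A finite trace `τ` on `p M_n(A) p` has a smallest lower semicontinuous extension to `A`
(`exists_smallest_extension`), whose extension to `M_n(A)` sends `x` to the supremum of
`∑ τ(v_i v_i⋆)` over the `v_i` with `p v_i = v_i` and `∑ v_i⋆ v_i ≤ x`. All extensions agree on
`J_p` (`IsRestriction.val_eq`), because `φ(v⋆v) = φ(vv⋆)` for lower semicontinuous `φ`
(`LscTrace.val_mul_star`). This makes the evaluations and restriction maps of the Stevens invariant
independent of choices.

For the first isomorphism it remains to see that traces `φ`, `ψ` which are finite at `p` and have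
the same restriction to the corner are identified by the affine maps in question
(`IsRestriction.affine_eq`): with `ρ` equal to `0` on `J_p` and `∞` off it, `φ + ρ = ψ + ρ`, and
`f(ρ) < ∞`, so that `f(φ) = f(ψ)`.

For the second isomorphism, the ideal property shows that a trace `φ` is infinite off `J_Λ`, where
`Λ` is the set of the classes at which `φ` is finite (`LscTrace.val_eq_top`); so `φ` is determined
by its restrictions to the corners of the `p ∈ Λ`. Conversely a compatible family is realized by the
directed supremum of the smallest extensions of its members, plus the trace which is infinite off
`J_Λ` (`exists_trace_of_family`). This trace is not finite at more classes than those in `Λ`, since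
a projection in a matrix algebra over `J_Λ` is of the form `v⋆v` with `v = p v` and `[p] ∈ Λ`
(`MatProj.DiagMem.exists_eq_conjTranspose_mul`), hence has its class in the hereditary set `Λ`.
-/

noncomputable section

/-! ### Order and functional calculus in a `C⋆`-algebra and its unitization -/

section UnitalOrder

variable {U : Type u} [CStarAlgebra U] [PartialOrder U] [StarOrderedRing U]

/-- An element which is bounded below by a positive scalar has an inverse square root, in the
bicommutant. -/
theorem exists_inv_sqrt {h : U} {c : ℝ} (hc : 0 < c) (hh : ((c : ℝ) : ℂ) • (1 : U) ≤ h) :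
    ∃ r : U, star r = r ∧ r * h * r = 1 ∧ ∀ b, Commute b h → Commute b r := by
  have e1 : ((c : ℝ) : ℂ) • (1 : U) = algebraMap ℝ U c := by
    rw [Algebra.algebraMap_eq_smul_one]; exact Complex.coe_smul c 1
  have h0 : IsStrictlyPositive (algebraMap ℝ U c) :=
    ⟨by rw [Algebra.algebraMap_eq_smul_one]; exact smul_nonneg hc.le zero_le_one,
      (IsUnit.mk0 c hc.ne').map _⟩
  rw [e1] at hh
  have h1 : IsStrictlyPositive h := ⟨h0.nonneg.trans hh, CStarAlgebra.isUnit_of_le _ hh h0⟩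
  refine ⟨h ^ (-(1 / 2) : ℝ), ?_, CFC.conjugate_rpow_neg_one_half h h1, fun b hb => ?_⟩
  · exact (IsSelfAdjoint.of_nonneg CFC.rpow_nonneg).star_eq
  · exact (Commute.cfc_nnreal hb.symm _).symm

theorem conj_le_one {r h a : U} (hr : star r = r) (hrh : r * h * r = 1) (ha : a ≤ h) :
    r * a * r ≤ 1 := by
  have := star_left_conjugate_le_conjugate ha r
  rwa [hr, hrh] at this

end UnitalOrder

section NonunitalOrder

variable {B : Type u} [NonUnitalCStarAlgebra B] [PartialOrder B] [StarOrderedRing B]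

theorem nonneg_iff_exists {x : B} : 0 ≤ x ↔ ∃ y, x = star y * y :=
  CStarAlgebra.nonneg_iff_eq_star_mul_self

theorem exists_selfAdjoint_mul_self {x : B} (hx : 0 ≤ x) : ∃ y : B, star y = y ∧ y * y = x :=
  ⟨CFC.sqrt x, (IsSelfAdjoint.of_nonneg (CFC.sqrt_nonneg x)).star_eq, CFC.sqrt_mul_sqrt_self x hx⟩

theorem real_smul_nonneg {t : ℝ} (ht : 0 ≤ t) {x : B} (hx : 0 ≤ x) : 0 ≤ ((t : ℝ) : ℂ) • x := by
  rw [Complex.coe_smul]; exact smul_nonneg ht hx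

theorem real_smul_le {t : ℝ} (ht : 0 ≤ t) {x y : B} (hx : x ≤ y) :
    ((t : ℝ) : ℂ) • x ≤ ((t : ℝ) : ℂ) • y := by
  rw [Complex.coe_smul, Complex.coe_smul]; exact smul_le_smul_of_nonneg_left hx ht

theorem real_smul_le_of_le {s t : ℝ} (ht : s ≤ t) {x : B} (hx : 0 ≤ x) :
    ((s : ℝ) : ℂ) • x ≤ ((t : ℝ) : ℂ) • x := by
  rw [Complex.coe_smul, Complex.coe_smul]; exact smul_le_smul_of_nonneg_right ht hx

/-- The operator form of `|x + y|² ≤ 2|x|² + 2|y|²`. -/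
theorem star_add_mul_add_le (x y : B) :
    star (x + y) * (x + y) ≤ (2 : ℕ) • (star x * x) + (2 : ℕ) • (star y * y) := by
  rw [← sub_nonneg]
  convert star_mul_self_nonneg (x - y) using 1
  simp only [star_add, star_sub]
  noncomm_ring

omit [PartialOrder B] [StarOrderedRing B] in
theorem star_mul_self_le_norm (x : B) :
    ((star x * x : B) : Unitization ℂ B) ≤ ((‖x‖ ^ 2 : ℝ) : ℂ) • 1 := by
  have := CStarAlgebra.star_mul_le_algebraMap_norm_sq (a := (x : Unitization ℂ B))
  rw [Unitization.norm_inr, Algebra.algebraMap_eq_smul_one] at this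
  rw [Unitization.inr_mul, Unitization.inr_star]
  convert this using 1
  exact Complex.coe_smul (‖x‖ ^ 2) (1 : Unitization ℂ B)

theorem norm_le_of_le_smul_one {x : B} (hx : 0 ≤ x) {t : ℝ} (ht : 0 ≤ t)
    (h : (x : Unitization ℂ B) ≤ ((t : ℝ) : ℂ) • 1) : ‖x‖ ≤ t := by
  rw [← Unitization.norm_inr (𝕜 := ℂ) (a := x)]
  rw [CStarAlgebra.norm_le_iff_le_algebraMap _ ht (Unitization.inr_nonneg_iff.2 hx),
    Algebra.algebraMap_eq_smul_one]
  convert h using 1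
  exact (Complex.coe_smul t (1 : Unitization ℂ B)).symm

omit [PartialOrder B] [StarOrderedRing B] in
theorem sub_le_norm_smul_one {x y : B} (hx : IsSelfAdjoint x) (hy : IsSelfAdjoint y) :
    (x : Unitization ℂ B) ≤ y + ((‖x - y‖ : ℝ) : ℂ) • 1 := by
  have := IsSelfAdjoint.le_algebraMap_norm_self (a := ((x - y : B) : Unitization ℂ B))
    ((hx.sub hy).inr ℂ)
  rw [Unitization.norm_inr, Algebra.algebraMap_eq_smul_one, Unitization.inr_sub,
    sub_le_iff_le_add'] at this
  convert this using 2
  exact Complex.coe_smul (‖x - y‖) (1 : Unitization ℂ B)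

namespace Unitization

omit [PartialOrder B] [StarOrderedRing B]

/-- `x c`, for `x` in the algebra and `c` in the unitization, as an element of the algebra. -/
def rightMul (x : B) (c : Unitization ℂ B) : B := ((x : Unitization ℂ B) * c).snd

@[simp]
theorem coe_rightMul (x : B) (c : Unitization ℂ B) :
    ((rightMul x c : B) : Unitization ℂ B) = x * c := by
  ext <;> simp [rightMul]

/-- `c⋆ x c`, for `x` in the algebra and `c` in the unitization, as an element of the algebra. -/
def conj (c : Unitization ℂ B) (x : B) : B := (star c * (x : Unitization ℂ B) * c).snd

@[simp]
theorem coe_conj (c : Unitization ℂ B) (x : B) :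
    ((conj c x : B) : Unitization ℂ B) = star c * x * c := by
  ext <;> simp [conj]

omit [NonUnitalCStarAlgebra B] in
theorem coe_eq {x y : B} (h : (x : Unitization ℂ B) = y) : x = y := Unitization.inr_injective h

theorem conj_add (c : Unitization ℂ B) (x y : B) : conj c (x + y) = conj c x + conj c y :=
  coe_eq (by simp [mul_add, add_mul])

theorem star_rightMul_mul (x : B) (c : Unitization ℂ B) :
    star (rightMul x c) * rightMul x c = conj c (star x * x) :=
  coe_eq (by simp [mul_assoc])

end Unitization

open Unitization

theorem conj_nonneg (c : Unitization ℂ B) {x : B} (hx : 0 ≤ x) : 0 ≤ conj c x := by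
  rw [← Unitization.inr_nonneg_iff, coe_conj]
  exact star_left_conjugate_nonneg (Unitization.inr_nonneg_iff.2 hx) c

theorem coe_le_coe {x y : B} (hx : IsSelfAdjoint x) (hy : IsSelfAdjoint y) :
    (x : Unitization ℂ B) ≤ y ↔ x ≤ y := Unitization.inr_le_iff x y hx hy

theorem coe_le_coe' {x y : B} (hx : 0 ≤ x) (hy : 0 ≤ y) :
    (x : Unitization ℂ B) ≤ y ↔ x ≤ y :=
  coe_le_coe (IsSelfAdjoint.of_nonneg hx) (IsSelfAdjoint.of_nonneg hy)

theorem conj_le_conj (c : Unitization ℂ B) {x y : B} (hx : 0 ≤ x) (h : x ≤ y) :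
    conj c x ≤ conj c y := by
  rw [← coe_le_coe' (conj_nonneg c hx) (conj_nonneg c (hx.trans h)), coe_conj, coe_conj]
  exact star_left_conjugate_le_conjugate ((coe_le_coe' hx (hx.trans h)).2 h) c

end NonunitalOrder

/-! ### Traces as functions on the whole algebra -/

section TraceVal

variable {B : Type u} [NonUnitalCStarAlgebra B]

open Classical in
/-- The value of a trace at `x`, with the junk value `0` if `x` is not positive. -/
def CTrace.val (φ : CTrace B) (x : B) : ℝ≥0∞ :=
  if h : ∃ y, x = star y * y then φ.toFun ⟨x, h⟩ else 0

theorem CTrace.val_coe (φ : CTrace B) (x : PosElt B) : φ.val x.1 = φ.toFun x := by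
  rw [CTrace.val, dif_pos x.2]
  rfl

theorem CTrace.val_mk (φ : CTrace B) (x : B) (h : ∃ y, x = star y * y) :
    φ.toFun ⟨x, h⟩ = φ.val x := (φ.val_coe ⟨x, h⟩).symm

theorem CTrace.add_val (φ ψ : CTrace B) (x : B) : (φ + ψ).val x = φ.val x + ψ.val x := by
  unfold CTrace.val
  split_ifs
  · rfl
  · simp

theorem CTrace.smul_val (t : PosReal) (φ : CTrace B) (x : B) :
    (t • φ).val x = ENNReal.ofReal t.1 * φ.val x := by
  unfold CTrace.val
  split_ifs
  · rfl
  · simp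

variable [PartialOrder B] [StarOrderedRing B]

theorem CTrace.ext_val {φ ψ : CTrace B} (h : ∀ x, 0 ≤ x → φ.val x = ψ.val x) : φ = ψ :=
  CTrace.ext (funext fun x => by
    rw [← CTrace.val_coe, ← CTrace.val_coe, h _ (nonneg_iff_exists.2 x.2)])

variable (φ : CTrace B)

theorem CTrace.val_add {x y : B} (hx : 0 ≤ x) (hy : 0 ≤ y) :
    φ.val (x + y) = φ.val x + φ.val y := by
  rw [← φ.val_mk x (nonneg_iff_exists.1 hx), ← φ.val_mk y (nonneg_iff_exists.1 hy),
    ← φ.val_mk (x + y) (nonneg_iff_exists.1 (add_nonneg hx hy))]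
  exact φ.map_add' _ _ _ rfl

theorem CTrace.val_smul {t : ℝ} (ht : 0 ≤ t) {x : B} (hx : 0 ≤ x) :
    φ.val (((t : ℝ) : ℂ) • x) = ENNReal.ofReal t * φ.val x := by
  rw [← φ.val_mk x (nonneg_iff_exists.1 hx),
    ← φ.val_mk _ (nonneg_iff_exists.1 (real_smul_nonneg ht hx))]
  rw [ENNReal.ofReal, Real.toNNReal_of_nonneg ht]
  exact φ.map_smul' ⟨t, ht⟩ ⟨x, _⟩ ⟨_, _⟩ rfl

theorem CTrace.val_zero : φ.val 0 = 0 := by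
  have := φ.val_smul (le_refl 0) (le_refl (0 : B))
  simpa using this

theorem CTrace.val_mono {x y : B} (hx : 0 ≤ x) (h : x ≤ y) : φ.val x ≤ φ.val y := by
  have := φ.val_add hx (sub_nonneg.2 h)
  rw [add_sub_cancel] at this
  rw [this]
  exact le_self_add

theorem CTrace.val_sum {ι : Type*} (s : Finset ι) (f : ι → B) (hf : ∀ i ∈ s, 0 ≤ f i) :
    φ.val (∑ i ∈ s, f i) = ∑ i ∈ s, φ.val (f i) := by
  classical
  induction s using Finset.induction_on with
  | empty => simp [φ.val_zero]
  | insert a s ha ih =>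
    rw [Finset.sum_insert ha, Finset.sum_insert ha, φ.val_add (hf a (by simp))
      (Finset.sum_nonneg fun i hi => hf i (by simp [hi])), ih fun i hi => hf i (by simp [hi])]

theorem CTrace.val_nsmul (n : ℕ) {x : B} (hx : 0 ≤ x) : φ.val (n • x) = n * φ.val x := by
  have := φ.val_sum (Finset.range n) (fun _ => x) (fun _ _ => hx)
  simpa using this

open Unitization

theorem CTrace.val_unitary {w : Unitization ℂ B} (hw : w ∈ unitary (Unitization ℂ B)) {x : B}
    (hx : 0 ≤ x) : φ.val (conj w x) = φ.val x := by
  rw [← φ.val_mk x (nonneg_iff_exists.1 hx),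
    ← φ.val_mk _ (nonneg_iff_exists.1 (conj_nonneg w hx))]
  exact φ.map_unitary' w hw _ _ (coe_conj w x)

/-- The elements of finite trace are stable under `x ↦ c⋆ x c`, as the unitization is spanned by its
unitaries. -/
theorem CTrace.val_conj_ne_top {x : B} (hx : 0 ≤ x) (h : φ.val x ≠ ∞) (c : Unitization ℂ B) :
    φ.val (conj c x) ≠ ∞ := by
  have hc : c ∈ Submodule.span ℂ (unitary (Unitization ℂ B) : Set (Unitization ℂ B)) := by
    rw [CStarAlgebra.span_unitary]; trivial
  induction hc using Submodule.span_induction with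
  | mem w hw => rwa [φ.val_unitary hw hx]
  | zero =>
    have : conj (0 : Unitization ℂ B) x = 0 := coe_eq (by simp)
    rw [this, φ.val_zero]
    exact ENNReal.zero_ne_top
  | add a b _ _ ha hb =>
    obtain ⟨y, rfl⟩ := nonneg_iff_exists.1 hx
    have h1 := star_add_mul_add_le (rightMul y a) (rightMul y b)
    have h2 : rightMul y a + rightMul y b = rightMul y (a + b) := coe_eq (by simp [mul_add])
    rw [h2, star_rightMul_mul, star_rightMul_mul, star_rightMul_mul] at h1
    refine ne_top_of_le_ne_top ?_ (φ.val_mono (conj_nonneg _ hx) h1)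
    rw [φ.val_add (nsmul_nonneg (conj_nonneg _ hx) 2) (nsmul_nonneg (conj_nonneg _ hx) 2),
      φ.val_nsmul _ (conj_nonneg _ hx), φ.val_nsmul _ (conj_nonneg _ hx)]
    exact ENNReal.add_ne_top.2 ⟨ENNReal.mul_ne_top (by simp) ha, ENNReal.mul_ne_top (by simp) hb⟩
  | smul t a _ ha =>
    have h2 : conj (t • a) x = ((‖t‖ ^ 2 : ℝ) : ℂ) • conj a x := coe_eq (by
      simp only [coe_conj, star_smul, Unitization.inr_smul, smul_mul_assoc, mul_smul_comm, smul_smul]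
      congr 1
      rw [mul_comm]
      simpa using RCLike.conj_mul t)
    rw [h2, φ.val_smul (by positivity) (conj_nonneg _ hx)]
    exact ENNReal.mul_ne_top ENNReal.ofReal_ne_top ha

end TraceVal

/-! ### The trace property -/

section TraceProperty

variable {B : Type u} [NonUnitalCStarAlgebra B] [PartialOrder B] [StarOrderedRing B]

open Unitization

/-- The linear extension of a trace `φ` to the span of the positive elements of finite trace, as a
relation: `m` is a combination of four such elements with coefficients `1, -1, I, -I`, and `z` is
the corresponding combination of traces. The elements `m` are taken in the unitization. -/
def CTrace.HasTr (φ : CTrace B) (m : Unitization ℂ B) (z : ℂ) : Prop :=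
  ∃ a b c d : B, (0 ≤ a ∧ φ.val a ≠ ∞) ∧ (0 ≤ b ∧ φ.val b ≠ ∞) ∧ (0 ≤ c ∧ φ.val c ≠ ∞) ∧
    (0 ≤ d ∧ φ.val d ≠ ∞) ∧
    m = (a : Unitization ℂ B) - b + Complex.I • ((c : Unitization ℂ B) - d) ∧
    z = ((φ.val a).toReal - (φ.val b).toReal : ℂ) +
      Complex.I * ((φ.val c).toReal - (φ.val d).toReal : ℂ)

namespace CTrace

variable {φ : CTrace B}

theorem toReal_val_add {x y : B} (hx : 0 ≤ x ∧ φ.val x ≠ ∞) (hy : 0 ≤ y ∧ φ.val y ≠ ∞) :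
    (φ.val (x + y)).toReal = (φ.val x).toReal + (φ.val y).toReal := by
  rw [φ.val_add hx.1 hy.1, ENNReal.toReal_add hx.2 hy.2]

theorem fin_add {x y : B} (hx : 0 ≤ x ∧ φ.val x ≠ ∞) (hy : 0 ≤ y ∧ φ.val y ≠ ∞) :
    0 ≤ x + y ∧ φ.val (x + y) ≠ ∞ :=
  ⟨add_nonneg hx.1 hy.1, by rw [φ.val_add hx.1 hy.1]; exact ENNReal.add_ne_top.2 ⟨hx.2, hy.2⟩⟩

theorem fin_smul {x : B} {t : ℝ} (ht : 0 ≤ t) (hx : 0 ≤ x ∧ φ.val x ≠ ∞) :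
    0 ≤ ((t : ℝ) : ℂ) • x ∧ φ.val (((t : ℝ) : ℂ) • x) ≠ ∞ :=
  ⟨real_smul_nonneg ht hx.1, by
    rw [φ.val_smul ht hx.1]; exact ENNReal.mul_ne_top ENNReal.ofReal_ne_top hx.2⟩

theorem fin_conj {x : B} (c : Unitization ℂ B) (hx : 0 ≤ x ∧ φ.val x ≠ ∞) :
    0 ≤ conj c x ∧ φ.val (conj c x) ≠ ∞ :=
  ⟨conj_nonneg c hx.1, φ.val_conj_ne_top hx.1 hx.2 c⟩

theorem hasTr_of_nonneg {x : B} (hx : 0 ≤ x) (h : φ.val x ≠ ∞) :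
    φ.HasTr x ((φ.val x).toReal : ℂ) :=
  have h0 : 0 ≤ (0 : B) ∧ φ.val 0 ≠ ∞ := ⟨le_rfl, by simp [φ.val_zero]⟩
  ⟨x, 0, 0, 0, ⟨hx, h⟩, h0, h0, h0, by simp, by simp [φ.val_zero]⟩

theorem HasTr.add {m m' : Unitization ℂ B} {z z' : ℂ} (h : φ.HasTr m z) (h' : φ.HasTr m' z') :
    φ.HasTr (m + m') (z + z') := by
  obtain ⟨a, b, c, d, ha, hb, hc, hd, rfl, rfl⟩ := h
  obtain ⟨a', b', c', d', ha', hb', hc', hd', rfl, rfl⟩ := h'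
  refine ⟨a + a', b + b', c + c', d + d', fin_add ha ha', fin_add hb hb', fin_add hc hc',
    fin_add hd hd', ?_, ?_⟩
  · simp only [Unitization.inr_add, smul_sub, smul_add]
    abel
  · rw [toReal_val_add ha ha', toReal_val_add hb hb', toReal_val_add hc hc',
      toReal_val_add hd hd']
    push_cast
    ring

omit [StarOrderedRing B] in
theorem HasTr.neg {m : Unitization ℂ B} {z : ℂ} (h : φ.HasTr m z) : φ.HasTr (-m) (-z) := by
  obtain ⟨a, b, c, d, ha, hb, hc, hd, rfl, rfl⟩ := h
  refine ⟨b, a, d, c, hb, ha, hd, hc, ?_, by ring⟩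
  simp only [smul_sub]
  abel

omit [StarOrderedRing B] in
theorem HasTr.I_smul {m : Unitization ℂ B} {z : ℂ} (h : φ.HasTr m z) :
    φ.HasTr (Complex.I • m) (Complex.I * z) := by
  obtain ⟨a, b, c, d, ha, hb, hc, hd, rfl, rfl⟩ := h
  refine ⟨d, c, a, b, hd, hc, ha, hb, ?_, ?_⟩
  · rw [smul_add, smul_smul, Complex.I_mul_I]
    simp only [smul_sub, neg_smul, one_smul]
    abel
  · linear_combination ((φ.val c).toReal - (φ.val d).toReal : ℂ) * Complex.I_sq

theorem HasTr.pos_smul {m : Unitization ℂ B} {z : ℂ} (h : φ.HasTr m z) {t : ℝ} (ht : 0 ≤ t) :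
    φ.HasTr ((t : ℂ) • m) (t * z) := by
  obtain ⟨a, b, c, d, ha, hb, hc, hd, rfl, rfl⟩ := h
  refine ⟨(t : ℂ) • a, (t : ℂ) • b, (t : ℂ) • c, (t : ℂ) • d, fin_smul ht ha, fin_smul ht hb,
    fin_smul ht hc, fin_smul ht hd, ?_, ?_⟩
  · simp only [Unitization.inr_smul, smul_sub, smul_add]
    rw [smul_comm (t : ℂ) Complex.I, smul_comm (t : ℂ) Complex.I]
  · rw [φ.val_smul ht ha.1, φ.val_smul ht hb.1, φ.val_smul ht hc.1, φ.val_smul ht hd.1]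
    simp only [ENNReal.toReal_mul, ENNReal.toReal_ofReal ht]
    push_cast
    ring

theorem HasTr.real_smul {m : Unitization ℂ B} {z : ℂ} (h : φ.HasTr m z) (t : ℝ) :
    φ.HasTr ((t : ℂ) • m) (t * z) := by
  rcases le_total 0 t with ht | ht
  · exact h.pos_smul ht
  · have := (h.pos_smul (neg_nonneg.2 ht)).neg
    simpa using this

theorem HasTr.smul {m : Unitization ℂ B} {z : ℂ} (h : φ.HasTr m z) (t : ℂ) :
    φ.HasTr (t • m) (t * z) := by
  have := (h.real_smul t.re).add (h.real_smul t.im).I_smul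
  convert this using 1
  · rw [smul_smul, ← add_smul, mul_comm Complex.I, Complex.re_add_im]
  · nth_rw 1 [← Complex.re_add_im t]
    ring

theorem HasTr.conj {m : Unitization ℂ B} {z : ℂ} (h : φ.HasTr m z) {w : Unitization ℂ B}
    (hw : w ∈ unitary (Unitization ℂ B)) : φ.HasTr (star w * m * w) z := by
  obtain ⟨a, b, c, d, ha, hb, hc, hd, rfl, rfl⟩ := h
  refine ⟨Unitization.conj w a, Unitization.conj w b, Unitization.conj w c, Unitization.conj w d,
    fin_conj w ha, fin_conj w hb, fin_conj w hc, fin_conj w hd, ?_, ?_⟩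
  · simp only [coe_conj, mul_add, add_mul, mul_sub, sub_mul, mul_smul_comm, smul_mul_assoc]
  · rw [φ.val_unitary hw ha.1, φ.val_unitary hw hb.1, φ.val_unitary hw hc.1,
      φ.val_unitary hw hd.1]

theorem HasTr.unique {m : Unitization ℂ B} {z z' : ℂ} (h : φ.HasTr m z) (h' : φ.HasTr m z') :
    z = z' := by
  obtain ⟨a, b, c, d, ha, hb, hc, hd, rfl, rfl⟩ := h
  obtain ⟨a', b', c', d', ha', hb', hc', hd', h, rfl⟩ := h'
  have sa : ∀ {x : B}, 0 ≤ x → star x = x := fun hx => (IsSelfAdjoint.of_nonneg hx).star_eq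
  have e1 : a - b + Complex.I • (c - d) = a' - b' + Complex.I • (c' - d') :=
    coe_eq (by simpa using h)
  -- The selfadjoint and skew-adjoint parts of the two decompositions agree.
  have e2 := congrArg star e1
  simp only [star_add, star_sub, star_smul, sa ha.1, sa hb.1, sa hc.1, sa hd.1, sa ha'.1,
    sa hb'.1, sa hc'.1, sa hd'.1, Complex.star_def, Complex.conj_I, neg_smul] at e2
  have e3 : (2 : ℂ) • (a - b) = (2 : ℂ) • (a' - b') := by
    have := congrArg₂ (· + ·) e1 e2
    convert this using 1 <;> module
  have e4 : (2 : ℂ) • Complex.I • (c - d) = (2 : ℂ) • Complex.I • (c' - d') := by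
    have := congrArg₂ (· - ·) e1 e2
    convert this using 1 <;> module
  have e5 := smul_right_injective B (two_ne_zero (α := ℂ)) e3
  have e6 := smul_right_injective B Complex.I_ne_zero
    (smul_right_injective B (two_ne_zero (α := ℂ)) e4)
  have e7 : a + b' = a' + b := by rw [sub_eq_sub_iff_add_eq_add] at e5; exact e5
  have e8 : c + d' = c' + d := by rw [sub_eq_sub_iff_add_eq_add] at e6; exact e6
  have e9 := congrArg (fun x => ((φ.val x).toReal : ℂ)) e7
  have e10 := congrArg (fun x => ((φ.val x).toReal : ℂ)) e8
  simp only [toReal_val_add ha hb', toReal_val_add ha' hb, toReal_val_add hc hd',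
    toReal_val_add hc' hd, Complex.ofReal_add] at e9 e10
  linear_combination e9 + Complex.I * e10

/-- The domain of the linear extension is a left ideal. This is polarization:
`4 c a = ∑ₖ iᵏ (c + iᵏ) a (c + iᵏ)⋆`. -/
theorem exists_hasTr_mul {m : Unitization ℂ B} {z : ℂ} (h : φ.HasTr m z) (c : Unitization ℂ B) :
    ∃ z', φ.HasTr (c * m) z' := by
  have key : ∀ {a : B}, (0 ≤ a ∧ φ.val a ≠ ∞) →
      ∃ z', φ.HasTr (c * (a : Unitization ℂ B)) z' := by
    intro a ha
    have H : ∀ k : ℂ, ∃ z', φ.HasTr ((c + k • 1) * a * star (c + k • 1)) z' := fun k => by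
      have := fin_conj (star (c + k • 1)) ha
      have h1 := hasTr_of_nonneg this.1 this.2
      rw [coe_conj, star_star] at h1
      exact ⟨_, h1⟩
    obtain ⟨z0, h0⟩ := H 1
    obtain ⟨z1, h1⟩ := H Complex.I
    obtain ⟨z2, h2⟩ := H (-1)
    obtain ⟨z3, h3⟩ := H (-Complex.I)
    have h4 := ((((h0.add (h1.smul Complex.I)).add (h2.smul (-1))).add
      (h3.smul (-Complex.I)))).smul (1 / 4)
    refine ⟨1 / 4 * (z0 + Complex.I * z1 + -1 * z2 + -Complex.I * z3), ?_⟩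
    convert h4 using 1
    simp only [star_add, star_smul, star_one, star_neg, Complex.star_def, Complex.conj_I, mul_add,
      add_mul, smul_mul_assoc, mul_smul_comm, one_mul, mul_one, smul_add,
      smul_smul]
    match_scalars <;> ring_nf <;> norm_num [Complex.I_sq]
  obtain ⟨a, b, x, d, ha, hb, hx, hd, rfl, rfl⟩ := h
  obtain ⟨za, h1⟩ := key ha
  obtain ⟨zb, h2⟩ := key hb
  obtain ⟨zc, h3⟩ := key hx
  obtain ⟨zd, h4⟩ := key hd
  have := (h1.add h2.neg).add (h3.add h4.neg).I_smul
  refine ⟨za + -zb + Complex.I * (zc + -zd), ?_⟩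
  convert this using 1
  simp only [mul_add, mul_smul_comm, sub_eq_add_neg, mul_neg]

/-- The linear extension of a trace satisfies `φ(c m) = φ(m c)`. -/
theorem exists_hasTr_comm {m : Unitization ℂ B} {z : ℂ} (h : φ.HasTr m z) (c : Unitization ℂ B) :
    ∃ z', φ.HasTr (c * m) z' ∧ φ.HasTr (m * c) z' := by
  have hc : c ∈ Submodule.span ℂ (unitary (Unitization ℂ B) : Set (Unitization ℂ B)) := by
    rw [CStarAlgebra.span_unitary]; trivial
  induction hc using Submodule.span_induction with
  | mem w hw =>
    obtain ⟨z', hz'⟩ := exists_hasTr_mul h w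
    refine ⟨z', hz', ?_⟩
    have := hz'.conj hw
    rwa [← mul_assoc, Unitary.star_mul_self_of_mem hw, one_mul] at this
  | zero =>
    have := h.smul 0
    exact ⟨0 * z, by simpa using this, by simpa using this⟩
  | add a b _ _ ha hb =>
    obtain ⟨za, h1, h2⟩ := ha
    obtain ⟨zb, h3, h4⟩ := hb
    exact ⟨za + zb, by rw [add_mul]; exact h1.add h3, by rw [mul_add]; exact h2.add h4⟩
  | smul t a _ ha =>
    obtain ⟨za, h1, h2⟩ := ha
    exact ⟨t * za, by rw [smul_mul_assoc]; exact h1.smul t, by rw [mul_smul_comm]; exact h2.smul t⟩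

theorem val_eq_of_hasTr {x y : B} (hx : 0 ≤ x) (hx' : φ.val x ≠ ∞) (hy : 0 ≤ y)
    (hy' : φ.val y ≠ ∞) {z : ℂ} (h1 : φ.HasTr x z) (h2 : φ.HasTr y z) : φ.val x = φ.val y := by
  have e1 := h1.unique (hasTr_of_nonneg hx hx')
  have e2 := h2.unique (hasTr_of_nonneg hy hy')
  rw [e1] at e2
  exact (ENNReal.toReal_eq_toReal_iff' hx' hy').1 (by exact_mod_cast e2)

/-- If `φ m < ∞` and `m` commutes with `x⋆x`, then `φ(x m x⋆) = φ(m x⋆x)`. -/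
theorem val_conj_star_eq {m : B} (hm : 0 ≤ m) (hm' : φ.val m ≠ ∞) (x : B) (y : B) (hy : 0 ≤ y)
    (hyx : m * (star x * x) = y) (hy' : φ.val y ≠ ∞) : φ.val (x * m * star x) = φ.val y := by
  have h0 := hasTr_of_nonneg hm hm'
  obtain ⟨z, h1, h2⟩ := exists_hasTr_comm h0 (star (x : Unitization ℂ B))
  obtain ⟨z', h3, h4⟩ := exists_hasTr_comm h2 (x : Unitization ℂ B)
  have e : x * m * star x = conj (star (x : Unitization ℂ B)) m := coe_eq (by simp)
  have f := fin_conj (star (x : Unitization ℂ B)) ⟨hm, hm'⟩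
  rw [← e] at f
  refine val_eq_of_hasTr f.1 f.2 hy hy' (z := z') ?_ ?_
  · convert h3 using 1
    simp [mul_assoc]
  · convert h4 using 1
    rw [← hyx]
    simp [mul_assoc]

/-- A finite trace satisfies `φ(x⋆x) = φ(xx⋆)`. -/
theorem val_mul_star_of_finite (h : ∀ x, φ.toFun x ≠ ∞) (x : B) :
    φ.val (star x * x) = φ.val (x * star x) := by
  have hfin : ∀ y : B, φ.val y ≠ ∞ := fun y => by
    unfold CTrace.val
    split_ifs
    · exact h _
    · simp
  have hpos : ∀ y : B, ∃ z, φ.HasTr y z := by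
    intro y
    have hy : y ∈ Submodule.span ℂ {a : B | 0 ≤ a} := by
      rw [CStarAlgebra.span_nonneg]; trivial
    induction hy using Submodule.span_induction with
    | mem a ha => exact ⟨_, hasTr_of_nonneg ha (hfin a)⟩
    | zero => exact ⟨_, hasTr_of_nonneg le_rfl (hfin 0)⟩
    | add a b _ _ ha hb =>
      obtain ⟨z, hz⟩ := ha
      obtain ⟨z', hz'⟩ := hb
      exact ⟨_, by rw [Unitization.inr_add]; exact hz.add hz'⟩
    | smul t a _ ha =>
      obtain ⟨z, hz⟩ := ha
      exact ⟨_, by rw [Unitization.inr_smul]; exact hz.smul t⟩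
  obtain ⟨z, hz⟩ := hpos x
  obtain ⟨z', h1, h2⟩ := exists_hasTr_comm hz (star (x : Unitization ℂ B))
  exact val_eq_of_hasTr (star_mul_self_nonneg x) (hfin _) (mul_star_self_nonneg x) (hfin _)
    (z := z') (by simpa using h1) (by simpa using h2)

end CTrace

/-- Lower semicontinuity, in terms of norms. -/
theorem LscTrace.exists_delta (φ : LscTrace B) {x : B} (hx : 0 ≤ x) {c : ℝ≥0∞}
    (h : c < φ.1.val x) : ∃ δ > 0, ∀ y, 0 ≤ y → ‖y - x‖ < δ → c < φ.1.val y := by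
  rw [← φ.1.val_mk x (nonneg_iff_exists.1 hx)] at h
  have h1 := φ.2 ⟨x, nonneg_iff_exists.1 hx⟩ c h
  have h2 : nhds (⟨x, nonneg_iff_exists.1 hx⟩ : PosElt B) =
    Filter.comap Subtype.val (nhds x) := nhds_subtype_eq_comap
  obtain ⟨δ, hδ, H⟩ := (Metric.nhds_basis_ball.comap _).eventually_iff.1 (h2 ▸ h1)
  refine ⟨δ, hδ, fun y hy hyx => ?_⟩
  have := @H ⟨y, nonneg_iff_exists.1 hy⟩ (by
    show y ∈ Metric.ball x δ
    rwa [mem_ball_iff_norm])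
  rwa [← φ.1.val_mk y (nonneg_iff_exists.1 hy)]

theorem lowerSemicontinuous_of_val {φ : CTrace B}
    (h : ∀ x, 0 ≤ x → ∀ c < φ.val x, ∃ δ > 0, ∀ y, 0 ≤ y → ‖y - x‖ < δ → c < φ.val y) :
    LowerSemicontinuous φ.toFun := by
  intro x c hc
  rw [← φ.val_coe] at hc
  obtain ⟨δ, hδ, H⟩ := h x.1 (nonneg_iff_exists.2 x.2) c hc
  rw [show nhds x = Filter.comap Subtype.val (nhds x.1) from nhds_subtype_eq_comap]
  refine (Metric.nhds_basis_ball.comap _).eventually_iff.2 ⟨δ, hδ, fun {y} hy => ?_⟩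
  show c < φ.toFun y
  rw [← φ.val_coe]
  exact H y.1 (nonneg_iff_exists.2 y.2) (by rw [← mem_ball_iff_norm]; exact hy)

/-- It suffices to bound a lower semicontinuous trace near a point. -/
theorem LscTrace.val_le_of_approx (φ : LscTrace B) {x : B} (hx : 0 ≤ x) {c : ℝ≥0∞}
    (h : ∀ δ > 0, ∃ y, 0 ≤ y ∧ ‖y - x‖ < δ ∧ φ.1.val y ≤ c) : φ.1.val x ≤ c := by
  by_contra! hc
  obtain ⟨δ, hδ, H⟩ := φ.exists_delta hx hc
  obtain ⟨y, hy, hyx, hyc⟩ := h δ hδ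
  exact absurd (H y hy hyx) (not_lt.2 hyc)

theorem exists_inv_sqrt_add {s : B} (hs : 0 ≤ s) {ε : ℝ} (hε : 0 < ε) :
    ∃ r : Unitization ℂ B, star r = r ∧ r * (s + (ε : ℂ) • 1) * r = 1 ∧
      ∀ b, Commute b (s + (ε : ℂ) • 1 : Unitization ℂ B) → Commute b r :=
  exists_inv_sqrt hε (le_add_of_nonneg_left (Unitization.inr_nonneg_iff.2 hs))

omit [PartialOrder B] [StarOrderedRing B] in
theorem real_smul_one_nonneg {ε : ℝ} (hε : 0 ≤ ε) :
    0 ≤ ((ε : ℝ) : ℂ) • (1 : Unitization ℂ B) := by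
  rw [Complex.coe_smul]
  exact smul_nonneg hε zero_le_one

/-- Approximation from below in the ideal generated by `s`: with `r = (s + ε)^{-1/2}`, the element
`x^{1/2} r s r x^{1/2}` is below `x`, at distance at most `ε`. -/
theorem exists_conj_approx {x s : B} (hx : 0 ≤ x) (hs : 0 ≤ s) {ε : ℝ} (hε : 0 < ε)
    (h : (x : Unitization ℂ B) ≤ s + (ε : ℂ) • 1) :
    ∃ c : Unitization ℂ B, conj c s ≤ x ∧ ‖conj c s - x‖ ≤ ε := by
  obtain ⟨r, hr, hrs, -⟩ := exists_inv_sqrt_add hs hε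
  obtain ⟨y, hy, rfl⟩ := exists_selfAdjoint_mul_self hx
  have h1 : y * y - conj (r * (y : Unitization ℂ B)) s =
      (ε : ℂ) • (star (star (rightMul y r)) * star (rightMul y r)) := coe_eq (by
    have : (y : Unitization ℂ B) * y = y * (r * (s + (ε : ℂ) • 1) * r) * y := by
      rw [hrs, mul_one]
    have hy' : star (y : Unitization ℂ B) = y := by rw [← Unitization.inr_star, hy]
    rw [Unitization.inr_sub, Unitization.inr_mul, this]
    simp only [coe_conj, star_mul, hr, Unitization.inr_star, hy', Unitization.inr_smul, star_star,
      Unitization.inr_mul, coe_rightMul, mul_add, add_mul, mul_smul_comm, smul_mul_assoc, mul_one,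
      mul_assoc, add_sub_cancel_left])
  have h2 : ‖rightMul y r‖ ^ 2 ≤ 1 := by
    have e : star (rightMul y r) * rightMul y r = conj r (y * y) := by
      rw [star_rightMul_mul, hy]
    rw [sq, ← CStarRing.norm_star_mul_self, e]
    refine norm_le_of_le_smul_one (conj_nonneg r hx) zero_le_one ?_
    rw [coe_conj, hr]
    simpa using conj_le_one hr hrs h
  refine ⟨r * y, ?_, ?_⟩
  · rw [← sub_nonneg, h1]
    exact real_smul_nonneg hε.le (star_mul_self_nonneg _)
  · rw [norm_sub_rev, h1, norm_smul, CStarRing.norm_star_mul_self, norm_star, ← sq]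
    calc _ ≤ ‖(ε : ℂ)‖ * 1 := by gcongr
      _ = ε := by simp [abs_of_pos hε]

/-- One half of `φ(x⋆x) = φ(xx⋆)` for lower semicontinuous traces. With `a = x⋆x` and
`m = a (a + ε)⁻¹`, of finite trace if `φ a < ∞`, the element `x m x⋆` approximates `x x⋆`, and
`φ(x m x⋆) = φ(m a) ≤ φ(a)`. -/
theorem LscTrace.val_mul_star_le (φ : LscTrace B) (x : B) :
    φ.1.val (x * star x) ≤ φ.1.val (star x * x) := by
  by_cases hfin : φ.1.val (star x * x) = ∞
  · rw [hfin]; exact le_top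
  have ha := star_mul_self_nonneg x
  refine φ.val_le_of_approx (mul_star_self_nonneg x) fun δ hδ => ?_
  have hε : 0 < δ / 2 := half_pos hδ
  set ε := δ / 2
  obtain ⟨r, hr, hrs, hcomm⟩ := exists_inv_sqrt_add ha hε
  set a := star x * x with ha_def
  have hra : Commute (a : Unitization ℂ B) r :=
    hcomm _ ((Commute.refl _).add_right ((Commute.one_right _).smul_right _))
  have e1 : conj r a * a = conj r (a * a) := coe_eq (by
    simp only [coe_conj, Unitization.inr_mul, hr]
    simp only [mul_assoc]
    rw [hra.eq])
  have haa : 0 ≤ a * a := by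
    have := star_mul_self_nonneg a
    rwa [(IsSelfAdjoint.of_nonneg ha).star_eq] at this
  have e2 : a - conj r (a * a) = (ε : ℂ) • conj r a := coe_eq (by
    have : (a : Unitization ℂ B) = r * (a + (ε : ℂ) • 1) * a * r := by
      rw [mul_assoc, hra.eq, ← mul_assoc, hrs, one_mul]
    rw [Unitization.inr_sub]
    nth_rw 1 [this]
    simp only [coe_conj, hr, Unitization.inr_smul, Unitization.inr_mul, mul_add, add_mul,
      mul_smul_comm, smul_mul_assoc, mul_one, mul_assoc, add_sub_cancel_left])
  have hle : conj r (a * a) ≤ a := by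
    rw [← sub_nonneg, e2]
    exact real_smul_nonneg hε.le (conj_nonneg r ha)
  have hle' := φ.1.val_mono (conj_nonneg r haa) hle
  have e3 := CTrace.val_conj_star_eq (conj_nonneg r ha) (φ.1.val_conj_ne_top ha hfin r) x
    (conj r (a * a)) (conj_nonneg r haa) e1 (ne_top_of_le_ne_top hfin hle')
  refine ⟨x * conj r a * star x, star_right_conjugate_nonneg (conj_nonneg r ha) x, ?_,
    e3.trans_le hle'⟩
  have e4 : x * star x - x * conj r a * star x =
      (ε : ℂ) • (rightMul x r * star (rightMul x r)) := coe_eq (by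
    have : (x : Unitization ℂ B) * star (x : Unitization ℂ B) =
        x * (r * (a + (ε : ℂ) • 1) * r) * star (x : Unitization ℂ B) := by
      rw [hrs, mul_one]
    rw [Unitization.inr_sub, Unitization.inr_mul, Unitization.inr_star, this]
    simp only [coe_conj, hr, Unitization.inr_smul, Unitization.inr_star, Unitization.inr_mul,
      coe_rightMul, star_mul, mul_add, add_mul, mul_smul_comm, smul_mul_assoc, mul_one, mul_assoc,
      add_sub_cancel_left])
  have h2 : ‖rightMul x r‖ ^ 2 ≤ 1 := by
    rw [sq, ← CStarRing.norm_star_mul_self, star_rightMul_mul]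
    refine norm_le_of_le_smul_one (conj_nonneg r ha) zero_le_one ?_
    rw [coe_conj, hr]
    simpa using conj_le_one hr hrs (le_add_of_nonneg_right (real_smul_one_nonneg hε.le))
  rw [norm_sub_rev, e4, norm_smul, CStarRing.norm_self_mul_star, ← sq]
  calc _ ≤ ‖(ε : ℂ)‖ * 1 := by gcongr
    _ = ε := by simp [abs_of_pos hε]
    _ < δ := half_lt_self hδ

/-- A lower semicontinuous trace satisfies `φ(x⋆x) = φ(xx⋆)`. -/
theorem LscTrace.val_mul_star (φ : LscTrace B) (x : B) :
    φ.1.val (star x * x) = φ.1.val (x * star x) := by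
  refine le_antisymm ?_ (φ.val_mul_star_le x)
  have := φ.val_mul_star_le (star x)
  rwa [star_star] at this

omit [PartialOrder B] [StarOrderedRing B]

theorem CTrace.val_add_of_exists (φ : CTrace B) {x y : B} (hx : ∃ z, x = star z * z)
    (hy : ∃ z, y = star z * z) : φ.val (x + y) = φ.val x + φ.val y := by
  let _ := CStarAlgebra.spectralOrder B
  have := CStarAlgebra.spectralOrderedRing B
  exact φ.val_add (nonneg_iff_exists.2 hx) (nonneg_iff_exists.2 hy)

theorem CTrace.val_smul_of_exists (φ : CTrace B) {t : ℝ} (ht : 0 ≤ t) {x : B}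
    (hx : ∃ z, x = star z * z) : φ.val (((t : ℝ) : ℂ) • x) = ENNReal.ofReal t * φ.val x := by
  let _ := CStarAlgebra.spectralOrder B
  have := CStarAlgebra.spectralOrderedRing B
  exact φ.val_smul ht (nonneg_iff_exists.2 hx)

theorem FinTrace.val_mul_star (φ : FinTrace B) (x : B) :
    φ.1.val (star x * x) = φ.1.val (x * star x) := by
  let _ := CStarAlgebra.spectralOrder B
  have := CStarAlgebra.spectralOrderedRing B
  exact CTrace.val_mul_star_of_finite φ.2 x

theorem FinTrace.val_ne_top (φ : FinTrace B) (x : B) : φ.1.val x ≠ ∞ := by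
  unfold CTrace.val
  split_ifs
  · exact φ.2 _
  · simp

/-- A trace from a function with the trace property. -/
def CTrace.ofTracial (f : B → ℝ≥0∞)
    (hsmul : ∀ (t : ℝ≥0) (x : B), (∃ z, x = star z * z) → f (((t : ℝ) : ℂ) • x) = t * f x)
    (hadd : ∀ x y, (∃ z, x = star z * z) → (∃ z, y = star z * z) → f (x + y) = f x + f y)
    (htr : ∀ x, f (star x * x) = f (x * star x)) : CTrace B where
  toFun x := f x.1
  map_smul' c x y h := by rw [h]; exact hsmul c x.1 x.2
  map_add' x y z h := by rw [h]; exact hadd x.1 y.1 x.2 y.2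
  map_unitary' w hw x y h := by
    obtain ⟨x, b, rfl⟩ := x
    have e1 : y.1 = star (rightMul b w) * rightMul b w := coe_eq (by
      rw [h]; simp [mul_assoc])
    have e2 : rightMul b w * star (rightMul b w) = b * star b := coe_eq (by
      simp only [Unitization.inr_mul, Unitization.inr_star, coe_rightMul, star_mul]
      rw [mul_assoc, ← mul_assoc w, Unitary.mul_star_self_of_mem hw, one_mul])
    simp only [e1]
    rw [htr, e2, htr]

theorem CTrace.ofTracial_val (f : B → ℝ≥0∞) (hsmul hadd htr) {x : B} (hx : ∃ z, x = star z * z) :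
    (CTrace.ofTracial f hsmul hadd htr).val x = f x := by
  rw [← CTrace.val_mk _ x hx]
  rfl

end TraceProperty

/-! ### Closed ideals generated by cones of positive elements -/

section ConjCones

open Unitization

/-- A cone of positive elements which is invariant under `s ↦ c⋆ s c`, for all `c` in the
unitization. -/
structure ConjCone (B : Type u) [NonUnitalCStarAlgebra B] [PartialOrder B] where
  carrier : Set B
  nonneg : ∀ {s}, s ∈ carrier → 0 ≤ s
  zero_mem : 0 ∈ carrier
  add_mem : ∀ {s t}, s ∈ carrier → t ∈ carrier → s + t ∈ carrier
  conj_mem : ∀ (c : Unitization ℂ B) {s}, s ∈ carrier → conj c s ∈ carrier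

variable {B : Type u} [NonUnitalCStarAlgebra B] [PartialOrder B] [StarOrderedRing B]

omit [PartialOrder B] [StarOrderedRing B] in
theorem conj_scalar {t : ℝ} (ht : 0 ≤ t) (x : B) :
    conj (((√t : ℝ) : ℂ) • (1 : Unitization ℂ B)) x = (t : ℂ) • x := coe_eq (by
  simp only [coe_conj, star_smul, star_one, smul_mul_assoc, mul_smul_comm, one_mul, mul_one,
    smul_smul, Unitization.inr_smul, Complex.star_def, Complex.conj_ofReal]
  rw [← Complex.ofReal_mul, Real.mul_self_sqrt ht])

namespace ConjCone

variable (S : ConjCone B)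

omit [StarOrderedRing B] in
theorem smul_mem {t : ℝ} (ht : 0 ≤ t) {s : B} (hs : s ∈ S.carrier) :
    (t : ℂ) • s ∈ S.carrier := by
  rw [← conj_scalar ht]
  exact S.conj_mem _ hs

/-- `x` is dominated, up to every `ε`, by elements of the cone. -/
def Dom (x : B) : Prop := ∀ ε : ℝ, 0 < ε → ∃ s ∈ S.carrier,
  (x : Unitization ℂ B) ≤ s + (ε : ℂ) • 1

variable {S}

theorem Dom.mono {x y : B} (h : S.Dom y) (hxy : x ≤ y) (hx : IsSelfAdjoint x)
    (hy : IsSelfAdjoint y) : S.Dom x := fun ε hε => by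
  obtain ⟨s, hs, h⟩ := h ε hε
  exact ⟨s, hs, ((coe_le_coe hx hy).2 hxy).trans h⟩

omit [StarOrderedRing B] in
theorem Dom.add {x y : B} (h : S.Dom x) (h' : S.Dom y) : S.Dom (x + y) := fun ε hε => by
  obtain ⟨s, hs, h⟩ := h _ (half_pos hε)
  obtain ⟨t, ht, h'⟩ := h' _ (half_pos hε)
  refine ⟨s + t, S.add_mem hs ht, ?_⟩
  have := add_le_add h h'
  rw [Unitization.inr_add, Unitization.inr_add]
  convert this using 1
  push_cast
  module

omit [StarOrderedRing B] in
theorem Dom.conj {x : B} (h : S.Dom x) (c : B) : S.Dom (star c * x * c) := fun ε hε => by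
  have h0 : 0 < ‖c‖ ^ 2 + 1 := by positivity
  obtain ⟨s, hs, h⟩ := h (ε / (‖c‖ ^ 2 + 1)) (by positivity)
  refine ⟨Unitization.conj c s, S.conj_mem c hs, ?_⟩
  have h1 := star_left_conjugate_le_conjugate h (c : Unitization ℂ B)
  simp only [Unitization.inr_mul, Unitization.inr_star, coe_conj]
  refine h1.trans ?_
  rw [mul_add, add_mul]
  refine add_le_add le_rfl ?_
  rw [mul_smul_comm, mul_one, smul_mul_assoc]
  have h2 := star_mul_self_le_norm c
  rw [Unitization.inr_mul, Unitization.inr_star] at h2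
  refine (real_smul_le (by positivity) h2).trans ?_
  rw [smul_smul, ← Complex.ofReal_mul]
  refine real_smul_le_of_le ?_ zero_le_one
  rw [div_mul_eq_mul_div, div_le_iff₀ h0]
  nlinarith [sq_nonneg ‖c‖]

omit [StarOrderedRing B] in
theorem Dom.smul {x : B} (h : S.Dom x) {t : ℝ} (ht : 0 ≤ t) : S.Dom ((t : ℂ) • x) :=
  fun ε hε => by
  obtain ⟨s, hs, h⟩ := h (ε / (t + 1)) (by positivity)
  refine ⟨(t : ℂ) • s, S.smul_mem ht hs, ?_⟩
  rw [Unitization.inr_smul, Unitization.inr_smul]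
  refine (real_smul_le ht h).trans ?_
  rw [smul_add, smul_smul, ← Complex.ofReal_mul]
  refine add_le_add le_rfl (real_smul_le_of_le ?_ zero_le_one)
  rw [← mul_div_assoc, div_le_iff₀ (by positivity)]
  nlinarith

omit [StarOrderedRing B] in
theorem dom_of_mem {s : B} (hs : s ∈ S.carrier) : S.Dom s := fun _ hε =>
  ⟨s, hs, le_add_of_nonneg_right (real_smul_one_nonneg hε.le)⟩

variable (S)

/-- The closed two-sided ideal generated by the cone: the elements `x` such that `x⋆x` is
dominated, up to every `ε`, by elements of the cone. -/
def ideal : TwoSidedIdeal B :=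
  TwoSidedIdeal.mk' {x | S.Dom (star x * x)}
    (by simpa using dom_of_mem S.zero_mem)
    (fun {x y} hx hy => by
      have h2 := (hx.add hx).add (hy.add hy)
      rw [← two_nsmul, ← two_nsmul] at h2
      exact h2.mono (star_add_mul_add_le x y) (.star_mul_self _)
        (.of_nonneg (add_nonneg (nsmul_nonneg (star_mul_self_nonneg x) 2)
          (nsmul_nonneg (star_mul_self_nonneg y) 2))))
    (fun {x} hx => by simpa using hx)
    (fun {a x} hx => by
      have h := CStarAlgebra.star_left_conjugate_le_norm_smul (a := x) (b := star a * a)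
        (.star_mul_self a)
      rw [← Complex.coe_smul] at h
      refine (hx.smul (norm_nonneg (star a * a))).mono ?_ (.star_mul_self _)
        (IsSelfAdjoint.of_nonneg (real_smul_nonneg (norm_nonneg _) (star_mul_self_nonneg x)))
      simpa [mul_assoc] using h)
    (fun {x a} hx => by
      have h := hx.conj a
      show S.Dom _
      simpa [mul_assoc] using h)

variable {S}

theorem mem_ideal {x : B} : x ∈ S.ideal ↔ S.Dom (star x * x) := by
  unfold ideal
  rw [TwoSidedIdeal.mem_mk']
  rfl

/-- For positive elements, membership in the ideal does not require squares. -/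
theorem mem_ideal_of_nonneg {x : B} (hx : 0 ≤ x) : x ∈ S.ideal ↔ S.Dom x := by
  have hsx : star x = x := (IsSelfAdjoint.of_nonneg hx).star_eq
  rw [mem_ideal, hsx]
  refine ⟨fun h ε hε => ?_, fun h => ?_⟩
  · obtain ⟨s, hs, h⟩ := h (ε ^ 2) (by positivity)
    refine ⟨((1 / (2 * ε) : ℝ) : ℂ) • s, S.smul_mem (by positivity) hs, ?_⟩
    set X := (x : Unitization ℂ B)
    have hX : star X = X := by rw [← Unitization.inr_star, hsx]
    -- `2 ε x = x² + ε² - (x - ε)²`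
    have h1 : X = ((1 / (2 * ε) : ℝ) : ℂ) • (X * X + ((ε ^ 2 : ℝ) : ℂ) • 1 -
        star (X - (ε : ℂ) • 1) * (X - (ε : ℂ) • 1)) := by
      simp only [star_sub, star_smul, star_one, hX, Complex.star_def, Complex.conj_ofReal, mul_sub,
        sub_mul, mul_smul_comm, smul_mul_assoc, mul_one, one_mul, smul_sub, smul_add, smul_smul]
      have : (ε : ℂ) ≠ 0 := by exact_mod_cast hε.ne'
      match_scalars <;> field_simp <;> ring
    rw [h1, Unitization.inr_smul]
    have h2 : X * X + ((ε ^ 2 : ℝ) : ℂ) • 1 -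
        star (X - (ε : ℂ) • 1) * (X - (ε : ℂ) • 1) ≤ s + ((2 * ε ^ 2 : ℝ) : ℂ) • 1 := by
      refine (sub_le_self _ (star_mul_self_nonneg _)).trans ?_
      rw [Unitization.inr_mul] at h
      refine (add_le_add_left h _).trans (le_of_eq ?_)
      push_cast
      module
    refine (real_smul_le (by positivity) h2).trans (le_of_eq ?_)
    rw [smul_add, smul_smul, ← Complex.ofReal_mul]
    congr 4
    field_simp
  · obtain ⟨y, hy, hyx⟩ := exists_selfAdjoint_mul_self hx
    have h1 := CStarAlgebra.star_left_conjugate_le_norm_smul (a := y) (b := x)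
      (IsSelfAdjoint.of_nonneg hx)
    rw [← Complex.coe_smul, hy, hyx] at h1
    have h2 : y * x * y = x * x := by rw [← hyx]; simp only [mul_assoc]
    rw [h2] at h1
    have h3 := IsSelfAdjoint.star_mul_self x
    rw [hsx] at h3
    exact (h.smul (norm_nonneg x)).mono h1 h3
      (IsSelfAdjoint.of_nonneg (real_smul_nonneg (norm_nonneg _) hx))

theorem star_mul_self_mem_ideal {x : B} : star x * x ∈ S.ideal ↔ x ∈ S.ideal := by
  rw [mem_ideal_of_nonneg (star_mul_self_nonneg x), mem_ideal]

theorem subset_ideal {s : B} (hs : s ∈ S.carrier) : s ∈ S.ideal :=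
  (mem_ideal_of_nonneg (S.nonneg hs)).2 (dom_of_mem hs)

theorem mem_ideal_of_le {x y : B} (hx : 0 ≤ x) (hxy : x ≤ y) (hy : y ∈ S.ideal) :
    x ∈ S.ideal := by
  rw [mem_ideal_of_nonneg (hx.trans hxy)] at hy
  rw [mem_ideal_of_nonneg hx]
  exact hy.mono hxy (.of_nonneg hx) (.of_nonneg (hx.trans hxy))

theorem add_mem_ideal_iff {x y : B} (hx : 0 ≤ x) (hy : 0 ≤ y) :
    x + y ∈ S.ideal ↔ x ∈ S.ideal ∧ y ∈ S.ideal :=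
  ⟨fun h => ⟨mem_ideal_of_le hx (le_add_of_nonneg_right hy) h,
    mem_ideal_of_le hy (le_add_of_nonneg_left hx) h⟩, fun h => S.ideal.add_mem h.1 h.2⟩

theorem smul_mem_ideal {x : B} (hx : 0 ≤ x) {t : ℝ} (ht : 0 ≤ t) (h : x ∈ S.ideal) :
    (t : ℂ) • x ∈ S.ideal := by
  rw [mem_ideal_of_nonneg (real_smul_nonneg ht hx)]
  exact ((mem_ideal_of_nonneg hx).1 h).smul ht

theorem conj_mem_ideal {x : B} (hx : 0 ≤ x) (c : Unitization ℂ B) (h : x ∈ S.ideal) :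
    conj c x ∈ S.ideal := by
  obtain ⟨y, rfl⟩ := nonneg_iff_exists.1 hx
  rw [star_mul_self_mem_ideal] at h
  rw [← star_rightMul_mul, star_mul_self_mem_ideal]
  have : rightMul y c = c.fst • y + y * c.snd := by
    unfold rightMul
    simp
  have h2 : c.fst • y ∈ S.ideal := by
    rw [mem_ideal] at h ⊢
    convert h.smul (sq_nonneg ‖c.fst‖) using 1
    rw [star_smul, smul_mul_assoc, mul_smul_comm, smul_smul]
    congr 1
    simpa using RCLike.conj_mul c.fst
  rw [this]
  exact S.ideal.add_mem h2 (S.ideal.mul_mem_right _ _ h)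

theorem isClosed_ideal : IsClosed (S.ideal : Set B) := by
  rw [← isSeqClosed_iff_isClosed]
  intro f x hf hfx
  show x ∈ S.ideal
  rw [mem_ideal]
  intro ε hε
  obtain ⟨n, hn⟩ := (Metric.tendsto_atTop.1 hfx (√(ε / 4)) (by positivity))
  have hn := hn n le_rfl
  have h1 : S.Dom (star (f n) * f n + star (f n) * f n) :=
    (mem_ideal.1 (hf n)).add (mem_ideal.1 (hf n))
  obtain ⟨s, hs, h2⟩ := h1 (ε / 2) (half_pos hε)
  refine ⟨s, hs, ?_⟩
  -- `x⋆x ≤ 2 f_n⋆ f_n + 2 (x - f_n)⋆ (x - f_n)`, and the last term is at most `ε / 2`.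
  have h3 := star_add_mul_add_le (f n) (x - f n)
  rw [add_sub_cancel] at h3
  have h4 := star_mul_self_le_norm (x - f n)
  have h5 : ‖x - f n‖ ^ 2 ≤ ε / 4 := by
    rw [dist_comm, dist_eq_norm] at hn
    calc _ ≤ (√(ε / 4)) ^ 2 := by gcongr
      _ = _ := Real.sq_sqrt (by positivity)
  have h6 : ((star (x - f n) * (x - f n) : B) : Unitization ℂ B) ≤ ((ε / 4 : ℝ) : ℂ) • 1 :=
    h4.trans (real_smul_le_of_le h5 zero_le_one)
  refine ((coe_le_coe (.star_mul_self _) (.of_nonneg (add_nonneg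
    (nsmul_nonneg (star_mul_self_nonneg _) 2) (nsmul_nonneg (star_mul_self_nonneg _) 2)))).2 h3).trans
    ?_
  rw [Unitization.inr_add, two_nsmul, two_nsmul, Unitization.inr_add _ (star (x - f n) * _)]
  refine (add_le_add h2 (add_le_add h6 h6)).trans (le_of_eq ?_)
  push_cast
  module

variable (S)

open Classical in
/-- The trace which vanishes on the closed ideal generated by the cone, and is infinite
elsewhere. -/
def indicator : LscTrace B :=
  ⟨{ toFun := fun x => if x.1 ∈ S.ideal then 0 else ∞
     map_smul' := fun c x y h => by
       have hx : 0 ≤ x.1 := nonneg_iff_exists.2 x.2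
       by_cases hc : c = 0
       · simp [h, hc, S.ideal.zero_mem]
       by_cases hxS : x.1 ∈ S.ideal
       · rw [if_pos hxS, if_pos (by rw [h]; exact smul_mem_ideal hx c.2 hxS), mul_zero]
       · have : y.1 ∉ S.ideal := fun hy => hxS (by
           have h1 := smul_mem_ideal (hx := nonneg_iff_exists.2 y.2) (inv_nonneg.2 c.2) hy
           rwa [h, smul_smul, ← Complex.ofReal_mul, NNReal.val_eq_coe,
             inv_mul_cancel₀ (by exact_mod_cast hc), Complex.ofReal_one, one_smul] at h1)
         rw [if_neg hxS, if_neg this, ENNReal.mul_top (by exact_mod_cast hc)]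
     map_add' := fun x y z h => by
       rw [h]
       have := add_mem_ideal_iff (S := S) (nonneg_iff_exists.2 x.2) (nonneg_iff_exists.2 y.2)
       by_cases hx : x.1 ∈ S.ideal <;> by_cases hy : y.1 ∈ S.ideal <;> simp [this, hx, hy]
     map_unitary' := fun w hw x y h => by
       have hx : 0 ≤ x.1 := nonneg_iff_exists.2 x.2
       have e1 : y.1 = conj w x.1 := coe_eq (by rw [h, coe_conj])
       have e2 : x.1 = conj (star w) y.1 := coe_eq (by
         have h1 := Unitary.mul_star_self_of_mem hw
         rw [coe_conj, h, star_star]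
         calc _ = (w * star w) * (x.1 : Unitization ℂ B) * (w * star w) := by rw [h1]; simp
           _ = _ := by simp only [mul_assoc])
       have : y.1 ∈ S.ideal ↔ x.1 ∈ S.ideal :=
         ⟨fun hy => by rw [e2]; exact conj_mem_ideal (nonneg_iff_exists.2 y.2) _ hy,
          fun hy => by rw [e1]; exact conj_mem_ideal hx _ hy⟩
       simp only [this] }, by
    refine lowerSemicontinuous_iff_isClosed_preimage.2 fun c => ?_
    rcases eq_or_ne c ∞ with rfl | hc
    · simp
    · have : (fun x : PosElt B => if x.1 ∈ S.ideal then (0 : ℝ≥0∞) else ∞) ⁻¹' Set.Iic c =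
          Subtype.val ⁻¹' (S.ideal : Set B) := by
        ext x
        show (if x.1 ∈ S.ideal then (0 : ℝ≥0∞) else ∞) ≤ c ↔ x.1 ∈ S.ideal
        split_ifs with h <;> simp [h, hc]
      rw [this]
      exact isClosed_ideal.preimage continuous_subtype_val⟩

theorem indicator_val_of_mem {x : B} (h : x ∈ S.ideal) :
    S.indicator.1.val x = 0 := by
  unfold CTrace.val
  split_ifs
  · exact if_pos h
  · rfl

theorem indicator_val_of_notMem {x : B} (hx : 0 ≤ x) (h : x ∉ S.ideal) :
    S.indicator.1.val x = ∞ := by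
  rw [← CTrace.val_mk _ _ (nonneg_iff_exists.1 hx)]
  exact if_neg h

end ConjCone

end ConjCones

/-! ### The smallest extension of a finite trace from a corner -/

section Extension

open Unitization

variable {B : Type u} [NonUnitalCStarAlgebra B] [PartialOrder B] [StarOrderedRing B]

/-- `x` is a positive element of the corner `p B p`. -/
def PosIn (p x : B) : Prop := 0 ≤ x ∧ p * x = x ∧ x * p = x

/-- A finite trace on the corner `p B p`, as a function on `B` which is only meaningful at positive
elements of the corner. -/
structure CornerTrace (p : B) where
  val : B → ℝ≥0∞
  val_add : ∀ {x y}, PosIn p x → PosIn p y → val (x + y) = val x + val y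
  val_smul : ∀ {t : ℝ} {x}, 0 ≤ t → PosIn p x → val (((t : ℝ) : ℂ) • x) = ENNReal.ofReal t * val x
  val_mul_star : ∀ y, p * y = y → y * p = y → val (star y * y) = val (y * star y)
  ne_top : val p ≠ ∞

theorem PosIn.add {p x y : B} (hx : PosIn p x) (hy : PosIn p y) : PosIn p (x + y) :=
  ⟨add_nonneg hx.1 hy.1, by rw [mul_add, hx.2.1, hy.2.1], by rw [add_mul, hx.2.2, hy.2.2]⟩

theorem PosIn.smul {p x : B} (hx : PosIn p x) {t : ℝ} (ht : 0 ≤ t) :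
    PosIn p (((t : ℝ) : ℂ) • x) :=
  ⟨real_smul_nonneg ht hx.1, by rw [mul_smul_comm, hx.2.1], by rw [smul_mul_assoc, hx.2.2]⟩

omit [StarOrderedRing B] in
theorem posIn_zero (p : B) : PosIn p 0 := ⟨le_rfl, mul_zero _, zero_mul _⟩

theorem posIn_sum {p : B} {ι : Type*} (s : Finset ι) (f : ι → B) (hf : ∀ i ∈ s, PosIn p (f i)) :
    PosIn p (∑ i ∈ s, f i) :=
  ⟨Finset.sum_nonneg fun i hi => (hf i hi).1,
    by rw [Finset.mul_sum]; exact Finset.sum_congr rfl fun i hi => (hf i hi).2.1,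
    by rw [Finset.sum_mul]; exact Finset.sum_congr rfl fun i hi => (hf i hi).2.2⟩

theorem posIn_mul_star {p v : B} (hp : IsStarProjection p) (hv : p * v = v) :
    PosIn p (v * star v) := by
  have h : star v * p = star v := by
    rw [← hp.isSelfAdjoint.star_eq, ← star_mul, hv]
  exact ⟨mul_star_self_nonneg v, by rw [← mul_assoc, hv], by rw [mul_assoc, h]⟩

theorem posIn_self {p : B} (hp : IsStarProjection p) : PosIn p p :=
  ⟨hp.nonneg, hp.isIdempotentElem.eq, hp.isIdempotentElem.eq⟩

/-- Positive elements of the corner have square roots in the corner. -/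
theorem PosIn.exists_sqrt {p x : B} (hp : IsStarProjection p) (hx : PosIn p x) :
    ∃ y, star y = y ∧ y * y = x ∧ p * y = y ∧ y * p = y := by
  obtain ⟨y, hy, hyx⟩ := exists_selfAdjoint_mul_self hx.1
  have hps := hp.isSelfAdjoint.star_eq
  have h1 : y * p = y := by
    have : star (y - y * p) * (y - y * p) = 0 := by
      simp only [star_sub, star_mul, hps, hy, mul_sub, sub_mul]
      rw [hyx, mul_assoc, hyx, hx.2.1, ← mul_assoc, hyx, hx.2.2, mul_assoc, ← mul_assoc y y p,
        hyx, hx.2.2, hx.2.1]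
      abel
    rw [CStarRing.star_mul_self_eq_zero_iff, sub_eq_zero] at this
    exact this.symm
  refine ⟨y, hy, hyx, ?_, h1⟩
  have := congrArg star h1
  rwa [star_mul, hps, hy] at this

/-- If `v⋆v` is dominated by an element of the corner of `p`, then `v = v p`. -/
theorem mul_eq_of_star_mul_self_le {p x v : B} (hx : PosIn p x)
    (h : star v * v ≤ x) : v * p = v := by
  have h1 := conj_le_conj (1 - (p : Unitization ℂ B)) (star_mul_self_nonneg v) h
  have h2 : conj (1 - (p : Unitization ℂ B)) x = 0 := coe_eq (by
    rw [coe_conj, mul_assoc, mul_sub, mul_one, ← Unitization.inr_mul, hx.2.2]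
    simp)
  rw [h2, ← star_rightMul_mul] at h1
  have h3 := le_antisymm h1 (star_mul_self_nonneg _)
  rw [CStarRing.star_mul_self_eq_zero_iff] at h3
  have h4 := congrArg (fun z : B => (z : Unitization ℂ B)) h3
  simp only [coe_rightMul, mul_sub, mul_one, Unitization.inr_zero, sub_eq_zero,
    ← Unitization.inr_mul] at h4
  exact (coe_eq h4).symm

theorem PosIn.le_norm_smul {p x : B} (hp : IsStarProjection p) (hx : PosIn p x) :
    x ≤ ((‖x‖ : ℝ) : ℂ) • p := by
  have h := CStarAlgebra.star_left_conjugate_le_norm_smul (a := p) (b := x) (.of_nonneg hx.1)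
  rwa [hp.isSelfAdjoint.star_eq, hx.2.1, hx.2.2, hp.isIdempotentElem.eq, ← Complex.coe_smul] at h

theorem PosIn.of_le {p x y : B} (hp : IsStarProjection p) (hy : PosIn p y) (hx : 0 ≤ x)
    (h : x ≤ y) : PosIn p x := by
  obtain ⟨v, rfl⟩ := nonneg_iff_exists.1 hx
  have h1 := mul_eq_of_star_mul_self_le hy h
  refine ⟨hx, ?_, by rw [mul_assoc, h1]⟩
  have := congrArg star h1
  rw [star_mul, hp.isSelfAdjoint.star_eq] at this
  rw [← mul_assoc, this]

theorem exists_ofReal_mul_le {M : ℝ≥0∞} (hM : M ≠ ∞) {r : ℝ≥0} (hr : 0 < r) :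
    ∃ ε : ℝ, 0 < ε ∧ ENNReal.ofReal ε * M ≤ r := by
  lift M to ℝ≥0 using hM
  refine ⟨(r / (M + 1) : ℝ≥0), by positivity, ?_⟩
  rw [ENNReal.ofReal_coe_nnreal]
  norm_cast
  rw [div_mul_eq_mul_div, div_le_iff₀ (by positivity)]
  exact mul_le_mul_right le_self_add r

namespace CornerTrace

variable {p : B} (t : CornerTrace p)

theorem val_mono {x y : B} (hx : PosIn p x) (hy : PosIn p y) (h : x ≤ y) :
    t.val x ≤ t.val y := by
  have h1 : PosIn p (y - x) :=
    ⟨sub_nonneg.2 h, by rw [mul_sub, hy.2.1, hx.2.1], by rw [sub_mul, hy.2.2, hx.2.2]⟩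
  have := t.val_add hx h1
  rw [add_sub_cancel] at this
  rw [this]
  exact le_self_add

omit [StarOrderedRing B] in
theorem val_zero : t.val 0 = 0 := by
  have := t.val_smul (le_refl 0) (posIn_zero p)
  simpa using this

theorem val_sum {ι : Type*} (s : Finset ι) (f : ι → B) (hf : ∀ i ∈ s, PosIn p (f i)) :
    t.val (∑ i ∈ s, f i) = ∑ i ∈ s, t.val (f i) := by
  classical
  induction s using Finset.induction_on with
  | empty => simp [t.val_zero]
  | insert a s ha ih =>
    rw [Finset.sum_insert ha, Finset.sum_insert ha, t.val_add (hf a (by simp))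
      (posIn_sum s f fun i hi => hf i (by simp [hi])), ih fun i hi => hf i (by simp [hi])]

/-- The finite families `v` in `p B` with `∑ vᵢ⋆ vᵢ ≤ x`. -/
def Fam (p x : B) : Type u :=
  {v : Σ n : ℕ, Fin n → B // (∀ i, p * v.2 i = v.2 i) ∧ ∑ i, star (v.2 i) * v.2 i ≤ x}

/-- The smallest extension of a finite trace `t` on `p B p`: at `x ≥ 0` it is the supremum of
`∑ t(vᵢ vᵢ⋆)` over the finite families in `p B` with `∑ vᵢ⋆ vᵢ ≤ x`. -/
def extVal (x : B) : ℝ≥0∞ := ⨆ v : Fam p x, ∑ i, t.val (v.1.2 i * star (v.1.2 i))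

omit [StarOrderedRing B] in
theorem le_extVal {ι : Type*} [Fintype ι] {x : B} (v : ι → B) (hv : ∀ i, p * v i = v i)
    (h : ∑ i, star (v i) * v i ≤ x) : ∑ i, t.val (v i * star (v i)) ≤ t.extVal x := by
  let e := Fintype.equivFin ι
  have h1 : ∑ i, star (v (e.symm i)) * v (e.symm i) ≤ x := by
    rwa [Equiv.sum_comp e.symm fun i => star (v i) * v i]
  refine le_trans (le_of_eq ?_) (le_iSup (fun v : Fam p x => ∑ i, t.val (v.1.2 i * star (v.1.2 i)))
    ⟨⟨_, fun i => v (e.symm i)⟩, fun i => hv _, h1⟩)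
  exact (Equiv.sum_comp e.symm fun i => t.val (v i * star (v i))).symm

omit [StarOrderedRing B] in
theorem extVal_le {x : B} {c : ℝ≥0∞} (h : ∀ (n : ℕ) (v : Fin n → B), (∀ i, p * v i = v i) →
    ∑ i, star (v i) * v i ≤ x → ∑ i, t.val (v i * star (v i)) ≤ c) : t.extVal x ≤ c :=
  iSup_le fun v => h _ _ v.2.1 v.2.2

/-- With `r = (x + y + ε)^{-1/2}`, each `vᵢ vᵢ⋆` is the sum of `(vᵢ r x^{1/2}) (vᵢ r x^{1/2})⋆`,
the same with `y`, and `ε (vᵢ r) (vᵢ r)⋆`; and `∑ (vᵢ r)⋆ (vᵢ r) ≤ 1`. -/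
theorem sum_le_extVal_add (hp : IsStarProjection p) {x y : B} (hx : 0 ≤ x) (hy : 0 ≤ y) {ε : ℝ}
    (hε : 0 < ε) {n : ℕ} (v : Fin n → B) (hv : ∀ i, p * v i = v i)
    (h : ((∑ i, star (v i) * v i : B) : Unitization ℂ B) ≤
      ((x + y : B) : Unitization ℂ B) + (ε : ℂ) • 1) :
    ∑ i, t.val (v i * star (v i)) ≤
      t.extVal x + t.extVal y + ENNReal.ofReal ε * (n * t.val p) := by
  obtain ⟨r, hr, hrs, -⟩ := exists_inv_sqrt_add (add_nonneg hx hy) hε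
  have hsum0 : 0 ≤ ∑ i, star (v i) * v i := Finset.sum_nonneg fun i _ => star_mul_self_nonneg _
  have hle1 : r * ((∑ i, star (v i) * v i : B) : Unitization ℂ B) * r ≤ 1 := conj_le_one hr hrs h
  have hpv : ∀ i c, p * rightMul (v i) c = rightMul (v i) c := fun i c => coe_eq (by
    rw [Unitization.inr_mul, coe_rightMul, ← mul_assoc, ← Unitization.inr_mul, hv])
  have part : ∀ a : B, star a = a →
      ∑ i, t.val (rightMul (v i) (r * a) * star (rightMul (v i) (r * a))) ≤ t.extVal (a * a) := by
    intro a ha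
    refine t.le_extVal _ (fun i => hpv i _) ?_
    have e : ∑ i, star (rightMul (v i) (r * a)) * rightMul (v i) (r * a) =
        conj (r * (a : Unitization ℂ B)) (∑ i, star (v i) * v i) := by
      simp only [star_rightMul_mul]
      exact (map_sum (⟨⟨conj (r * (a : Unitization ℂ B)), coe_eq (by simp)⟩, conj_add _⟩ : B →+ B)
        (fun i => star (v i) * v i) Finset.univ).symm
    rw [e, ← coe_le_coe' (conj_nonneg _ hsum0) (by simpa [ha] using star_mul_self_nonneg a)]
    have h2 := star_left_conjugate_le_conjugate hle1 (a : Unitization ℂ B)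
    simpa [mul_assoc, hr, ← Unitization.inr_star, ha] using h2
  obtain ⟨a, ha, hax⟩ := exists_selfAdjoint_mul_self hx
  obtain ⟨b, hb, hby⟩ := exists_selfAdjoint_mul_self hy
  have hsplit : ∀ i, v i * star (v i) =
      rightMul (v i) (r * a) * star (rightMul (v i) (r * a)) +
      rightMul (v i) (r * b) * star (rightMul (v i) (r * b)) +
      (ε : ℂ) • (rightMul (v i) r * star (rightMul (v i) r)) := fun i => coe_eq (by
    have ha' : star (a : Unitization ℂ B) = a := by rw [← Unitization.inr_star, ha]
    have hb' : star (b : Unitization ℂ B) = b := by rw [← Unitization.inr_star, hb]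
    have : (v i : Unitization ℂ B) * star (v i : Unitization ℂ B) =
        v i * (r * (((x + y : B) : Unitization ℂ B) + (ε : ℂ) • 1) * r) *
          star (v i : Unitization ℂ B) := by
      rw [hrs, mul_one]
    rw [Unitization.inr_mul, Unitization.inr_star, this, ← hax, ← hby]
    simp only [Unitization.inr_add, Unitization.inr_smul, Unitization.inr_star,
      Unitization.inr_mul, coe_rightMul, star_mul, hr, ha', hb', mul_add, add_mul, mul_smul_comm,
      smul_mul_assoc, mul_one, mul_assoc])
  have hlast : ∀ i, t.val (rightMul (v i) r * star (rightMul (v i) r)) ≤ t.val p := by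
    intro i
    have q := posIn_mul_star hp (hpv i r)
    refine t.val_mono q (posIn_self hp) ((q.le_norm_smul hp).trans ?_)
    have : ‖rightMul (v i) r * star (rightMul (v i) r)‖ ≤ 1 := by
      rw [CStarRing.norm_self_mul_star, ← CStarRing.norm_star_mul_self, star_rightMul_mul]
      refine norm_le_of_le_smul_one (conj_nonneg r (star_mul_self_nonneg _)) zero_le_one ?_
      have h3 : star (v i) * v i ≤ ∑ i, star (v i) * v i :=
        Finset.single_le_sum (f := fun i => star (v i) * v i)
          (fun i _ => star_mul_self_nonneg _) (Finset.mem_univ i)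
      have h4 := (coe_le_coe' (conj_nonneg r (star_mul_self_nonneg (v i)))
        (conj_nonneg r hsum0)).2 (conj_le_conj r (star_mul_self_nonneg _) h3)
      refine h4.trans ?_
      rw [coe_conj, hr]
      simpa using hle1
    have h5 := real_smul_le_of_le this hp.nonneg
    simpa using h5
  calc ∑ i, t.val (v i * star (v i))
      = ∑ i, (t.val (rightMul (v i) (r * a) * star (rightMul (v i) (r * a))) +
          t.val (rightMul (v i) (r * b) * star (rightMul (v i) (r * b))) +
          ENNReal.ofReal ε * t.val (rightMul (v i) r * star (rightMul (v i) r))) := by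
        refine Finset.sum_congr rfl fun i _ => ?_
        have q1 := posIn_mul_star hp (hpv i (r * a))
        have q2 := posIn_mul_star hp (hpv i (r * b))
        have q3 := posIn_mul_star hp (hpv i r)
        rw [hsplit, t.val_add (q1.add q2) (q3.smul hε.le), t.val_add q1 q2, t.val_smul hε.le q3]
    _ ≤ t.extVal x + t.extVal y + ENNReal.ofReal ε * (n * t.val p) := by
        rw [Finset.sum_add_distrib, Finset.sum_add_distrib]
        refine add_le_add (add_le_add ?_ ?_) ?_
        · rw [← hax]; exact part a ha
        · rw [← hby]; exact part b hb
        · rw [← Finset.mul_sum]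
          refine mul_le_mul_right ((Finset.sum_le_sum fun i _ => hlast i).trans (le_of_eq ?_)) _
          simp

theorem extVal_add (hp : IsStarProjection p) {x y : B} (hx : 0 ≤ x) (hy : 0 ≤ y) :
    t.extVal (x + y) = t.extVal x + t.extVal y := by
  apply le_antisymm
  · refine t.extVal_le fun n v hv h => ?_
    refine ENNReal.le_of_forall_pos_le_add fun r hr _ => ?_
    obtain ⟨ε, hε, hM⟩ := exists_ofReal_mul_le (M := n * t.val p)
      (ENNReal.mul_ne_top (by simp) t.ne_top) hr
    refine (t.sum_le_extVal_add hp hx hy hε v hv ?_).trans (by gcongr)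
    have hs : 0 ≤ ∑ i, star (v i) * v i := Finset.sum_nonneg fun i _ => star_mul_self_nonneg _
    exact ((coe_le_coe' hs (hs.trans h)).2 h).trans
      (le_add_of_nonneg_right (real_smul_one_nonneg hε.le))
  · have : Nonempty (Fam p x) := ⟨⟨⟨0, Fin.elim0⟩, fun i => i.elim0, by simpa using hx⟩⟩
    have : Nonempty (Fam p y) := ⟨⟨⟨0, Fin.elim0⟩, fun i => i.elim0, by simpa using hy⟩⟩
    refine ENNReal.iSup_add_iSup_le fun v w => ?_
    have := t.le_extVal (x := x + y) (Sum.elim v.1.2 w.1.2)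
      (by rintro (i | i); exacts [v.2.1 i, w.2.1 i]) (by
        rw [Fintype.sum_sum_type]
        exact add_le_add v.2.2 w.2.2)
    rwa [Fintype.sum_sum_type] at this

/-- For `c c⋆ = s`, the map `v ↦ v c` sends the families for `x` to families for `c⋆ x c` and
multiplies `vv⋆` by `s`. This covers both scalars and unitaries. -/
theorem smul_extVal_le (hp : IsStarProjection p) {s : ℝ} (hs : 0 ≤ s) {c : Unitization ℂ B}
    (hc : c * star c = (s : ℂ) • 1) {x : B} :
    ENNReal.ofReal s * t.extVal x ≤ t.extVal (conj c x) := by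
  unfold extVal
  rw [ENNReal.mul_iSup]
  refine iSup_le fun v => ?_
  have hs0 : 0 ≤ ∑ i, star (v.1.2 i) * v.1.2 i :=
    Finset.sum_nonneg fun i _ => star_mul_self_nonneg _
  have h1 := t.le_extVal (x := conj c x) (fun i => rightMul (v.1.2 i) c) (fun i => coe_eq (by
    rw [Unitization.inr_mul, coe_rightMul, ← mul_assoc, ← Unitization.inr_mul, v.2.1])) (by
      simp only [star_rightMul_mul]
      refine le_trans (le_of_eq ?_) (conj_le_conj c hs0 v.2.2)
      exact (map_sum (⟨⟨conj c, coe_eq (by simp)⟩, conj_add _⟩ : B →+ B) _ _).symm)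
  refine le_trans (le_of_eq ?_) h1
  rw [Finset.mul_sum]
  refine Finset.sum_congr rfl fun i _ => ?_
  rw [← t.val_smul hs (posIn_mul_star hp (v.2.1 i))]
  congr 1
  refine coe_eq ?_
  rw [Unitization.inr_mul, Unitization.inr_star, coe_rightMul, star_mul, mul_assoc,
    ← mul_assoc c, hc]
  simp

theorem extVal_zero : t.extVal 0 = 0 := by
  refine le_antisymm (t.extVal_le fun n v hv h => ?_) zero_le
  have : ∀ i, v i = 0 := fun i => by
    have h1 : star (v i) * v i ≤ 0 := (Finset.single_le_sum (f := fun i => star (v i) * v i)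
      (fun i _ => star_mul_self_nonneg _) (Finset.mem_univ i)).trans h
    have h2 := le_antisymm h1 (star_mul_self_nonneg _)
    rwa [CStarRing.star_mul_self_eq_zero_iff] at h2
  simp [this, t.val_zero]

theorem extVal_smul (hp : IsStarProjection p) (s : ℝ≥0) {x : B} :
    t.extVal (((s : ℝ) : ℂ) • x) = s * t.extVal x := by
  have key : ∀ (s : ℝ≥0) {x : B}, s * t.extVal x ≤ t.extVal (((s : ℝ) : ℂ) • x) := by
    intro s x
    rw [← conj_scalar s.coe_nonneg, ← ENNReal.ofReal_coe_nnreal]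
    refine t.smul_extVal_le hp s.coe_nonneg ?_
    simp only [star_smul, star_one, smul_mul_assoc, mul_smul_comm, one_mul, smul_smul,
      Complex.star_def, Complex.conj_ofReal]
    rw [← Complex.ofReal_mul, Real.mul_self_sqrt s.coe_nonneg]
  refine le_antisymm ?_ (key s)
  rcases eq_or_ne s 0 with rfl | hs
  · simp [t.extVal_zero]
  have h := key s⁻¹ (x := ((s : ℝ) : ℂ) • x)
  have e : (((s⁻¹ : ℝ≥0) : ℝ) : ℂ) • ((s : ℝ) : ℂ) • x = x := by
    rw [smul_smul, ← Complex.ofReal_mul, ← NNReal.coe_mul, inv_mul_cancel₀ hs]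
    simp
  rw [e] at h
  calc t.extVal (((s : ℝ) : ℂ) • x)
      = s * (((s⁻¹ : ℝ≥0) : ℝ≥0∞) * t.extVal (((s : ℝ) : ℂ) • x)) := by
        rw [← mul_assoc, ← ENNReal.coe_mul, mul_inv_cancel₀ hs]
        simp
    _ ≤ _ := mul_le_mul_right h _

/-- The smallest extension of a finite trace from a corner, as a trace. -/
def ext (hp : IsStarProjection p) : CTrace B where
  toFun x := t.extVal x.1
  map_smul' c x y h := by rw [h]; exact t.extVal_smul hp c
  map_add' x y z h := by
    rw [h]; exact t.extVal_add hp (nonneg_iff_exists.2 x.2) (nonneg_iff_exists.2 y.2)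
  map_unitary' w hw x y h := by
    have e1 : y.1 = conj w x.1 := coe_eq (by rw [h, coe_conj])
    have e2 : x.1 = conj (star w) y.1 := coe_eq (by
      have h1 := Unitary.mul_star_self_of_mem hw
      rw [coe_conj, h, star_star]
      calc _ = (w * star w) * (x.1 : Unitization ℂ B) * (w * star w) := by rw [h1]; simp
        _ = _ := by simp only [mul_assoc])
    apply le_antisymm
    · have h1 := t.smul_extVal_le hp zero_le_one (c := star w) (x := y.1)
        (by rw [star_star, Unitary.star_mul_self_of_mem hw]; simp)
      rw [ENNReal.ofReal_one, one_mul] at h1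
      exact h1.trans (le_of_eq (congrArg t.extVal e2.symm))
    · have h1 := t.smul_extVal_le hp zero_le_one (c := w) (x := x.1)
        (by rw [Unitary.mul_star_self_of_mem hw]; simp)
      rw [ENNReal.ofReal_one, one_mul] at h1
      exact h1.trans (le_of_eq (congrArg t.extVal e1.symm))

theorem ext_val (hp : IsStarProjection p) {x : B} (hx : 0 ≤ x) :
    (t.ext hp).val x = t.extVal x := by
  rw [← CTrace.val_mk _ _ (nonneg_iff_exists.1 hx)]
  rfl

theorem lowerSemicontinuous_ext (hp : IsStarProjection p) :
    LowerSemicontinuous (t.ext hp).toFun := by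
  refine lowerSemicontinuous_of_val fun x hx c hc => ?_
  rw [t.ext_val hp hx] at hc
  obtain ⟨v, hv⟩ := lt_iSup_iff.1 hc
  obtain ⟨r, hr, hr'⟩ := ENNReal.lt_iff_exists_add_pos_lt.1 hv
  obtain ⟨ε, hε, hM⟩ := exists_ofReal_mul_le (M := v.1.1 * t.val p)
    (ENNReal.mul_ne_top (by simp) t.ne_top) hr
  refine ⟨ε, hε, fun y hy hyx => ?_⟩
  rw [t.ext_val hp hy]
  -- If `‖y - x‖ < ε`, then `∑ vᵢ⋆ vᵢ ≤ x ≤ y + ε`.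
  by_contra! hcon
  refine absurd hr' (not_lt.2 ?_)
  have hs : 0 ≤ ∑ i, star (v.1.2 i) * v.1.2 i :=
    Finset.sum_nonneg fun i _ => star_mul_self_nonneg _
  refine (t.sum_le_extVal_add hp hy le_rfl hε v.1.2 v.2.1 ?_).trans ?_
  · refine ((coe_le_coe' hs hx).2 v.2.2).trans ((sub_le_norm_smul_one (.of_nonneg hx)
      (.of_nonneg hy)).trans ?_)
    rw [add_zero]
    refine add_le_add le_rfl (real_smul_le_of_le ?_ zero_le_one)
    rw [norm_sub_rev]
    exact hyx.le
  · rw [t.extVal_zero, add_zero]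
    exact add_le_add hcon hM

theorem extVal_eq (hp : IsStarProjection p) {x : B} (hx : PosIn p x) : t.extVal x = t.val x := by
  apply le_antisymm
  · refine t.extVal_le fun n v hv h => ?_
    have hle : ∀ i, star (v i) * v i ≤ x := fun i =>
      (Finset.single_le_sum (f := fun i => star (v i) * v i)
        (fun i _ => star_mul_self_nonneg _) (Finset.mem_univ i)).trans h
    have h1 : ∀ i, PosIn p (star (v i) * v i) := fun i =>
      hx.of_le hp (star_mul_self_nonneg _) (hle i)
    calc ∑ i, t.val (v i * star (v i)) = ∑ i, t.val (star (v i) * v i) :=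
          Finset.sum_congr rfl fun i _ => (t.val_mul_star _ (hv i)
            (mul_eq_of_star_mul_self_le hx (hle i))).symm
      _ = t.val (∑ i, star (v i) * v i) := (t.val_sum _ _ fun i _ => h1 i).symm
      _ ≤ t.val x := t.val_mono (posIn_sum _ _ fun i _ => h1 i) hx h
  · obtain ⟨y, hy, hyx, hpy, -⟩ := hx.exists_sqrt hp
    have := t.le_extVal (x := x) (fun _ : Fin 1 => y) (fun _ => hpy) (by simp [hy, hyx])
    simpa [hy, hyx] using this

/-- Every lower semicontinuous trace which extends `t` is above the extension `t.ext`. -/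
theorem extVal_le_of_extends {φ : LscTrace B}
    (h : ∀ x, PosIn p x → φ.1.val x = t.val x) (hp : IsStarProjection p) {x : B} :
    t.extVal x ≤ φ.1.val x := by
  refine t.extVal_le fun n v hv hx => ?_
  calc ∑ i, t.val (v i * star (v i)) = ∑ i, φ.1.val (star (v i) * v i) :=
        Finset.sum_congr rfl fun i _ => by
          rw [φ.val_mul_star, h _ (posIn_mul_star hp (hv i))]
    _ = φ.1.val (∑ i, star (v i) * v i) :=
        (φ.1.val_sum _ _ fun i _ => star_mul_self_nonneg _).symm
    _ ≤ φ.1.val x := φ.1.val_mono (Finset.sum_nonneg fun i _ => star_mul_self_nonneg _) hx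

end CornerTrace

end Extension

/-! ### Traces on matrix algebras and their corners -/

section Matrices

open Unitization

variable {A : Type u} [NonUnitalCStarAlgebra A] [PartialOrder A] [StarOrderedRing A]

omit [PartialOrder A] [StarOrderedRing A] in
theorem CStarMatrix.star_mul_self_apply {n : ℕ} (Y : CStarMatrix (Fin n) (Fin n) A) (i j : Fin n) :
    (star Y * Y) i j = ∑ k, star (Y k i) * Y k j := by
  simp [CStarMatrix.mul_apply, CStarMatrix.star_apply]

omit [PartialOrder A] [StarOrderedRing A] in
theorem CStarMatrix.mul_star_self_apply {n : ℕ} (Y : CStarMatrix (Fin n) (Fin n) A) (i j : Fin n) :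
    (Y * star Y) i j = ∑ k, Y i k * star (Y j k) := by
  simp [CStarMatrix.mul_apply, CStarMatrix.star_apply]

theorem CStarMatrix.diag_nonneg {n : ℕ} {X : CStarMatrix (Fin n) (Fin n) A} (hX : 0 ≤ X)
    (i : Fin n) : 0 ≤ X i i := by
  obtain ⟨Y, rfl⟩ := nonneg_iff_exists.1 hX
  rw [CStarMatrix.star_mul_self_apply]
  exact Finset.sum_nonneg fun k _ => star_mul_self_nonneg _

theorem CStarMatrix.diag_mono {n : ℕ} {X Y : CStarMatrix (Fin n) (Fin n) A} (h : X ≤ Y)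
    (i : Fin n) : X i i ≤ Y i i := by
  have := CStarMatrix.diag_nonneg (sub_nonneg.2 h) i
  rwa [CStarMatrix.sub_apply, sub_nonneg] at this

/-- The extension of a trace to matrices, as a function on all matrices. -/
def CTrace.matVal (φ : CTrace A) {n : ℕ} (X : CStarMatrix (Fin n) (Fin n) A) : ℝ≥0∞ :=
  ∑ i, φ.val (X i i)

theorem CTrace.onMatrix_eq (φ : CTrace A) {n : ℕ} (x : PosElt (CStarMatrix (Fin n) (Fin n) A)) :
    φ.onMatrix x = φ.matVal x.1 :=
  Finset.sum_congr rfl fun i _ => (φ.val_coe (diagEntry x i)).symm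

theorem CTrace.atProj_eq (φ : CTrace A) (p : MatProj A) : φ.atProj p = φ.matVal p.elt :=
  φ.onMatrix_eq _

theorem CTrace.matVal_add (φ : CTrace A) {n : ℕ} {X Y : CStarMatrix (Fin n) (Fin n) A} (hX : 0 ≤ X)
    (hY : 0 ≤ Y) : φ.matVal (X + Y) = φ.matVal X + φ.matVal Y := by
  unfold CTrace.matVal
  rw [← Finset.sum_add_distrib]
  exact Finset.sum_congr rfl fun i _ =>
    φ.val_add (CStarMatrix.diag_nonneg hX i) (CStarMatrix.diag_nonneg hY i)

theorem CTrace.matVal_smul (φ : CTrace A) {n : ℕ} {X : CStarMatrix (Fin n) (Fin n) A} (hX : 0 ≤ X)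
    {t : ℝ} (ht : 0 ≤ t) : φ.matVal (((t : ℝ) : ℂ) • X) = ENNReal.ofReal t * φ.matVal X := by
  unfold CTrace.matVal
  rw [Finset.mul_sum]
  exact Finset.sum_congr rfl fun i _ => φ.val_smul ht (CStarMatrix.diag_nonneg hX i)

theorem CTrace.matVal_mono (φ : CTrace A) {n : ℕ} {X Y : CStarMatrix (Fin n) (Fin n) A}
    (hX : 0 ≤ X) (h : X ≤ Y) : φ.matVal X ≤ φ.matVal Y :=
  Finset.sum_le_sum fun i _ => φ.val_mono (CStarMatrix.diag_nonneg hX i) (CStarMatrix.diag_mono h i)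

theorem LscTrace.matVal_mul_star (φ : LscTrace A) {n : ℕ} (Y : CStarMatrix (Fin n) (Fin n) A) :
    φ.1.matVal (star Y * Y) = φ.1.matVal (Y * star Y) := by
  unfold CTrace.matVal
  simp only [CStarMatrix.star_mul_self_apply, CStarMatrix.mul_star_self_apply]
  calc _ = ∑ i, ∑ k, φ.1.val (star (Y k i) * Y k i) := Finset.sum_congr rfl fun i _ =>
        φ.1.val_sum _ _ fun k _ => star_mul_self_nonneg _
    _ = ∑ k, ∑ i, φ.1.val (Y k i * star (Y k i)) := by
        rw [Finset.sum_comm]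
        simp only [φ.val_mul_star]
    _ = _ := Finset.sum_congr rfl fun i _ => (φ.1.val_sum _ _ fun k _ =>
        mul_star_self_nonneg _).symm

/-- The extension of a lower semicontinuous trace to matrices, as a trace. -/
def LscTrace.matrixTrace (φ : LscTrace A) (n : ℕ) : CTrace (CStarMatrix (Fin n) (Fin n) A) :=
  CTrace.ofTracial φ.1.matVal
    (fun t X hX => by
      rw [← ENNReal.ofReal_coe_nnreal]
      exact φ.1.matVal_smul (nonneg_iff_exists.2 hX) t.coe_nonneg)
    (fun X Y hX hY => φ.1.matVal_add (nonneg_iff_exists.2 hX) (nonneg_iff_exists.2 hY))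
    φ.matVal_mul_star

theorem LscTrace.lowerSemicontinuous_matrixTrace (φ : LscTrace A) (n : ℕ) :
    LowerSemicontinuous (φ.matrixTrace n).toFun := by
  have e : (φ.matrixTrace n).toFun =
      fun x : PosElt (CStarMatrix (Fin n) (Fin n) A) => ∑ i, φ.1.toFun (diagEntry x i) :=
    funext fun x => (φ.1.onMatrix_eq x).symm
  rw [e]
  refine lowerSemicontinuous_sum fun i _ => φ.2.comp ?_
  refine Continuous.subtype_mk ?_ _
  have h1 : Continuous fun X : CStarMatrix (Fin n) (Fin n) A => X i i :=
    continuous_apply_apply i i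
  exact h1.comp continuous_subtype_val

theorem LscTrace.matrixTrace_val (φ : LscTrace A) {n : ℕ} {X : CStarMatrix (Fin n) (Fin n) A}
    (hX : 0 ≤ X) : (φ.matrixTrace n).val X = φ.1.matVal X :=
  CTrace.ofTracial_val _ _ _ _ (nonneg_iff_exists.1 hX)

/-- The extension of a lower semicontinuous trace to matrices, as a lower semicontinuous trace. -/
def LscTrace.matrix (φ : LscTrace A) (n : ℕ) : LscTrace (CStarMatrix (Fin n) (Fin n) A) :=
  ⟨φ.matrixTrace n, φ.lowerSemicontinuous_matrixTrace n⟩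

theorem LscTrace.matrix_val (φ : LscTrace A) {n : ℕ} {X : CStarMatrix (Fin n) (Fin n) A}
    (hX : 0 ≤ X) : (φ.matrix n).1.val X = φ.1.matVal X :=
  φ.matrixTrace_val hX

omit [PartialOrder A] [StarOrderedRing A] in
theorem MatProj.isStarProjection_elt (p : MatProj A) : IsStarProjection p.elt :=
  ⟨p.isProj.isIdempotentElem, p.isProj.isSelfAdjoint⟩

theorem MatProj.posIn_coe {p : MatProj A} {x : p.corner} (hx : ∃ y : p.corner, x = star y * y) :
    PosIn p.elt x.1 := by
  refine ⟨?_, x.2.1, x.2.2⟩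
  obtain ⟨y, rfl⟩ := hx
  exact star_mul_self_nonneg y.1

theorem MatProj.exists_of_posIn {p : MatProj A} {x : CStarMatrix (Fin p.size) (Fin p.size) A}
    (hx : PosIn p.elt x) :
    ∃ y : p.corner, (⟨x, hx.2⟩ : p.corner) = star y * y := by
  obtain ⟨y, hy, hyx, h1, h2⟩ := hx.exists_sqrt p.isStarProjection_elt
  refine ⟨⟨y, h1, h2⟩, Subtype.ext ?_⟩
  show x = star y * y
  rw [hy, hyx]

theorem LscTrace.matVal_ne_top_of_posIn (φ : LscTrace A) {p : MatProj A} (h : φ.1.atProj p < ∞)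
    {x : CStarMatrix (Fin p.size) (Fin p.size) A} (hx : PosIn p.elt x) : φ.1.matVal x ≠ ∞ := by
  have h1 := φ.1.matVal_mono hx.1 (hx.le_norm_smul p.isStarProjection_elt)
  rw [φ.1.matVal_smul p.isStarProjection_elt.nonneg (norm_nonneg _), ← φ.1.atProj_eq] at h1
  exact ne_top_of_le_ne_top (ENNReal.mul_ne_top ENNReal.ofReal_ne_top h.ne) h1

section Restrict

/-- The restriction of a lower semicontinuous trace to `p M_n(A) p`, when it is finite at `p`. -/
def LscTrace.restrict (φ : LscTrace A) (p : MatProj A) (h : φ.1.atProj p < ∞) :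
    FinTrace p.corner :=
  ⟨CTrace.ofTracial (fun x => φ.1.matVal x.1)
    (fun t x hx => by
      rw [← ENNReal.ofReal_coe_nnreal]
      exact φ.1.matVal_smul (MatProj.posIn_coe hx).1 t.coe_nonneg)
    (fun x y hx hy => φ.1.matVal_add (MatProj.posIn_coe hx).1 (MatProj.posIn_coe hy).1)
    (fun x => φ.matVal_mul_star x.1),
    fun x => φ.matVal_ne_top_of_posIn h (MatProj.posIn_coe x.2)⟩

theorem LscTrace.restrict_isRestriction (φ : LscTrace A) (p : MatProj A) (h : φ.1.atProj p < ∞) :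
    IsRestriction φ (φ.restrict p h) := fun x => (φ.1.onMatrix_eq (p.incl x)).symm

theorem IsRestriction.unique {φ : LscTrace A} {p : MatProj A} {τ σ : FinTrace p.corner}
    (h : IsRestriction φ τ) (h' : IsRestriction φ σ) : τ = σ :=
  Subtype.ext (CTrace.ext (funext fun x => (h x).trans (h' x).symm))

theorem isRestriction_iff {φ : LscTrace A} {p : MatProj A} {τ : FinTrace p.corner} :
    IsRestriction φ τ ↔ ∀ x : p.corner, PosIn p.elt x.1 → τ.1.val x = φ.1.matVal x.1 := by
  refine ⟨fun h x hx => ?_, fun h x => ?_⟩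
  · have := h ⟨x, MatProj.exists_of_posIn hx⟩
    rw [φ.1.onMatrix_eq] at this
    exact (τ.1.val_coe ⟨x, MatProj.exists_of_posIn hx⟩).trans this
  · rw [φ.1.onMatrix_eq, ← CTrace.val_coe]
    exact h x.1 (MatProj.posIn_coe x.2)

theorem IsRestriction.matVal_eq {φ ψ : LscTrace A} {p : MatProj A} {τ : FinTrace p.corner}
    (h : IsRestriction φ τ) (h' : IsRestriction ψ τ)
    {x : CStarMatrix (Fin p.size) (Fin p.size) A} (hx : PosIn p.elt x) :
    φ.1.matVal x = ψ.1.matVal x :=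
  (isRestriction_iff.1 h ⟨x, hx.2⟩ hx).symm.trans (isRestriction_iff.1 h' ⟨x, hx.2⟩ hx)

theorem IsRestriction.atProj_lt_top {φ : LscTrace A} {p : MatProj A} {τ : FinTrace p.corner}
    (h : IsRestriction φ τ) : φ.1.atProj p < ∞ := by
  have hp := posIn_self p.isStarProjection_elt
  rw [φ.1.atProj_eq, ← isRestriction_iff.1 h ⟨p.elt, hp.2⟩ hp]
  exact (τ.val_ne_top _).lt_top

end Restrict

/-- A finite trace on the corner `p M_n(A) p`, as a function on `M_n(A)`. -/
def FinTrace.toCornerTrace {p : MatProj A} (τ : FinTrace p.corner) : CornerTrace p.elt :=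
  open Classical in
  have hval : ∀ {x : CStarMatrix (Fin p.size) (Fin p.size) A} (hx : x ∈ p.corner),
      (if h : x ∈ p.corner then τ.1.val ⟨x, h⟩ else 0) = τ.1.val ⟨x, hx⟩ := fun hx => dif_pos hx
  { val := fun x => if h : x ∈ p.corner then τ.1.val ⟨x, h⟩ else 0
    val_add := fun {x y} hx hy => by
      rw [hval hx.2, hval hy.2, hval (hx.add hy).2]
      exact τ.1.val_add_of_exists (MatProj.exists_of_posIn hx) (MatProj.exists_of_posIn hy)
    val_smul := fun {t x} ht hx => by
      rw [hval hx.2, hval (hx.smul ht).2]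
      exact τ.1.val_smul_of_exists ht (MatProj.exists_of_posIn hx)
    val_mul_star := fun y h1 h2 => by
      have hy : y ∈ p.corner := ⟨h1, h2⟩
      rw [hval (mul_mem (star_mem hy) hy), hval (mul_mem hy (star_mem hy))]
      exact τ.val_mul_star ⟨y, hy⟩
    ne_top := by
      rw [hval (posIn_self p.isStarProjection_elt).2]
      exact τ.val_ne_top _ }

theorem FinTrace.toCornerTrace_val {p : MatProj A} (τ : FinTrace p.corner) (x : p.corner) :
    τ.toCornerTrace.val x.1 = τ.1.val x := dif_pos x.2

/-- The matrix with the given row in row `i₀`, and zeros elsewhere. -/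
def rowMatrix {n : ℕ} (i₀ : Fin n) (v : Fin n → A) : CStarMatrix (Fin n) (Fin n) A :=
  CStarMatrix.ofMatrix fun i j => if i = i₀ then v j else 0

/-- The matrix with entry `a` at `(i₀, i₀)`, and zeros elsewhere. -/
def cornerMatrix {n : ℕ} (i₀ : Fin n) (a : A) : CStarMatrix (Fin n) (Fin n) A :=
  CStarMatrix.ofMatrix fun i j => if i = i₀ ∧ j = i₀ then a else 0

section

variable {n : ℕ} (i₀ : Fin n)

omit [PartialOrder A] [StarOrderedRing A] in
theorem rowMatrix_apply (v : Fin n → A) (i j : Fin n) :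
    rowMatrix i₀ v i j = if i = i₀ then v j else 0 := rfl

omit [PartialOrder A] [StarOrderedRing A] in
theorem cornerMatrix_apply (a : A) (i j : Fin n) :
    cornerMatrix i₀ a i j = if i = i₀ ∧ j = i₀ then a else 0 := rfl

omit [PartialOrder A] [StarOrderedRing A] in
theorem star_rowMatrix_mul (v : Fin n → A) (i j : Fin n) :
    (star (rowMatrix i₀ v) * rowMatrix i₀ v) i j = star (v i) * v j := by
  rw [CStarMatrix.star_mul_self_apply, Finset.sum_eq_single i₀]
  · simp [rowMatrix_apply]
  · intro k _ hk
    simp [rowMatrix_apply, hk]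
  · simp

omit [PartialOrder A] [StarOrderedRing A] in
theorem rowMatrix_mul_star (v : Fin n → A) :
    rowMatrix i₀ v * star (rowMatrix i₀ v) = cornerMatrix i₀ (∑ k, v k * star (v k)) := by
  ext i j
  rw [CStarMatrix.mul_star_self_apply, cornerMatrix_apply]
  by_cases hi : i = i₀ <;> by_cases hj : j = i₀ <;> simp [rowMatrix_apply, hi, hj]

omit [PartialOrder A] [StarOrderedRing A] in
theorem cornerMatrix_mul (a b : A) :
    cornerMatrix i₀ a * cornerMatrix i₀ b = cornerMatrix i₀ (a * b) := by
  ext i j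
  rw [CStarMatrix.mul_apply, Finset.sum_eq_single i₀]
  · simp only [cornerMatrix_apply]
    split_ifs <;> simp_all
  · intro k _ hk
    simp [cornerMatrix_apply, hk]
  · simp

omit [PartialOrder A] [StarOrderedRing A] in
theorem star_cornerMatrix (a : A) : star (cornerMatrix i₀ a) = cornerMatrix i₀ (star a) := by
  ext i j
  rw [CStarMatrix.star_apply, cornerMatrix_apply, cornerMatrix_apply]
  split_ifs <;> simp_all

omit [PartialOrder A] [StarOrderedRing A] in
theorem cornerMatrix_add (a b : A) :
    cornerMatrix i₀ (a + b) = cornerMatrix i₀ a + cornerMatrix i₀ b := by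
  ext i j
  rw [CStarMatrix.add_apply, cornerMatrix_apply, cornerMatrix_apply, cornerMatrix_apply]
  split_ifs <;> simp

omit [PartialOrder A] [StarOrderedRing A] in
theorem cornerMatrix_smul (c : ℂ) (a : A) :
    cornerMatrix i₀ (c • a) = c • cornerMatrix i₀ a := by
  ext i j
  rw [CStarMatrix.smul_apply, cornerMatrix_apply, cornerMatrix_apply]
  split_ifs <;> simp

theorem cornerMatrix_nonneg {a : A} (ha : 0 ≤ a) : 0 ≤ cornerMatrix i₀ a := by
  obtain ⟨y, rfl⟩ := nonneg_iff_exists.1 ha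
  rw [← cornerMatrix_mul, ← star_cornerMatrix]
  exact star_mul_self_nonneg _

omit [PartialOrder A] [StarOrderedRing A] in
theorem continuous_cornerMatrix : Continuous (cornerMatrix i₀ : A → _) := by
  refine continuous_pi fun i => continuous_pi fun j => ?_
  show Continuous fun a : A => if i = i₀ ∧ j = i₀ then a else 0
  split_ifs
  · exact continuous_id
  · exact continuous_const

theorem CTrace.matVal_cornerMatrix (φ : CTrace A) (a : A) :
    φ.matVal (cornerMatrix i₀ a) = φ.val a := by
  unfold CTrace.matVal
  rw [Finset.sum_eq_single i₀]
  · simp [cornerMatrix_apply]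
  · intro i _ hi
    simp [cornerMatrix_apply, hi, φ.val_zero]
  · simp

/-- The restriction of a trace on `M_n(A)` to a diagonal copy of `A`, as a trace. -/
def LscTrace.ofMatrixTrace (Φ : LscTrace (CStarMatrix (Fin n) (Fin n) A)) : CTrace A :=
  CTrace.ofTracial (fun x => Φ.1.val (cornerMatrix i₀ x))
    (fun t x hx => by
      rw [cornerMatrix_smul,
        Φ.1.val_smul t.coe_nonneg (cornerMatrix_nonneg i₀ (nonneg_iff_exists.2 hx)),
        ENNReal.ofReal_coe_nnreal])
    (fun x y hx hy => by
      rw [cornerMatrix_add, Φ.1.val_add (cornerMatrix_nonneg i₀ (nonneg_iff_exists.2 hx))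
        (cornerMatrix_nonneg i₀ (nonneg_iff_exists.2 hy))])
    (fun x => by
      rw [← cornerMatrix_mul, ← cornerMatrix_mul, ← star_cornerMatrix, Φ.val_mul_star])

theorem LscTrace.ofMatrixTrace_val (Φ : LscTrace (CStarMatrix (Fin n) (Fin n) A)) {x : A}
    (hx : 0 ≤ x) : (Φ.ofMatrixTrace i₀).val x = Φ.1.val (cornerMatrix i₀ x) :=
  CTrace.ofTracial_val _ _ _ _ (nonneg_iff_exists.1 hx)

/-- The restriction of a trace on `M_n(A)` to a diagonal copy of `A`. -/
def LscTrace.ofMatrix (Φ : LscTrace (CStarMatrix (Fin n) (Fin n) A)) : LscTrace A :=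
  ⟨Φ.ofMatrixTrace i₀, by
    refine lowerSemicontinuous_of_val fun x hx c hc => ?_
    rw [Φ.ofMatrixTrace_val i₀ hx] at hc
    obtain ⟨δ, hδ, H⟩ := Φ.exists_delta (cornerMatrix_nonneg i₀ hx) hc
    obtain ⟨η, hη, K⟩ := Metric.continuous_iff.1 (continuous_cornerMatrix i₀) x δ hδ
    refine ⟨η, hη, fun y hy hyx => ?_⟩
    rw [Φ.ofMatrixTrace_val i₀ hy]
    refine H _ (cornerMatrix_nonneg i₀ hy) ?_
    rw [← dist_eq_norm]
    exact K y (by rwa [dist_eq_norm])⟩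

theorem LscTrace.ofMatrix_val (Φ : LscTrace (CStarMatrix (Fin n) (Fin n) A)) {x : A}
    (hx : 0 ≤ x) : (Φ.ofMatrix i₀).1.val x = Φ.1.val (cornerMatrix i₀ x) :=
  Φ.ofMatrixTrace_val i₀ hx

/-- A trace on `M_n(A)` is the extension of its restriction to a diagonal copy of `A`. -/
theorem LscTrace.matVal_ofMatrix (Φ : LscTrace (CStarMatrix (Fin n) (Fin n) A))
    {X : CStarMatrix (Fin n) (Fin n) A} (hX : 0 ≤ X) :
    (Φ.ofMatrix i₀).1.matVal X = Φ.1.val X := by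
  obtain ⟨Y, rfl⟩ := nonneg_iff_exists.1 hX
  have e : star Y * Y = ∑ k, star (rowMatrix i₀ (Y k)) * rowMatrix i₀ (Y k) := by
    ext i j
    rw [CStarMatrix.star_mul_self_apply]
    have : ∀ s : Finset (Fin n), (∑ k ∈ s, star (rowMatrix i₀ (Y k)) * rowMatrix i₀ (Y k)) i j =
        ∑ k ∈ s, star (Y k i) * Y k j := by
      intro s
      induction s using Finset.induction_on with
      | empty => rfl
      | insert a s ha ih =>
        rw [Finset.sum_insert ha, Finset.sum_insert ha, CStarMatrix.add_apply, ih,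
          star_rowMatrix_mul]
    exact (this _).symm
  refine ((Φ.ofMatrix i₀).matVal_mul_star Y).trans (Eq.trans ?_ (congrArg Φ.1.val e).symm)
  rw [Φ.1.val_sum _ _ fun k _ => star_mul_self_nonneg _]
  refine Finset.sum_congr rfl fun k _ => ?_
  rw [Φ.val_mul_star, rowMatrix_mul_star, ← CStarMatrix.mul_star_self_apply,
    LscTrace.ofMatrix_val]
  exact CStarMatrix.diag_nonneg (mul_star_self_nonneg Y) k

end

/-- The zero trace. -/
def LscTrace.zero : LscTrace A :=
  ⟨(default : FinTrace A).1, lowerSemicontinuous_const⟩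

/-- Every finite trace on a corner `p M_n(A) p` extends to a lower semicontinuous trace on `A`, and
there is a smallest extension. -/
theorem exists_smallest_extension {p : MatProj A} (τ : FinTrace p.corner) :
    ∃ μ : LscTrace A, IsRestriction μ τ ∧
      ∀ φ : LscTrace A, IsRestriction φ τ → ∀ x, 0 ≤ x → μ.1.val x ≤ φ.1.val x := by
  have hp := p.isStarProjection_elt
  rcases Nat.eq_zero_or_pos p.size with hn | hn
  -- `M_0(A)` is zero, and the smallest extension is the zero trace.
  · have : IsEmpty (Fin p.size) := by rw [hn]; infer_instance
    refine ⟨LscTrace.zero, isRestriction_iff.2 fun x hx => ?_, fun φ _ x hx => ?_⟩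
    · have h0 : x = 0 := Subtype.ext (by ext i; exact this.elim i)
      rw [h0, CTrace.matVal, Finset.univ_eq_empty, Finset.sum_empty]
      have := τ.1.val_smul_of_exists le_rfl (x := 0) ⟨0, by simp⟩
      simpa using this
    · rw [← CTrace.val_mk _ x (nonneg_iff_exists.1 hx)]
      exact zero_le
  · let i₀ : Fin p.size := ⟨0, hn⟩
    let t := τ.toCornerTrace
    let Φ : LscTrace (CStarMatrix (Fin p.size) (Fin p.size) A) :=
      ⟨t.ext hp, t.lowerSemicontinuous_ext hp⟩
    have hΦ : ∀ {x}, 0 ≤ x → Φ.1.val x = t.extVal x := fun hx => t.ext_val hp hx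
    refine ⟨Φ.ofMatrix i₀, isRestriction_iff.2 fun x hx => ?_, fun φ hφ x hx => ?_⟩
    · rw [LscTrace.matVal_ofMatrix i₀ Φ hx.1, hΦ hx.1, t.extVal_eq hp hx, τ.toCornerTrace_val]
    · rw [LscTrace.ofMatrix_val i₀ Φ hx, hΦ (cornerMatrix_nonneg i₀ hx)]
      refine (t.extVal_le_of_extends (φ := φ.matrix p.size) (fun y hy => ?_) hp).trans ?_
      · rw [φ.matrix_val hy.1, ← isRestriction_iff.1 hφ ⟨y, hy.2⟩ hy]
        exact (τ.toCornerTrace_val ⟨y, hy.2⟩).symm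
      · rw [φ.matrix_val (cornerMatrix_nonneg i₀ hx), CTrace.matVal_cornerMatrix]

end Matrices

/-! ### Ideals generated by projections in matrix algebras -/

section ProjectionIdeals

open Unitization

section

variable {B : Type u} [NonUnitalCStarAlgebra B] [PartialOrder B] [StarOrderedRing B]

/-- A projection in the closed ideal generated by the cone `S` belongs to `S`: if
`q ≤ s + 1/2`, then `h = q s q + (1 - q) ≥ 1/2` is invertible and commutes with `q`, and
`q = h^{-1/2} q s q h^{-1/2}`. -/
theorem ConjCone.mem_of_isStarProjection {S : ConjCone B} {q : B} (hq : IsStarProjection q)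
    (h : q ∈ S.ideal) : q ∈ S.carrier := by
  obtain ⟨s, hs, hle⟩ := (ConjCone.mem_ideal_of_nonneg hq.nonneg).1 h (1 / 2) (by norm_num)
  have hqs : star (q : Unitization ℂ B) = q := by
    rw [← Unitization.inr_star, hq.isSelfAdjoint.star_eq]
  have hqq : (q : Unitization ℂ B) * q = q := by
    rw [← Unitization.inr_mul, hq.isIdempotentElem.eq]
  have h1 : ((1 / 2 : ℝ) : ℂ) • (q : Unitization ℂ B) ≤ q * s * q := by
    have := star_left_conjugate_le_conjugate hle (q : Unitization ℂ B)
    rw [hqs, hqq, hqq, mul_add, add_mul, mul_smul_comm, mul_one, smul_mul_assoc, hqq] at this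
    have h2 : (q : Unitization ℂ B) - ((1 / 2 : ℝ) : ℂ) • (q : Unitization ℂ B) =
        ((1 / 2 : ℝ) : ℂ) • (q : Unitization ℂ B) := by
      rw [sub_eq_iff_eq_add, ← add_smul, ← Complex.ofReal_add]
      norm_num
    rw [← h2]
    exact sub_le_iff_le_add.2 this
  have h2 : ((1 / 2 : ℝ) : ℂ) • (1 : Unitization ℂ B) ≤ q * s * q + (1 - q) := by
    have h3 : 0 ≤ (1 : Unitization ℂ B) - q := by
      have : (1 : Unitization ℂ B) - q = star (1 - (q : Unitization ℂ B)) * (1 - q) := by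
        rw [star_sub, star_one, hqs, mul_sub, sub_mul, sub_mul, hqq]
        simp
      rw [this]
      exact star_mul_self_nonneg _
    have h4 := add_le_add h1 (real_smul_le_of_le (show (1 / 2 : ℝ) ≤ 1 by norm_num) h3)
    rw [Complex.ofReal_one, one_smul, ← smul_add] at h4
    simpa using h4
  obtain ⟨r, hr, hrh, hcomm⟩ := exists_inv_sqrt (by norm_num : (0 : ℝ) < 1 / 2) h2
  have hqh : (q : Unitization ℂ B) * (q * s * q + (1 - q)) = q * s * q := by
    rw [mul_add, mul_sub, mul_one, hqq, sub_self, add_zero, ← mul_assoc, ← mul_assoc, hqq]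
  have hhq : (q * s * q + (1 - q)) * (q : Unitization ℂ B) = q * s * q := by
    rw [add_mul, sub_mul, one_mul, hqq, sub_self, add_zero, mul_assoc, hqq]
  have hqr : (q : Unitization ℂ B) * r = r * q := hcomm q (hqh.trans hhq.symm)
  have e : q = conj ((q : Unitization ℂ B) * r) s := coe_eq (by
    rw [coe_conj, star_mul, hr, hqs]
    calc (q : Unitization ℂ B) = q * (r * (q * s * q + (1 - q)) * r) := by rw [hrh, mul_one]
      _ = r * (q * (q * s * q + (1 - q))) * r := by
        rw [← mul_assoc, ← mul_assoc, hqr]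
        simp only [mul_assoc]
      _ = r * q * s * (q * r) := by rw [hqh]; simp only [mul_assoc])
  rw [e]
  exact S.conj_mem _ hs

theorem ConjCone.mem_closure_of_mem_ideal {S : ConjCone B} {x : B} (hx : 0 ≤ x)
    (h : x ∈ S.ideal) : x ∈ closure S.carrier := by
  refine Metric.mem_closure_iff.2 fun δ hδ => ?_
  obtain ⟨s, hs, hle⟩ := (ConjCone.mem_ideal_of_nonneg hx).1 h _ (half_pos hδ)
  obtain ⟨c, hc, hcx⟩ := exists_conj_approx hx (S.nonneg hs) (half_pos hδ) hle
  refine ⟨conj c s, S.conj_mem c hs, ?_⟩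
  rw [dist_comm, dist_eq_norm]
  exact hcx.trans_lt (half_lt_self hδ)

theorem ConjCone.mem_ideal_of_carrier_subset {S T : ConjCone B}
    (h : ∀ s ∈ S.carrier, s ∈ T.ideal) {x : B} (hx : 0 ≤ x) (hxS : x ∈ S.ideal) : x ∈ T.ideal :=
  closure_minimal h T.isClosed_ideal (ConjCone.mem_closure_of_mem_ideal hx hxS)

/-- The positive elements at which a trace is finite. -/
def CTrace.finiteCone (φ : CTrace B) : ConjCone B where
  carrier := {x | 0 ≤ x ∧ φ.val x ≠ ∞}
  nonneg h := h.1
  zero_mem := ⟨le_rfl, by simp [φ.val_zero]⟩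
  add_mem h h' := ⟨add_nonneg h.1 h'.1, by
    rw [φ.val_add h.1 h'.1]
    exact ENNReal.add_ne_top.2 ⟨h.2, h'.2⟩⟩
  conj_mem c _ h := ⟨conj_nonneg c h.1, φ.val_conj_ne_top h.1 h.2 c⟩

/-- If two lower semicontinuous traces agree on a cone, the first is at most the second on the
closed ideal generated by the cone. -/
theorem LscTrace.val_le_of_mem_ideal {φ ψ : LscTrace B} {S : ConjCone B}
    (h : ∀ s ∈ S.carrier, φ.1.val s = ψ.1.val s) {x : B} (hx : 0 ≤ x) (hxS : x ∈ S.ideal) :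
    φ.1.val x ≤ ψ.1.val x := by
  refine φ.val_le_of_approx hx fun δ hδ => ?_
  obtain ⟨s, hs, hle⟩ := (ConjCone.mem_ideal_of_nonneg hx).1 hxS _ (half_pos hδ)
  obtain ⟨c, hc, hcx⟩ := exists_conj_approx hx (S.nonneg hs) (half_pos hδ) hle
  refine ⟨conj c s, conj_nonneg c (S.nonneg hs), hcx.trans_lt (half_lt_self hδ), ?_⟩
  rw [h _ (S.conj_mem c hs)]
  exact ψ.1.val_mono (conj_nonneg c (S.nonneg hs)) hc

theorem LscTrace.val_eq_of_mem_ideal {φ ψ : LscTrace B} {S : ConjCone B}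
    (h : ∀ s ∈ S.carrier, φ.1.val s = ψ.1.val s) {x : B} (hx : 0 ≤ x) (hxS : x ∈ S.ideal) :
    φ.1.val x = ψ.1.val x :=
  le_antisymm (LscTrace.val_le_of_mem_ideal h hx hxS)
    (LscTrace.val_le_of_mem_ideal (fun s hs => (h s hs).symm) hx hxS)

end

variable {A : Type u} [NonUnitalCStarAlgebra A] [PartialOrder A] [StarOrderedRing A]

/-- The columns `v` over `A` with `p v = v`. -/
def MatProj.IsColumn (p : MatProj A) (v : Fin p.size → A) : Prop :=
  ∀ a, ∑ b, p.mat a b * v b = v a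

omit [PartialOrder A] [StarOrderedRing A] in
theorem MatProj.IsColumn.rightMul {p : MatProj A} {v : Fin p.size → A} (hv : p.IsColumn v)
    (c : Unitization ℂ A) : p.IsColumn fun a => rightMul (v a) c := fun a => coe_eq (by
  have h : ∀ s : Finset (Fin p.size), ((∑ b ∈ s, p.mat a b * Unitization.rightMul (v b) c : A) :
      Unitization ℂ A) = ((∑ b ∈ s, p.mat a b * v b : A) : Unitization ℂ A) * c := by
    intro s
    induction s using Finset.induction_on with
    | empty => simp
    | insert b s hb ih =>
      rw [Finset.sum_insert hb, Finset.sum_insert hb, Unitization.inr_add, Unitization.inr_add,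
        ih, add_mul, Unitization.inr_mul, Unitization.inr_mul, coe_rightMul, mul_assoc]
  rw [h, hv a, coe_rightMul])

omit [PartialOrder A] [StarOrderedRing A] in
/-- The columns of `p` itself, which have `v⋆v = p_{jj}`. -/
theorem MatProj.isColumn_col (p : MatProj A) (j : Fin p.size) :
    p.IsColumn fun a => p.mat a j := fun a => by
  have := congrFun (congrFun p.isProj.isIdempotentElem.eq a) j
  rwa [Matrix.mul_apply] at this

omit [PartialOrder A] [StarOrderedRing A] in
theorem MatProj.sum_star_mul (p : MatProj A) (i j : Fin p.size) :
    ∑ a, star (p.mat a i) * p.mat a j = p.mat i j := by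
  have h1 : p.matᴴ = p.mat := p.isProj.isSelfAdjoint
  have := congrFun (congrFun p.isProj.isIdempotentElem.eq i) j
  rw [Matrix.mul_apply] at this
  rw [← this]
  refine Finset.sum_congr rfl fun a _ => ?_
  rw [← Matrix.conjTranspose_apply, h1]

/-- The cone generated by the elements `v⋆v`, for columns `v` over `A` with `p v = v` and `p ∈ P`.
It generates the smallest closed ideal of `A` which contains the entries of all `p ∈ P`. -/
def projCone (P : Set (MatProj A)) : ConjCone A where
  carrier := AddSubmonoid.closure
    {x | ∃ p ∈ P, ∃ v, MatProj.IsColumn p v ∧ x = ∑ a, star (v a) * v a}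
  nonneg {s} hs := by
    refine AddSubmonoid.closure_induction (motive := fun x _ => 0 ≤ x) ?_ le_rfl
      (fun x y _ _ => add_nonneg) hs
    rintro _ ⟨p, -, v, -, rfl⟩
    exact Finset.sum_nonneg fun a _ => star_mul_self_nonneg _
  zero_mem := zero_mem _
  add_mem := add_mem
  conj_mem c s hs := by
    refine AddSubmonoid.closure_induction
      (motive := fun x _ => conj c x ∈ AddSubmonoid.closure _) ?_ ?_ ?_ hs
    · rintro _ ⟨p, hp, v, hv, rfl⟩
      refine AddSubmonoid.subset_closure ⟨p, hp, _, hv.rightMul c, ?_⟩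
      simp only [star_rightMul_mul]
      exact map_sum (AddMonoidHom.mk' (conj c) (conj_add c)) _ _
    · rw [show conj c (0 : A) = 0 from coe_eq (by simp)]
      exact zero_mem _
    · intro x y _ _ hx hy
      rw [conj_add]
      exact add_mem hx hy

theorem mem_projCone_of_isColumn {P : Set (MatProj A)} {p : MatProj A} (hp : p ∈ P)
    {v : Fin p.size → A} (hv : p.IsColumn v) : ∑ a, star (v a) * v a ∈ (projCone P).carrier :=
  AddSubmonoid.subset_closure ⟨p, hp, v, hv, rfl⟩

/-- The diagonal entries of the projection `p` lie in the ideal `I`. For closed ideals this says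
that `p` is a projection in a matrix algebra over `I`. -/
def MatProj.DiagMem (p : MatProj A) (I : TwoSidedIdeal A) : Prop := ∀ i, p.mat i i ∈ I

theorem diagMem_projCone {P : Set (MatProj A)} {p : MatProj A} (hp : p ∈ P) :
    p.DiagMem (projCone P).ideal := fun i => by
  rw [← p.sum_star_mul i i]
  exact ConjCone.subset_ideal (mem_projCone_of_isColumn hp (p.isColumn_col i))

theorem MatProj.DiagMem.of_posIn {S : ConjCone A} {p : MatProj A} (h : p.DiagMem S.ideal)
    {x : CStarMatrix (Fin p.size) (Fin p.size) A} (hx : PosIn p.elt x) (i : Fin p.size) :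
    x i i ∈ S.ideal := by
  have hp := p.isStarProjection_elt
  refine ConjCone.mem_ideal_of_le (CStarMatrix.diag_nonneg hx.1 i)
    (CStarMatrix.diag_mono (hx.le_norm_smul hp) i) ?_
  exact ConjCone.smul_mem_ideal (CStarMatrix.diag_nonneg hp.nonneg i) (norm_nonneg _) (h i)

/-- If `v = p v`, then `v⋆v` lies in any closed ideal which contains the diagonal of `p`. -/
theorem MatProj.DiagMem.of_isColumn {S : ConjCone A} {p : MatProj A} (h : p.DiagMem S.ideal)
    {v : Fin p.size → A} (hv : p.IsColumn v) : ∑ a, star (v a) * v a ∈ S.ideal := by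
  have hcol : ∀ a b, p.mat b a ∈ S.ideal := fun a b => by
    have h1 := h a
    rw [← p.sum_star_mul a a] at h1
    refine ConjCone.star_mul_self_mem_ideal.1 (ConjCone.mem_ideal_of_le (star_mul_self_nonneg _)
      (Finset.single_le_sum (f := fun k => star (p.mat k a) * p.mat k a)
        (fun k _ => star_mul_self_nonneg _) (Finset.mem_univ b)) h1)
  refine sum_mem fun a _ => S.ideal.mul_mem_left _ _ ?_
  rw [← hv a]
  exact sum_mem fun b _ => S.ideal.mul_mem_right _ _ (hcol b a)

theorem projCone_subset_ideal {S : ConjCone A} {P : Set (MatProj A)}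
    (h : ∀ p ∈ P, p.DiagMem S.ideal) {s : A} (hs : s ∈ (projCone P).carrier) : s ∈ S.ideal := by
  refine AddSubmonoid.closure_induction (motive := fun x _ => x ∈ S.ideal) ?_ (zero_mem _)
    (fun x y _ _ => add_mem) hs
  rintro _ ⟨p, hp, v, hv, rfl⟩
  exact (h p hp).of_isColumn hv

/-- A lower semicontinuous trace takes at `v⋆v` the value which its extension to matrices takes at
`v v⋆`, a positive element of the corner of `p` if `v = p v`. -/
theorem exists_posIn_of_isColumn {p : MatProj A} {v : Fin p.size → A} (hv : p.IsColumn v) :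
    ∃ x, PosIn p.elt x ∧ ∀ φ : LscTrace A,
      φ.1.val (∑ a, star (v a) * v a) = φ.1.matVal x := by
  let x : CStarMatrix (Fin p.size) (Fin p.size) A :=
    CStarMatrix.ofMatrix fun i j => v i * star (v j)
  have hx : ∀ i j, x i j = v i * star (v j) := fun _ _ => rfl
  have hpos : 0 ≤ x := by
    rcases isEmpty_or_nonempty (Fin p.size) with h | ⟨⟨i₀⟩⟩
    · exact le_of_eq (by ext i; exact h.elim i)
    · have : x = star (rowMatrix i₀ fun a => star (v a)) * rowMatrix i₀ fun a => star (v a) := by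
        ext i j
        rw [star_rowMatrix_mul, hx, star_star]
      rw [this]
      exact star_mul_self_nonneg _
  have hpx : p.elt * x = x := by
    ext i j
    rw [CStarMatrix.mul_apply]
    simp only [hx, ← mul_assoc, ← Finset.sum_mul]
    exact congrArg (· * star (v j)) (hv i)
  have hxp : x * p.elt = x := by
    have := congrArg star hpx
    rwa [star_mul, (IsSelfAdjoint.of_nonneg hpos).star_eq,
      p.isStarProjection_elt.isSelfAdjoint.star_eq] at this
  refine ⟨x, ⟨hpos, hpx, hxp⟩, fun φ => ?_⟩
  rw [φ.1.val_sum _ _ fun a _ => star_mul_self_nonneg _]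
  exact Finset.sum_congr rfl fun a _ => φ.val_mul_star _

/-- Two lower semicontinuous traces which extend the same finite trace on the corner of `p` agree
on the closed ideal generated by `p`. -/
theorem IsRestriction.val_eq {φ ψ : LscTrace A} {p : MatProj A} {τ : FinTrace p.corner}
    (h : IsRestriction φ τ) (h' : IsRestriction ψ τ) {x : A} (hx : 0 ≤ x)
    (hxp : x ∈ (projCone {p}).ideal) : φ.1.val x = ψ.1.val x := by
  refine LscTrace.val_eq_of_mem_ideal (S := projCone {p}) (fun s hs => ?_) hx hxp
  refine (AddSubmonoid.closure_induction
    (motive := fun x _ => 0 ≤ x ∧ φ.1.val x = ψ.1.val x) ?_ ?_ ?_ hs).2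
  · rintro _ ⟨p, rfl, v, hv, rfl⟩
    obtain ⟨y, hy, e⟩ := exists_posIn_of_isColumn hv
    exact ⟨Finset.sum_nonneg fun a _ => star_mul_self_nonneg _,
      (e φ).trans ((h.matVal_eq h' hy).trans (e ψ).symm)⟩
  · exact ⟨le_rfl, φ.1.val_zero.trans ψ.1.val_zero.symm⟩
  · rintro x y _ _ ⟨hx, ex⟩ ⟨hy, ey⟩
    exact ⟨add_nonneg hx hy, by rw [φ.1.val_add hx hy, ψ.1.val_add hx hy, ex, ey]⟩

/-! ### Projections in the ideal of a family of projections -/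

/-- The block column with blocks `v` and `w`. -/
def stack {m n k : ℕ} (v : Matrix (Fin m) (Fin k) A) (w : Matrix (Fin n) (Fin k) A) :
    Matrix (Fin (m + n)) (Fin k) A :=
  (Matrix.fromRows v w).submatrix finSumFinEquiv.symm id

section Stack

variable {m n k : ℕ} (v : Matrix (Fin m) (Fin k) A) (w : Matrix (Fin n) (Fin k) A)

omit [PartialOrder A] [StarOrderedRing A]

omit [NonUnitalCStarAlgebra A] in
theorem stack_inl (i : Fin m) (j : Fin k) : stack v w (finSumFinEquiv (Sum.inl i)) j = v i j := by
  rw [stack, Matrix.submatrix_apply, Equiv.symm_apply_apply]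
  rfl

omit [NonUnitalCStarAlgebra A] in
theorem stack_inr (i : Fin n) (j : Fin k) : stack v w (finSumFinEquiv (Sum.inr i)) j = w i j := by
  rw [stack, Matrix.submatrix_apply, Equiv.symm_apply_apply]
  rfl

theorem conjTranspose_stack_mul_stack : (stack v w)ᴴ * stack v w = vᴴ * v + wᴴ * w := by
  ext i j
  simp only [Matrix.mul_apply, Matrix.add_apply, Matrix.conjTranspose_apply]
  rw [← finSumFinEquiv.sum_comp, Fintype.sum_sum_type]
  simp only [stack_inl, stack_inr]

theorem stack_mul_conjTranspose_stack : stack v w * (stack v w)ᴴ =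
    (Matrix.fromBlocks (v * vᴴ) (v * wᴴ) (w * vᴴ) (w * wᴴ)).submatrix
      finSumFinEquiv.symm finSumFinEquiv.symm := by
  ext i j
  obtain ⟨i, rfl⟩ := finSumFinEquiv.surjective i
  obtain ⟨j, rfl⟩ := finSumFinEquiv.surjective j
  rw [Matrix.submatrix_apply, Equiv.symm_apply_apply, Equiv.symm_apply_apply, Matrix.mul_apply]
  simp only [Matrix.conjTranspose_apply]
  rcases i with i | i <;> rcases j with j | j <;>
    simp only [stack_inl, stack_inr, Matrix.fromBlocks_apply₁₁, Matrix.fromBlocks_apply₁₂,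
      Matrix.fromBlocks_apply₂₁, Matrix.fromBlocks_apply₂₂, Matrix.mul_apply,
      Matrix.conjTranspose_apply]

theorem blockDiag_mul_stack (x : Matrix (Fin m) (Fin m) A) (y : Matrix (Fin n) (Fin n) A) :
    blockDiag x y * stack v w = stack (x * v) (y * w) := by
  ext i j
  obtain ⟨i, rfl⟩ := finSumFinEquiv.surjective i
  rw [blockDiag, Matrix.mul_apply, ← finSumFinEquiv.sum_comp, Fintype.sum_sum_type]
  rcases i with i | i <;>
    simp only [stack_inl, stack_inr, Matrix.submatrix_apply, Equiv.symm_apply_apply,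
      Matrix.fromBlocks_apply₁₁, Matrix.fromBlocks_apply₁₂, Matrix.fromBlocks_apply₂₁,
      Matrix.fromBlocks_apply₂₂, Matrix.zero_apply, zero_mul, Finset.sum_const_zero, add_zero,
      zero_add, Matrix.mul_apply]

end Stack

omit [PartialOrder A] [StarOrderedRing A] in
/-- Orthogonal projections `e` and `f` in the same matrix algebra satisfy `[e + f] = [e] + [f]`. -/
theorem KZero.of_add_of_mul_eq_zero {n : ℕ} {e f g : Matrix (Fin n) (Fin n) A}
    (he : IsStarProjection e) (hf : IsStarProjection f) (hg : IsStarProjection g)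
    (hef : e * f = 0) (h : g = e + f) :
    KZero.of ⟨n, g, hg⟩ = KZero.of ⟨n, e, he⟩ + KZero.of ⟨n, f, hf⟩ := by
  have he' : eᴴ = e := he.isSelfAdjoint
  have hf' : fᴴ = f := hf.isSelfAdjoint
  have hfe : f * e = 0 := by
    rw [← he', ← hf', ← Matrix.conjTranspose_mul, hef, Matrix.conjTranspose_zero]
  rw [← KZero.of_dsum]
  refine Subtype.ext (KZeroUnital.of_mvN (MatProj.MvN.map _ ⟨stack e f, ?_, ?_⟩))
  · show (stack e f)ᴴ * stack e f = g
    rw [conjTranspose_stack_mul_stack, he', hf', he.isIdempotentElem.eq, hf.isIdempotentElem.eq, h]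
  · show stack e f * (stack e f)ᴴ = blockDiag e f
    rw [stack_mul_conjTranspose_stack, he', hf', he.isIdempotentElem.eq, hf.isIdempotentElem.eq,
      hef, hfe, blockDiag]

omit [PartialOrder A] [StarOrderedRing A] in
theorem KZero.of_mvN {p q : MatProj A} (h : p.MvN q) : KZero.of p = KZero.of q :=
  Subtype.ext (KZeroUnital.of_mvN (h.map _))

/-- If `q = v⋆v` and `p v = v`, then `[p] - [q]` is the class of the projection `p - v v⋆`. -/
theorem KZero.exists_add_of_conjTranspose_mul {p q : MatProj A}
    {v : Matrix (Fin p.size) (Fin q.size) A} (hv : vᴴ * v = q.mat) (hpv : p.mat * v = v) :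
    ∃ f : MatProj A, KZero.of p = KZero.of q + KZero.of f := by
  have hq := q.isProj.isIdempotentElem.eq
  have hq' : q.matᴴ = q.mat := q.isProj.isSelfAdjoint
  have hp := p.isProj.isIdempotentElem.eq
  have hp' : p.matᴴ = p.mat := p.isProj.isSelfAdjoint
  -- `v q = v`, since `(v - v q)⋆ (v - v q) = q - q - q + q`.
  have hvq : v * q.mat = v := by
    have h0 : (v - v * q.mat)ᴴ * (v - v * q.mat) = 0 := by
      have e1 : vᴴ * (v * q.mat) = q.mat := by rw [← Matrix.mul_assoc, hv, hq]
      rw [Matrix.conjTranspose_sub, Matrix.conjTranspose_mul, hq', Matrix.sub_mul, Matrix.mul_sub,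
        Matrix.mul_sub, Matrix.mul_assoc q.mat, Matrix.mul_assoc q.mat, hv, e1, hq]
      simp
    have h1 : v - v * q.mat = 0 := by
      ext a i
      have h2 := congrFun (congrFun h0 i) i
      rw [Matrix.mul_apply] at h2
      have h3 := (Finset.sum_eq_zero_iff_of_nonneg (fun k _ => by
        rw [Matrix.conjTranspose_apply]
        exact star_mul_self_nonneg _)).1 h2 a (Finset.mem_univ a)
      rw [Matrix.conjTranspose_apply] at h3
      exact CStarRing.star_mul_self_eq_zero_iff _ |>.1 h3
    exact (sub_eq_zero.1 h1).symm
  have hvp : vᴴ * p.mat = vᴴ := by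
    rw [← hp', ← Matrix.conjTranspose_mul, hpv]
  have he : IsStarProjection (v * vᴴ) := by
    refine ⟨?_, ?_⟩
    · show v * vᴴ * (v * vᴴ) = v * vᴴ
      rw [Matrix.mul_assoc, ← Matrix.mul_assoc vᴴ, hv, ← Matrix.mul_assoc, hvq]
    · show (v * vᴴ)ᴴ = v * vᴴ
      rw [Matrix.conjTranspose_mul, Matrix.conjTranspose_conjTranspose]
  have hpe : p.mat * (v * vᴴ) = v * vᴴ := by rw [← Matrix.mul_assoc, hpv]
  have hep : v * vᴴ * p.mat = v * vᴴ := by rw [Matrix.mul_assoc, hvp]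
  have hee := he.isIdempotentElem.eq
  have hf : IsStarProjection (p.mat - v * vᴴ) := by
    refine ⟨?_, p.isProj.isSelfAdjoint.sub he.isSelfAdjoint⟩
    show (p.mat - v * vᴴ) * (p.mat - v * vᴴ) = _
    rw [mul_sub, sub_mul, sub_mul, hp, hpe, hep, hee]
    simp
  refine ⟨⟨p.size, _, hf⟩, ?_⟩
  have h1 := KZero.of_add_of_mul_eq_zero he hf p.isProj
    (by rw [mul_sub, hep, hee, sub_self]) (by rw [add_sub_cancel])
  have h2 : KZero.of q = KZero.of ⟨p.size, v * vᴴ, he⟩ := KZero.of_mvN ⟨v, hv, rfl⟩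
  rw [h2]
  exact h1

/-- For a family `P` of projections which is closed under orthogonal sums, the cone of the matrices
`v⋆v` with `v = p v` and `p ∈ P`. -/
def matCone (P : Set (MatProj A)) (hne : P.Nonempty)
    (hP : ∀ p ∈ P, ∀ q ∈ P, p.dsum q ∈ P) (k : ℕ) : ConjCone (CStarMatrix (Fin k) (Fin k) A) where
  carrier := {x | ∃ p ∈ P, ∃ v : Matrix (Fin p.size) (Fin k) A, p.mat * v = v ∧
    x = CStarMatrix.ofMatrix (vᴴ * v)}
  nonneg := by
    rintro _ ⟨p, -, v, -, rfl⟩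
    have h : ∀ s : Finset (Fin p.size), (0 : CStarMatrix (Fin k) (Fin k) A) ≤
        CStarMatrix.ofMatrix (Matrix.of fun i j => ∑ a ∈ s, star (v a i) * v a j) := by
      intro s
      induction s using Finset.induction_on with
      | empty => exact le_of_eq (by ext i j; rfl)
      | insert a s ha ih =>
        rcases isEmpty_or_nonempty (Fin k) with h | ⟨⟨i₀⟩⟩
        · exact le_of_eq (by ext i; exact h.elim i)
        · refine (add_nonneg ih (star_mul_self_nonneg (rowMatrix i₀ (v a)))).trans_eq ?_
          ext i j
          rw [CStarMatrix.add_apply, star_rowMatrix_mul, add_comm]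
          exact (Finset.sum_insert (f := fun a => star (v a i) * v a j) ha).symm
    exact h Finset.univ
  zero_mem := by
    obtain ⟨p, hp⟩ := hne
    exact ⟨p, hp, 0, Matrix.mul_zero _, by rw [Matrix.mul_zero]; rfl⟩
  add_mem := by
    rintro _ _ ⟨p, hp, v, hv, rfl⟩ ⟨q, hq, w, hw, rfl⟩
    refine ⟨p.dsum q, hP p hp q hq, stack v w, ?_, ?_⟩
    · show blockDiag p.mat q.mat * stack v w = stack v w
      rw [blockDiag_mul_stack, hv, hw]
    · exact congrArg CStarMatrix.ofMatrix (conjTranspose_stack_mul_stack v w).symm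
  conj_mem := by
    rintro c _ ⟨p, hp, v, hv, rfl⟩
    let b : Matrix (Fin k) (Fin k) A := CStarMatrix.ofMatrix.symm c.snd
    refine ⟨p, hp, c.fst • v + v * b, ?_, ?_⟩
    · rw [Matrix.mul_add, Matrix.mul_smul, hv, ← Matrix.mul_assoc, hv]
    · have e : conj c (CStarMatrix.ofMatrix (vᴴ * v)) = CStarMatrix.ofMatrix
          ((star c.fst * c.fst) • (vᴴ * v) + c.fst • (bᴴ * (vᴴ * v)) +
            star c.fst • (vᴴ * v * b) + bᴴ * (vᴴ * v) * b) := by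
        have e1 : ∀ x : CStarMatrix (Fin k) (Fin k) A, conj c x =
            (star c.fst * c.fst) • x + c.fst • (star c.snd * x) +
            star c.fst • (x * c.snd) + star c.snd * x * c.snd := by
          intro x
          simp [conj, smul_smul, add_mul, mul_comm]
          abel
        rw [e1]
        rfl
      rw [e]
      refine congrArg CStarMatrix.ofMatrix ?_
      rw [Matrix.conjTranspose_add, Matrix.conjTranspose_smul, Matrix.conjTranspose_mul]
      simp only [Matrix.add_mul, Matrix.mul_add, Matrix.smul_mul, Matrix.mul_smul,
        Matrix.mul_assoc, smul_add, smul_smul]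
      rw [mul_comm c.fst]
      abel

theorem cornerMatrix_mem_matCone {P : Set (MatProj A)} (hne : P.Nonempty)
    (hP : ∀ p ∈ P, ∀ q ∈ P, p.dsum q ∈ P) {k : ℕ} (i : Fin k) {s : A}
    (hs : s ∈ (projCone P).carrier) : cornerMatrix i s ∈ (matCone P hne hP k).carrier := by
  refine AddSubmonoid.closure_induction
    (motive := fun x _ => cornerMatrix i x ∈ (matCone P hne hP k).carrier) ?_ ?_ ?_ hs
  · rintro _ ⟨p, hp, v, hv, rfl⟩
    refine ⟨p, hp, Matrix.of fun a j => if j = i then v a else 0, ?_, ?_⟩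
    · ext a j
      rw [Matrix.mul_apply]
      by_cases hj : j = i
      · simpa [hj] using hv a
      · simp [hj]
    · ext j l
      rw [cornerMatrix_apply]
      show _ = ((Matrix.of fun a j => if j = i then v a else 0)ᴴ *
        (Matrix.of fun a j => if j = i then v a else 0) : Matrix _ _ A) j l
      rw [Matrix.mul_apply]
      by_cases hj : j = i <;> by_cases hl : l = i <;> simp [hj, hl]
  · have : cornerMatrix i (0 : A) = 0 := by
      ext j l
      simp [cornerMatrix_apply]
    rw [this]
    exact (matCone P hne hP k).zero_mem
  · intro x y _ _ hx hy
    rw [cornerMatrix_add]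
    exact (matCone P hne hP k).add_mem hx hy

theorem cornerMatrix_mem_ideal {P : Set (MatProj A)} (hne : P.Nonempty)
    (hP : ∀ p ∈ P, ∀ q ∈ P, p.dsum q ∈ P) {k : ℕ} (i : Fin k) {x : A} (hx : 0 ≤ x)
    (h : x ∈ (projCone P).ideal) : cornerMatrix i x ∈ (matCone P hne hP k).ideal := by
  have hcl := ((matCone P hne hP k).isClosed_ideal).preimage (continuous_cornerMatrix (A := A) i)
  refine closure_minimal (s := (projCone P).carrier) (fun s hs => ?_) hcl ?_
  · exact ConjCone.subset_ideal (cornerMatrix_mem_matCone hne hP i hs)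
  · exact ConjCone.mem_closure_of_mem_ideal hx h

/-- A projection in a matrix algebra over the closed ideal generated by `P` is of the form `v⋆v`
with `v = p v` and `p ∈ P`. -/
theorem MatProj.DiagMem.exists_eq_conjTranspose_mul {P : Set (MatProj A)} (hne : P.Nonempty)
    (hP : ∀ p ∈ P, ∀ q ∈ P, p.dsum q ∈ P) {q : MatProj A} (hq : q.DiagMem (projCone P).ideal) :
    ∃ p ∈ P, ∃ v : Matrix (Fin p.size) (Fin q.size) A, p.mat * v = v ∧ vᴴ * v = q.mat := by
  have hqe := q.isStarProjection_elt
  set T := matCone P hne hP q.size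
  -- The column matrices of `q` lie in the ideal since their squares are the diagonal entries.
  let col : Fin q.size → CStarMatrix (Fin q.size) (Fin q.size) A := fun i =>
    CStarMatrix.ofMatrix fun a j => if j = i then q.mat a i else 0
  have hcol : ∀ i, col i ∈ T.ideal := fun i => by
    refine ConjCone.star_mul_self_mem_ideal.1 ?_
    have : star (col i) * col i = cornerMatrix i (q.mat i i) := by
      ext j l
      rw [CStarMatrix.star_mul_self_apply, cornerMatrix_apply]
      have hc : ∀ a j, col i a j = if j = i then q.mat a i else 0 := fun _ _ => rfl
      simp only [hc]
      by_cases hj : j = i <;> by_cases hl : l = i <;> simp [hj, hl, q.sum_star_mul]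
    rw [this]
    exact cornerMatrix_mem_ideal hne hP i (CStarMatrix.diag_nonneg hqe.nonneg i) (hq i)
  have hsum : q.elt = ∑ i, col i := by
    ext a j
    have : ∀ s : Finset (Fin q.size), (∑ i ∈ s, col i) a j = ∑ i ∈ s, col i a j := by
      intro s
      induction s using Finset.induction_on with
      | empty => rfl
      | insert i s hi ih =>
        rw [Finset.sum_insert hi, Finset.sum_insert hi, CStarMatrix.add_apply, ih]
    rw [this, Finset.sum_eq_single j]
    · exact (if_pos rfl).symm
    · exact fun i _ hi => if_neg (Ne.symm hi)
    · simp
  have hmem : q.elt ∈ T.ideal := by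
    rw [hsum]
    exact sum_mem fun i _ => hcol i
  obtain ⟨p, hp, v, hv, e⟩ := ConjCone.mem_of_isStarProjection hqe hmem
  exact ⟨p, hp, v, hv, (congrArg CStarMatrix.ofMatrix.symm e).symm⟩

end ProjectionIdeals

/-! ### The pairing of traces with `K₀` -/

section Pairing

variable {A : Type u} [NonUnitalCStarAlgebra A] [PartialOrder A] [StarOrderedRing A]

theorem CTrace.atProj_eq_sum (φ : CTrace A) (p : MatProj A) :
    φ.atProj p = ∑ i, φ.val (p.mat i i) := φ.atProj_eq p

theorem CTrace.atProj_dsum (φ : CTrace A) (p q : MatProj A) :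
    φ.atProj (p.dsum q) = φ.atProj p + φ.atProj q := by
  simp only [CTrace.atProj_eq_sum]
  refine (finSumFinEquiv.sum_comp fun i => φ.val ((p.dsum q).mat i i)).symm.trans ?_
  rw [Fintype.sum_sum_type]
  have h : ∀ i j, (p.dsum q).mat (finSumFinEquiv i) (finSumFinEquiv j) =
      Matrix.fromBlocks p.mat 0 0 q.mat i j := fun i j => by
    show blockDiag p.mat q.mat _ _ = _
    rw [blockDiag, Matrix.submatrix_apply, Equiv.symm_apply_apply, Equiv.symm_apply_apply]
  simp only [h]
  rfl

theorem CTrace.add_atProj (φ ψ : CTrace A) (p : MatProj A) :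
    (φ + ψ).atProj p = φ.atProj p + ψ.atProj p := by
  simp only [CTrace.atProj_eq_sum, CTrace.add_val, Finset.sum_add_distrib]

theorem CTrace.smul_atProj (t : PosReal) (φ : CTrace A) (p : MatProj A) :
    (t • φ).atProj p = ENNReal.ofReal t.1 * φ.atProj p := by
  simp only [CTrace.atProj_eq_sum, CTrace.smul_val, Finset.mul_sum]

/-- The trace which vanishes on a closed ideal and is infinite off it detects the projections over
the ideal. -/
theorem MatProj.diagMem_iff (S : ConjCone A) (p : MatProj A) :
    p.DiagMem S.ideal ↔ S.indicator.1.atProj p < ∞ := by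
  rw [CTrace.atProj_eq_sum]
  refine ⟨fun h => ?_, fun h i => ?_⟩
  · rw [Finset.sum_eq_zero fun i _ => ConjCone.indicator_val_of_mem S (h i)]
    exact ENNReal.zero_lt_top
  · by_contra hi
    have h1 := ENNReal.sum_lt_top.1 h i (Finset.mem_univ i)
    have h2 := ConjCone.indicator_val_of_notMem S
      (CStarMatrix.diag_nonneg p.isStarProjection_elt.nonneg i) hi
    exact h1.ne h2

/-- The cone `{0}`. -/
def zeroCone (A : Type u) [NonUnitalCStarAlgebra A] [PartialOrder A] : ConjCone A where
  carrier := {0}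
  nonneg h := by rw [Set.mem_singleton_iff.1 h]
  zero_mem := rfl
  add_mem h h' := by rw [Set.mem_singleton_iff.1 h, Set.mem_singleton_iff.1 h', add_zero]; rfl
  conj_mem c _ h := by
    rw [Set.mem_singleton_iff.1 h]
    exact Unitization.coe_eq (by simp)

theorem MatProj.mat_eq_zero_of_diagMem {p : MatProj A} (h : p.DiagMem (zeroCone A).ideal) :
    p.mat = 0 := by
  ext a i
  have h1 : p.mat i i = 0 := by
    have hcl : closure (zeroCone A).carrier = {0} := closure_singleton
    have := ConjCone.mem_closure_of_mem_ideal
      (CStarMatrix.diag_nonneg p.isStarProjection_elt.nonneg i) (h i)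
    rw [hcl] at this
    exact this
  rw [← p.sum_star_mul i i,
    Finset.sum_eq_zero_iff_of_nonneg fun k _ => star_mul_self_nonneg _] at h1
  exact (CStarRing.star_mul_self_eq_zero_iff _).1 (h1 a (Finset.mem_univ a))

variable (hwd : PairingWellDefined A)

include hwd

theorem extendedElliott_isObject : (extendedElliott A).IsObject where
  ordered :=
    { antisymm := fun x hx hx' => by
        obtain ⟨p, hp⟩ := exists_rep A ⟨x, hx⟩
        obtain ⟨q, hq⟩ := exists_rep A ⟨-x, hx'⟩
        have h0 : KZero.of (p.dsum q) = KZero.of (⟨0, 0, .zero _⟩ : MatProj A) := by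
          rw [KZero.of_dsum, hp, hq, KZero.of_eq_zero ⟨0, 0, _⟩ rfl]
          exact add_neg_cancel x
        -- The trace which is infinite off `0` vanishes at `p ⊕ q`, so `p = 0`.
        have h1 := hwd _ _ h0 (zeroCone A).indicator
        rw [CTrace.atProj_dsum, CTrace.atProj_eq_sum _ ⟨0, 0, _⟩] at h1
        have h2 : (zeroCone A).indicator.1.atProj p = 0 := by
          refine (add_eq_zero.1 (h1.trans ?_)).1
          exact Finset.sum_empty
        have h3 : p.mat = 0 :=
          MatProj.mat_eq_zero_of_diagMem ((MatProj.diagMem_iff _ _).2 (by simp [h2]))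
        exact hp.symm.trans (KZero.of_eq_zero p h3)
      scale_subset := by
        rintro _ ⟨p, -, rfl⟩
        exact AddSubmonoid.subset_closure ⟨p, rfl⟩ }
  pairing_zero φ := by
    have h0 : KZero.of (rep (0 : kZeroPos A)) = KZero.of (⟨0, 0, .zero _⟩ : MatProj A) := by
      rw [rep_spec, KZero.of_eq_zero ⟨0, 0, _⟩ rfl]
      rfl
    refine (hwd _ _ h0 φ).trans ?_
    rw [CTrace.atProj_eq_sum]
    exact Finset.sum_empty
  pairing_add p q φ := by
    refine (hwd (rep (A := A) (p + q)) ((rep (A := A) p).dsum (rep (A := A) q)) ?_ φ).trans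
      (φ.1.atProj_dsum _ _)
    rw [KZero.of_dsum]
    exact (rep_spec _).trans (congrArg₂ (· + ·) (rep_spec _).symm (rep_spec _).symm)
  pairing_add_right p φ ψ := CTrace.add_atProj φ.1 ψ.1 (rep (A := A) p)
  pairing_smul_right p t φ := CTrace.smul_atProj t φ.1 (rep (A := A) p)

theorem LscTrace.atProj_rep (φ : LscTrace A) {p : MatProj A} {x : kZeroPos A}
    (h : KZero.of p = x) : φ.1.atProj p = φ.1.atProj (rep x) :=
  hwd _ _ (h.trans (rep_spec x).symm) φ

theorem LscTrace.atProj_lt_top_of_dominated (φ : LscTrace A) {e p : kZeroPos A}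
    (h : (cstarKTuple A).Dominated e p) (hφ : φ.1.atProj (rep p) < ∞) :
    φ.1.atProj (rep e) < ∞ :=
  (extendedElliott_isObject hwd).pairing_lt_top h ⟨φ, hφ⟩

/-- If `[e] ≤ n [p]` and `p` is a projection over a closed ideal, then so is `e`: this is seen by
pairing with the trace which vanishes on the ideal and is infinite off it. -/
theorem MatProj.DiagMem.of_dominated {S : ConjCone A} {x y : kZeroPos A}
    (h : (cstarKTuple A).Dominated x y) {e p : MatProj A} (he : KZero.of e = x)
    (hp : KZero.of p = y) (hd : p.DiagMem S.ideal) : e.DiagMem S.ideal := by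
  rw [MatProj.diagMem_iff, LscTrace.atProj_rep hwd _ ‹_›] at hd ⊢
  exact LscTrace.atProj_lt_top_of_dominated hwd _ h hd

/-- Two traces with the same finite restriction to the corner of `p` agree on the corner of `e`
if `[e] ≤ n [p]`. -/
theorem IsRestriction.matVal_eq_of_dominated {φ ψ : LscTrace A} {e p : kZeroPos A}
    (h : (cstarKTuple A).Dominated e p) {τ : FinTrace (rep p).corner} (hφ : IsRestriction φ τ)
    (hψ : IsRestriction ψ τ) {x : CStarMatrix (Fin (rep e).size) (Fin (rep e).size) A}
    (hx : PosIn (rep e).elt x) : φ.1.matVal x = ψ.1.matVal x := by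
  have hd : (rep e).DiagMem (projCone {rep p}).ideal :=
    MatProj.DiagMem.of_dominated hwd h (rep_spec e) (rep_spec p) (diagMem_projCone rfl)
  exact Finset.sum_congr rfl fun i _ =>
    hφ.val_eq hψ (CStarMatrix.diag_nonneg hx.1 i) (hd.of_posIn hx i)

/-- The pairing of the Stevens invariant can be computed with any extension. -/
theorem stevens_pairing_eq {p e : kZeroPos A} (h : (cstarKTuple A).Dominated e p)
    {τ : FinTrace (rep p).corner} {φ : LscTrace A} (hφ : IsRestriction φ τ) :
    ((stevens A).pairing p e h τ : ℝ≥0∞) = φ.1.atProj (rep e) := by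
  have hex : ∃ φ : LscTrace A, IsRestriction φ τ := ⟨φ, hφ⟩
  have e1 : (stevens A).pairing p e h τ = (hex.choose.1.atProj (rep e)).toNNReal := dif_pos hex
  have e2 : hex.choose.1.atProj (rep e) = φ.1.atProj (rep e) := by
    rw [CTrace.atProj_eq, CTrace.atProj_eq]
    exact IsRestriction.matVal_eq_of_dominated hwd h hex.choose_spec hφ
      (posIn_self (rep e).isStarProjection_elt)
  rw [e1, e2]
  exact ENNReal.coe_toNNReal
    (LscTrace.atProj_lt_top_of_dominated hwd φ h hφ.atProj_lt_top).ne

/-- The restriction maps of the Stevens invariant can be computed with any extension. -/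
theorem stevens_res_isRestriction {p q : kZeroPos A} (h : (cstarKTuple A).Le q p)
    {τ : FinTrace (rep p).corner} {φ : LscTrace A} (hφ : IsRestriction φ τ) :
    IsRestriction φ (p := rep q) ((stevens A).res p q h τ) := by
  have hd := (cstarKTuple A).dominated_of_le h
  have hex : ∃ σ : FinTrace (rep q).corner, ∃ φ : LscTrace A,
      IsRestriction φ τ ∧ IsRestriction φ σ :=
    ⟨φ.restrict (rep q) (LscTrace.atProj_lt_top_of_dominated hwd φ hd hφ.atProj_lt_top), φ, hφ,
      φ.restrict_isRestriction _ _⟩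
  have e1 : (stevens A).res p q h τ = hex.choose := dif_pos hex
  obtain ⟨ψ, h1, h2⟩ := hex.choose_spec
  rw [e1]
  refine isRestriction_iff.2 fun x hx => ?_
  exact (isRestriction_iff.1 h2 x hx).trans
    (IsRestriction.matVal_eq_of_dominated hwd hd h1 hφ hx)

omit hwd

theorem IsRestriction.add {φ ψ : LscTrace A} {p : MatProj A} {τ σ : FinTrace p.corner}
    (h : IsRestriction φ τ) (h' : IsRestriction ψ σ) : IsRestriction (φ + ψ) (τ + σ) := fun x =>
  (congrArg₂ (· + ·) (h x) (h' x)).trans Finset.sum_add_distrib.symm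

theorem IsRestriction.smul {φ : LscTrace A} {p : MatProj A} {τ : FinTrace p.corner}
    (h : IsRestriction φ τ) (t : PosReal) : IsRestriction (t • φ) (t • τ) := fun x =>
  (congrArg (ENNReal.ofReal t.1 * ·) (h x)).trans (Finset.mul_sum _ _ _)

include hwd

theorem stevens_isObject : (stevens A).IsObject where
  ordered := (extendedElliott_isObject hwd).ordered
  pairing_add p e f he hf τ := by
    obtain ⟨μ, hμ, -⟩ := exists_smallest_extension (p := rep (A := A) p) τ
    refine ENNReal.coe_injective ?_
    rw [ENNReal.coe_add, stevens_pairing_eq hwd he hμ, stevens_pairing_eq hwd hf hμ]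
    refine (stevens_pairing_eq hwd _ hμ).trans ?_
    exact (extendedElliott_isObject hwd).pairing_add e f μ
  pairing_add_right p e he τ σ := by
    obtain ⟨μ, hμ, -⟩ := exists_smallest_extension (p := rep (A := A) p) τ
    obtain ⟨ν, hν, -⟩ := exists_smallest_extension (p := rep (A := A) p) σ
    refine ENNReal.coe_injective ?_
    rw [ENNReal.coe_add, stevens_pairing_eq hwd he hμ, stevens_pairing_eq hwd he hν]
    refine (stevens_pairing_eq hwd he (hμ.add hν)).trans ?_
    exact CTrace.add_atProj μ.1 ν.1 (rep (A := A) e)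
  pairing_smul_right p e he t τ := by
    obtain ⟨μ, hμ, -⟩ := exists_smallest_extension (p := rep (A := A) p) τ
    refine ENNReal.coe_injective ?_
    rw [ENNReal.coe_mul, stevens_pairing_eq hwd he hμ]
    refine (stevens_pairing_eq hwd he (hμ.smul t)).trans ?_
    exact CTrace.smul_atProj t μ.1 (rep (A := A) e)
  res_add p q h τ σ := by
    obtain ⟨μ, hμ, -⟩ := exists_smallest_extension (p := rep (A := A) p) τ
    obtain ⟨ν, hν, -⟩ := exists_smallest_extension (p := rep (A := A) p) σ
    exact (stevens_res_isRestriction hwd h (hμ.add hν)).unique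
      ((stevens_res_isRestriction hwd h hμ).add (stevens_res_isRestriction hwd h hν))
  res_smul p q h t τ := by
    obtain ⟨μ, hμ, -⟩ := exists_smallest_extension (p := rep (A := A) p) τ
    exact (stevens_res_isRestriction hwd h (hμ.smul t)).unique
      ((stevens_res_isRestriction hwd h hμ).smul t)
  res_self p τ := by
    obtain ⟨μ, hμ, -⟩ := exists_smallest_extension (p := rep (A := A) p) τ
    exact (stevens_res_isRestriction hwd _ hμ).unique hμ
  res_res p q r hqp hrq hrp τ := by
    obtain ⟨μ, hμ, -⟩ := exists_smallest_extension (p := rep (A := A) p) τ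
    exact (stevens_res_isRestriction hwd hrq (stevens_res_isRestriction hwd hqp hμ)).unique
      (stevens_res_isRestriction hwd hrp hμ)
  pairing_res p q e h he τ := by
    obtain ⟨μ, hμ, -⟩ := exists_smallest_extension (p := rep (A := A) p) τ
    refine ENNReal.coe_injective ?_
    exact (stevens_pairing_eq hwd _ hμ).trans
      (stevens_pairing_eq hwd he (stevens_res_isRestriction hwd h hμ)).symm

end Pairing

/-! ### From lower semicontinuous traces to finite traces on corners -/

section ElliottToStevens

variable {A : Type u} [NonUnitalCStarAlgebra A] [PartialOrder A] [StarOrderedRing A]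

theorem LscTrace.ext_val {φ ψ : LscTrace A} (h : ∀ x, 0 ≤ x → φ.1.val x = ψ.1.val x) : φ = ψ :=
  Subtype.ext (CTrace.ext_val h)

omit [PartialOrder A] [StarOrderedRing A] in
theorem LscTrace.add_val (φ ψ : LscTrace A) (x : A) :
    (φ + ψ).1.val x = φ.1.val x + ψ.1.val x := CTrace.add_val φ.1 ψ.1 x

omit [PartialOrder A] [StarOrderedRing A] in
theorem LscTrace.smul_val (t : PosReal) (φ : LscTrace A) (x : A) :
    (t • φ).1.val x = ENNReal.ofReal t.1 * φ.1.val x := CTrace.smul_val t φ.1 x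

omit [PartialOrder A] [StarOrderedRing A] in
theorem LscTrace.isAffine_matVal {n : ℕ} (x : CStarMatrix (Fin n) (Fin n) A) :
    IsAffine fun φ : LscTrace A => φ.1.matVal x := fun s t _ φ ψ => by
  simp only [CTrace.matVal, LscTrace.add_val, LscTrace.smul_val, Finset.mul_sum,
    Finset.sum_add_distrib]

/-- An affine map which is finite at the traces finite at `p` takes the same value at two such traces
if these have the same restriction to the corner of `p`: one has `φ + ρ = ψ + ρ`, where `ρ` is `0`
on the ideal generated by `p` and `∞` off it; as `ρ(p) = 0`, the map is finite at `ρ` and this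
summand can be cancelled. -/
theorem IsRestriction.affine_eq {p : MatProj A} {φ ψ : LscTrace A} {τ : FinTrace p.corner}
    (hφ : IsRestriction φ τ) (hψ : IsRestriction ψ τ) {f : LscTrace A → ℝ≥0∞} (hf : IsAffine f)
    (hfin : ∀ ρ : LscTrace A, ρ.1.atProj p < ∞ → f ρ < ∞) : f φ = f ψ := by
  let ρ : LscTrace A := (projCone {p}).indicator
  have hρ : f ρ < ∞ :=
    hfin ρ ((MatProj.diagMem_iff _ _).1 (diagMem_projCone (Set.mem_singleton _)))
  have e : φ + ρ = ψ + ρ := LscTrace.ext_val fun x hx => by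
    rw [LscTrace.add_val, LscTrace.add_val]
    by_cases hxp : x ∈ (projCone {p}).ideal
    · rw [hφ.val_eq hψ hx hxp]
    · rw [ConjCone.indicator_val_of_notMem _ hx hxp, add_top, add_top]
  let t : PosReal := ⟨1 / 2, by norm_num⟩
  have ht : t.1 + t.1 = 1 := by norm_num [t]
  have h1 : f (t • φ + t • ρ) = f (t • ψ + t • ρ) := by
    rw [← RealCone.smul_add', ← RealCone.smul_add', e]
  rw [hf t t ht, hf t t ht] at h1
  have h2 := (ENNReal.add_left_inj (ENNReal.mul_ne_top ENNReal.ofReal_ne_top hρ.ne)).1 h1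
  exact (ENNReal.mul_right_inj (ENNReal.ofReal_pos.2 t.2).ne' ENNReal.ofReal_ne_top).1 h2

/-- Two traces finite at `p` are equivalent exactly when they have the same restriction to the
corner of `p`. -/
theorem finSetoid_iff {p : kZeroPos A} {φ ψ : (extendedElliott A).FinPart p}
    {τ σ : FinTrace (rep p).corner} (hφ : IsRestriction φ.1 τ) (hψ : IsRestriction ψ.1 σ) :
    (extendedElliott A).finSetoid p φ ψ ↔ τ = σ := by
  constructor
  · intro h
    have h1 : IsRestriction ψ.1 τ := isRestriction_iff.2 fun x hx =>
      (isRestriction_iff.1 hφ x hx).trans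
        (h (fun φ : LscTrace A => φ.1.matVal x.1) (LscTrace.isAffine_matVal x.1)
          fun ρ => (LscTrace.matVal_ne_top_of_posIn ρ.1 ρ.2 hx).lt_top)
    exact h1.unique hψ
  · rintro rfl f hf hfin
    exact hφ.affine_eq hψ hf fun ρ hρ => hfin ⟨ρ, hρ⟩

/-- The restriction map from the classes of traces finite at `p` to the finite traces on the corner
of `p`. -/
def quotRestrict (p : kZeroPos A) :
    (extendedElliott A).QuotPart p → FinTrace (rep p).corner :=
  Quotient.lift (fun φ => LscTrace.restrict φ.1 (rep p) φ.2) fun φ ψ h =>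
    (finSetoid_iff (LscTrace.restrict_isRestriction φ.1 (rep p) φ.2)
      (LscTrace.restrict_isRestriction ψ.1 (rep p) ψ.2)).1 h

theorem quotRestrict_isRestriction {p : kZeroPos A} (φ : (extendedElliott A).FinPart p) :
    IsRestriction φ.1 (quotRestrict p (ElliottTuple.QuotPart.mk φ)) :=
  LscTrace.restrict_isRestriction φ.1 (rep p) φ.2

theorem quotRestrict_eq {p : kZeroPos A} {φ : (extendedElliott A).FinPart p}
    {τ : FinTrace (rep p).corner} (h : IsRestriction φ.1 τ) :
    quotRestrict p (ElliottTuple.QuotPart.mk φ) = τ :=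
  (quotRestrict_isRestriction φ).unique h

theorem quotRestrict_bijective (p : kZeroPos A) :
    Function.Bijective (quotRestrict p) := by
  constructor
  · rintro ⟨φ⟩ ⟨ψ⟩ h
    exact Quotient.sound ((finSetoid_iff (quotRestrict_isRestriction φ)
      (quotRestrict_isRestriction ψ)).2 h)
  · intro τ
    obtain ⟨μ, hμ, -⟩ := exists_smallest_extension τ
    exact ⟨ElliottTuple.QuotPart.mk ⟨μ, hμ.atProj_lt_top⟩, quotRestrict_eq hμ⟩

/-- The identification of the classes of traces finite at `p` with the finite traces on the corner
of `p`. -/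
def quotEquiv (p : kZeroPos A) : FinTrace (rep p).corner ≃ (extendedElliott A).QuotPart p :=
  (Equiv.ofBijective _ (quotRestrict_bijective p)).symm

theorem quotEquiv_eq {p : kZeroPos A} {φ : (extendedElliott A).FinPart p}
    {τ : FinTrace (rep p).corner} (h : IsRestriction φ.1 τ) :
    quotEquiv p τ = ElliottTuple.QuotPart.mk φ :=
  (Equiv.symm_apply_eq _).2 (quotRestrict_eq h).symm

/-- The identity isomorphism of `K`-theoretic parts. -/
def KIso.refl (K : KTuple.{u}) : KIso K K where
  θ0 := AddEquiv.refl _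
  map_pos _ := Iff.rfl
  map_scale _ := Iff.rfl
  θ1 := AddEquiv.refl _

/-- The isomorphism from `G` of the extended Elliott invariant to the Stevens invariant. -/
def stevensIso (hwd : PairingWellDefined A) :
    StevensIso ((extendedElliott A).toStevens (extendedElliott_isObject hwd)) (stevens A) where
  toKIso := KIso.refl (cstarKTuple A)
  ξ p := quotEquiv p
  ξ_add p τ σ := by
    obtain ⟨μ, hμ, -⟩ := exists_smallest_extension (p := rep (A := A) p) τ
    obtain ⟨ν, hν, -⟩ := exists_smallest_extension (p := rep (A := A) p) σ
    have h1 := quotEquiv_eq (φ := ⟨μ, hμ.atProj_lt_top⟩) hμ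
    have h2 := quotEquiv_eq (φ := ⟨ν, hν.atProj_lt_top⟩) hν
    refine (quotEquiv_eq (φ := ⟨μ + ν, (hμ.add hν).atProj_lt_top⟩) (hμ.add hν)).trans ?_
    exact (congrArg₂ (fun a b : ((extendedElliott A).toStevens
      (extendedElliott_isObject hwd)).Δ p => a + b) h1 h2).symm
  ξ_smul p t τ := by
    obtain ⟨μ, hμ, -⟩ := exists_smallest_extension (p := rep (A := A) p) τ
    have h1 := quotEquiv_eq (φ := ⟨μ, hμ.atProj_lt_top⟩) hμ
    refine (quotEquiv_eq (φ := ⟨t • μ, (hμ.smul t).atProj_lt_top⟩) (hμ.smul t)).trans ?_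
    exact (congrArg (fun a : ((extendedElliott A).toStevens
      (extendedElliott_isObject hwd)).Δ p => t • a) h1).symm
  res_compat p q h τ := by
    obtain ⟨μ, hμ, -⟩ := exists_smallest_extension (p := rep (A := A) p) τ
    have h1 := quotEquiv_eq (φ := ⟨μ, hμ.atProj_lt_top⟩) hμ
    have h2 := stevens_res_isRestriction hwd h hμ
    refine (congrArg (((extendedElliott A).toStevens
      (extendedElliott_isObject hwd)).res p q h) h1).trans ?_
    exact (quotEquiv_eq (φ := ⟨μ, h2.atProj_lt_top⟩) h2).symm
  pairing_compat p e h τ := by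
    obtain ⟨μ, hμ, -⟩ := exists_smallest_extension (p := rep (A := A) p) τ
    have h1 := quotEquiv_eq (φ := ⟨μ, hμ.atProj_lt_top⟩) hμ
    refine Eq.trans ?_ (congrArg (((extendedElliott A).toStevens
      (extendedElliott_isObject hwd)).pairing p e h) h1).symm
    exact congrArg ENNReal.toNNReal (stevens_pairing_eq hwd h hμ)

end ElliottToStevens

/-! ### From families of finite traces to lower semicontinuous traces -/

section StevensToElliott

variable {A : Type u} [NonUnitalCStarAlgebra A] [PartialOrder A] [StarOrderedRing A]

/-- Directed suprema of lower semicontinuous traces are lower semicontinuous traces. -/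
theorem LscTrace.exists_iSup {ι : Type*} (μ : ι → LscTrace A)
    (hdir : ∀ i j, ∃ k, ∀ x, 0 ≤ x → (μ i).1.val x ≤ (μ k).1.val x ∧
      (μ j).1.val x ≤ (μ k).1.val x) :
    ∃ φ : LscTrace A, ∀ x, 0 ≤ x → φ.1.val x = ⨆ i, (μ i).1.val x := by
  let φ : CTrace A := CTrace.ofTracial (fun x => ⨆ i, (μ i).1.val x)
    (fun t x hx => by
      rw [ENNReal.mul_iSup]
      refine iSup_congr fun i => ?_
      rw [← ENNReal.ofReal_coe_nnreal]
      exact (μ i).1.val_smul t.coe_nonneg (nonneg_iff_exists.2 hx))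
    (fun x y hx hy => by
      have hx := nonneg_iff_exists.2 hx
      have hy := nonneg_iff_exists.2 hy
      rw [ENNReal.iSup_add_iSup]
      · exact iSup_congr fun i => (μ i).1.val_add hx hy
      · intro i j
        obtain ⟨k, hk⟩ := hdir i j
        exact ⟨k, add_le_add (hk x hx).1 (hk y hy).2⟩)
    (fun x => iSup_congr fun i => (μ i).val_mul_star x)
  have e : φ.toFun = fun x => ⨆ i, (μ i).1.toFun x :=
    funext fun x => iSup_congr fun i => (μ i).1.val_coe x
  have hval : ∀ x, 0 ≤ x → φ.val x = ⨆ i, (μ i).1.val x := fun x hx =>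
    CTrace.ofTracial_val _ _ _ _ (nonneg_iff_exists.1 hx)
  refine ⟨⟨φ, ?_⟩, hval⟩
  rw [e]
  exact lowerSemicontinuous_iSup fun i => (μ i).2

/-- The projections whose class belongs to the ideal `Λ` of `K₀(A)⁺`. -/
def projSet (Λ : PosIdeal (cstarKTuple A)) : Set (MatProj A) :=
  {q | ∃ p : kZeroPos A, p ∈ Λ.carrier ∧ KZero.of q = p}

omit [PartialOrder A] [StarOrderedRing A] in
theorem rep_mem_projSet {Λ : PosIdeal (cstarKTuple A)} {p : kZeroPos A} (hp : p ∈ Λ.carrier) :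
    rep p ∈ projSet Λ := ⟨p, hp, rep_spec p⟩

/-- The projections over the closed ideal of `A` generated by `Λ` are those with class in `Λ`. -/
theorem mem_of_diagMem_projSet {Λ : PosIdeal (cstarKTuple A)} {q : kZeroPos A}
    (h : (rep q).DiagMem (projCone (projSet Λ)).ideal) : q ∈ Λ.carrier := by
  obtain ⟨p, ⟨x, hx, hpx⟩, v, hpv, hv⟩ := h.exists_eq_conjTranspose_mul
    ⟨_, rep_mem_projSet Λ.zero_mem⟩ (by
      rintro p ⟨x, hx, hp⟩ q ⟨y, hy, hq⟩
      refine ⟨x + y, Λ.add_mem hx hy, ?_⟩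
      rw [KZero.of_dsum, hp, hq]
      rfl)
  obtain ⟨f, hf⟩ := KZero.exists_add_of_conjTranspose_mul hv hpv
  refine Λ.mem_of_le ?_ hx
  show (x : KZero A) - q ∈ kZeroPos A
  rw [← hpx, hf, rep_spec, add_sub_cancel_left]
  exact AddSubmonoid.subset_closure ⟨f, rfl⟩

theorem mem_ideal_projCone_of_le (hwd : PairingWellDefined A) {p q : kZeroPos A}
    (h : (cstarKTuple A).Le q p) {x : A} (hx : 0 ≤ x) (hxq : x ∈ (projCone {rep q}).ideal) :
    x ∈ (projCone {rep p}).ideal := by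
  refine ConjCone.mem_ideal_of_carrier_subset (fun s hs => projCone_subset_ideal ?_ hs) hx hxq
  rintro _ rfl
  exact MatProj.DiagMem.of_dominated hwd ((cstarKTuple A).dominated_of_le h) (rep_spec q)
    (rep_spec p) (diagMem_projCone (Set.mem_singleton _))

omit [PartialOrder A] [StarOrderedRing A] in
theorem kZeroPos_le_add_left (p q : kZeroPos A) : (cstarKTuple A).Le q (p + q) := by
  show ((p + q : kZeroPos A) : KZero A) - q ∈ kZeroPos A
  rw [AddSubmonoid.coe_add, add_sub_cancel_right]
  exact p.2

omit [PartialOrder A] [StarOrderedRing A] in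
theorem kZeroPos_le_add_right (p q : kZeroPos A) : (cstarKTuple A).Le p (p + q) :=
  add_comm q p ▸ kZeroPos_le_add_left q p

theorem exists_mem_ideal_of_mem_projCone (hwd : PairingWellDefined A)
    {Λ : PosIdeal (cstarKTuple A)} {s : A} (hs : s ∈ (projCone (projSet Λ)).carrier) :
    ∃ p : kZeroPos A, p ∈ Λ.carrier ∧ s ∈ (projCone {rep p}).ideal := by
  refine (AddSubmonoid.closure_induction (motive := fun s _ => 0 ≤ s ∧
    ∃ p : kZeroPos A, p ∈ Λ.carrier ∧ s ∈ (projCone {rep p}).ideal) ?_ ?_ ?_ hs).2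
  · rintro _ ⟨q, ⟨p, hp, hqp⟩, v, hv, rfl⟩
    refine ⟨Finset.sum_nonneg fun a _ => star_mul_self_nonneg _, p, hp, ?_⟩
    exact (MatProj.DiagMem.of_dominated hwd ((cstarKTuple A).dominated_self p) hqp (rep_spec p)
      (diagMem_projCone (Set.mem_singleton _))).of_isColumn hv
  · exact ⟨le_rfl, 0, Λ.zero_mem, zero_mem _⟩
  · rintro x y _ _ ⟨hx, p, hp, hxp⟩ ⟨hy, q, hq, hyq⟩
    exact ⟨add_nonneg hx hy, p + q, Λ.add_mem hp hq,
      add_mem (mem_ideal_projCone_of_le hwd (kZeroPos_le_add_right p q) hx hxp)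
        (mem_ideal_projCone_of_le hwd (kZeroPos_le_add_left p q) hy hyq)⟩

/-- The classes at which a trace is finite. -/
def LscTrace.finiteIdeal (hwd : PairingWellDefined A) (φ : LscTrace A) :
    PosIdeal (cstarKTuple A) where
  carrier := {p | φ.1.atProj (rep (A := A) p) < ∞}
  nonempty := ⟨0, ((extendedElliott_isObject hwd).pairing_zero φ).trans_lt ENNReal.zero_lt_top⟩
  add_mem {p q} hp hq := ((extendedElliott_isObject hwd).pairing_add p q φ).trans_lt
    (ENNReal.add_lt_top.2 ⟨hp, hq⟩)
  mem_of_le h hp :=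
    LscTrace.atProj_lt_top_of_dominated hwd φ ((cstarKTuple A).dominated_of_le h) hp

/-- By the ideal property, a trace is infinite off the ideal generated by the projections at which
it is finite. -/
theorem LscTrace.val_eq_top (hid : IdealProperty A) (hwd : PairingWellDefined A)
    {φ : LscTrace A} {Λ : PosIdeal (cstarKTuple A)}
    (hΛ : ∀ p : kZeroPos A, p ∈ Λ.carrier ↔ φ.1.atProj (rep p) < ∞) {x : A} (hx : 0 ≤ x)
    (h : x ∉ (projCone (projSet Λ)).ideal) : φ.1.val x = ∞ := by
  by_contra hfin
  refine h (hid φ.1.finiteCone.ideal _ ConjCone.isClosed_ideal ConjCone.isClosed_ideal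
    (fun p hp hpφ => ?_) (ConjCone.subset_ideal (S := φ.1.finiteCone) ⟨hx, hfin⟩))
  have h1 : φ.1.val p ≠ ∞ := (ConjCone.mem_of_isStarProjection hp hpφ).2
  let P : MatProj A := ⟨1, Matrix.of fun _ _ => p, by
    refine ⟨?_, ?_⟩
    · ext i j
      simp [Matrix.mul_apply, hp.isIdempotentElem.eq]
    · ext i j
      exact hp.isSelfAdjoint⟩
  let e : kZeroPos A := ⟨KZero.of P, AddSubmonoid.subset_closure ⟨P, rfl⟩⟩
  have h2 : φ.1.atProj P = φ.1.val p := by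
    rw [CTrace.atProj_eq_sum]
    exact Fin.sum_univ_one _
  have h3 : e ∈ Λ.carrier := by
    rw [hΛ, ← LscTrace.atProj_rep hwd φ (p := P) rfl, h2]
    exact h1.lt_top
  exact diagMem_projCone (P := projSet Λ) (p := P) ⟨e, h3, rfl⟩ (0 : Fin 1)

/-- A trace is determined by the classes at which it is finite and its restrictions to the
corresponding corners. -/
theorem LscTrace.eq_of_isRestriction (hid : IdealProperty A) (hwd : PairingWellDefined A)
    {φ ψ : LscTrace A} {Λ : PosIdeal (cstarKTuple A)}
    {τ : ∀ p : kZeroPos A, p ∈ Λ.carrier → FinTrace (rep p).corner}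
    (hφ : ∀ p : kZeroPos A, p ∈ Λ.carrier ↔ φ.1.atProj (rep p) < ∞)
    (hψ : ∀ p : kZeroPos A, p ∈ Λ.carrier ↔ ψ.1.atProj (rep p) < ∞)
    (hφτ : ∀ p hp, IsRestriction φ (τ p hp)) (hψτ : ∀ p hp, IsRestriction ψ (τ p hp)) :
    φ = ψ := by
  refine LscTrace.ext_val fun x hx => ?_
  by_cases h : x ∈ (projCone (projSet Λ)).ideal
  · refine LscTrace.val_eq_of_mem_ideal (fun s hs => ?_) hx h
    obtain ⟨p, hp, hsp⟩ := exists_mem_ideal_of_mem_projCone hwd hs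
    exact (hφτ p hp).val_eq (hψτ p hp) ((projCone (projSet Λ)).nonneg hs) hsp
  · rw [LscTrace.val_eq_top hid hwd hφ hx h, LscTrace.val_eq_top hid hwd hψ hx h]

/-- Every compatible family of finite traces on corners, indexed by an ideal `Λ`, comes from a lower
semicontinuous trace which is finite exactly at `Λ`: the supremum of the smallest extensions, plus
`∞` off the closed ideal generated by `Λ`. -/
theorem exists_trace_of_family (hwd : PairingWellDefined A) (a : (stevens A).Family) :
    ∃ φ : LscTrace A, (∀ p : kZeroPos A, p ∈ a.Λ.carrier ↔ φ.1.atProj (rep p) < ∞) ∧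
      ∀ (p : kZeroPos A) (hp : p ∈ a.Λ.carrier),
        IsRestriction φ (p := rep p) (a.τ p hp) := by
  choose μ hμ hmin using fun p : {p : kZeroPos A // p ∈ a.Λ.carrier} =>
    exists_smallest_extension (p := rep p.1) (a.τ p.1 p.2)
  have hres : ∀ p q : {p : kZeroPos A // p ∈ a.Λ.carrier}, (cstarKTuple A).Le q.1 p.1 →
      IsRestriction (μ p) (p := rep q.1) (a.τ q.1 q.2) := fun p q h =>
    a.compat p.1 q.1 p.2 h ▸ stevens_res_isRestriction hwd h (hμ p)
  let add (p q : {p : kZeroPos A // p ∈ a.Λ.carrier}) : {p : kZeroPos A // p ∈ a.Λ.carrier} :=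
    ⟨p.1 + q.1, a.Λ.add_mem p.2 q.2⟩
  have hl : ∀ p q, IsRestriction (μ (add p q)) (p := rep p.1) (a.τ p.1 p.2) := fun p q =>
    hres (add p q) p (kZeroPos_le_add_right p.1 q.1)
  have hr : ∀ p q, IsRestriction (μ (add p q)) (p := rep q.1) (a.τ q.1 q.2) := fun p q =>
    hres (add p q) q (kZeroPos_le_add_left p.1 q.1)
  obtain ⟨ν, hν⟩ := LscTrace.exists_iSup μ fun p q =>
    ⟨add p q, fun x hx => ⟨hmin p _ (hl p q) x hx, hmin q _ (hr p q) x hx⟩⟩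
  -- On the ideal of `p` the supremum is the smallest extension of `τ_p`.
  have hνp : ∀ p x, 0 ≤ x → x ∈ (projCone {rep p.1}).ideal → ν.1.val x = (μ p).1.val x := by
    intro p x hx hxp
    rw [hν x hx]
    refine le_antisymm (iSup_le fun q => ?_) (le_iSup (fun q => (μ q).1.val x) p)
    exact (hmin q _ (hr p q) x hx).trans ((hl p q).val_eq (hμ p) hx hxp).le
  let S := projCone (projSet a.Λ)
  have hφ : ∀ (p : kZeroPos A) (hp : p ∈ a.Λ.carrier),
      IsRestriction (ν + S.indicator) (p := rep p) (a.τ p hp) := fun p hp => by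
    refine isRestriction_iff.2 fun x hx => ?_
    refine (isRestriction_iff.1 (hμ ⟨p, hp⟩) x hx).trans (Finset.sum_congr rfl fun i _ => ?_)
    have h0 := CStarMatrix.diag_nonneg hx.1 i
    rw [LscTrace.add_val, ConjCone.indicator_val_of_mem S
      ((diagMem_projCone (rep_mem_projSet hp)).of_posIn hx i), add_zero]
    exact (hνp ⟨p, hp⟩ _ h0 ((diagMem_projCone (Set.mem_singleton _)).of_posIn hx i)).symm
  refine ⟨ν + S.indicator, fun p => ⟨fun hp => (hφ p hp).atProj_lt_top, fun h => ?_⟩, hφ⟩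
  refine mem_of_diagMem_projSet ((MatProj.diagMem_iff _ _).2 ?_)
  have h1 := CTrace.add_atProj ν.1 S.indicator.1 (rep p)
  exact lt_of_le_of_lt (le_add_self.trans_eq h1.symm) h

/-- The family of the restrictions of a trace to the corners at which it is finite. -/
def LscTrace.toFamily (hwd : PairingWellDefined A) (φ : LscTrace A) : (stevens A).Family where
  Λ := φ.finiteIdeal hwd
  τ p hp := φ.restrict (rep (A := A) p) hp
  compat _ _ hp h := (stevens_res_isRestriction hwd h (φ.restrict_isRestriction _ hp)).unique
    (φ.restrict_isRestriction _ _)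

theorem LscTrace.toFamily_isRestriction (hwd : PairingWellDefined A) (φ : LscTrace A)
    (p : kZeroPos A) (hp : p ∈ (φ.toFamily hwd).Λ.carrier) :
    IsRestriction φ (p := rep p) ((φ.toFamily hwd).τ p hp) := φ.restrict_isRestriction _ hp

theorem LscTrace.toFamily_bijective (hid : IdealProperty A) (hwd : PairingWellDefined A) :
    Function.Bijective (LscTrace.toFamily hwd : LscTrace A → _) := by
  refine ⟨fun φ ψ h => ?_, fun a => ?_⟩
  · have hψ : ∀ p : kZeroPos A, p ∈ (φ.toFamily hwd).Λ.carrier ↔ ψ.1.atProj (rep p) < ∞ :=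
      fun p => h ▸ Iff.rfl
    have hψτ : ∀ (p : kZeroPos A) (hp : p ∈ (φ.toFamily hwd).Λ.carrier),
        IsRestriction ψ (p := rep p) ((φ.toFamily hwd).τ p hp) :=
      h ▸ ψ.toFamily_isRestriction hwd
    exact LscTrace.eq_of_isRestriction hid hwd (fun p => Iff.rfl) hψ
      (φ.toFamily_isRestriction hwd) hψτ
  · obtain ⟨φ, hφ, hφτ⟩ := exists_trace_of_family hwd a
    refine ⟨φ, StevensTuple.Family.ext (fun p => (hφ p).symm) fun p h h' => ?_⟩
    exact (φ.toFamily_isRestriction hwd p h).unique (hφτ p h')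

/-- The isomorphism from `F` of the Stevens invariant to the extended Elliott invariant. -/
def elliottIso (hid : IdealProperty A) (hwd : PairingWellDefined A) :
    ElliottIso ((stevens A).toElliott (stevens_isObject hwd)) (extendedElliott A) where
  toKIso := KIso.refl (cstarKTuple A)
  ζ := Equiv.ofBijective _ (LscTrace.toFamily_bijective hid hwd)
  ζ_add φ ψ := by
    refine StevensTuple.Family.ext (fun p => ?_) fun p h h' => ?_
    · exact Iff.trans (by rw [← CTrace.add_atProj]; rfl) ENNReal.add_lt_top
    · exact (LscTrace.toFamily_isRestriction hwd _ p h).unique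
        ((LscTrace.toFamily_isRestriction hwd φ p h'.1).add
          (LscTrace.toFamily_isRestriction hwd ψ p h'.2))
  ζ_smul t φ := by
    refine StevensTuple.Family.ext (fun p => ?_) fun p h h' => ?_
    · have h1 := CTrace.smul_atProj t φ.1 (rep (A := A) p)
      have h2 : ENNReal.ofReal t.1 ≠ 0 := (ENNReal.ofReal_pos.2 t.2).ne'
      refine Iff.trans (b := ENNReal.ofReal t.1 * φ.1.atProj (rep (A := A) p) < ∞) ?_ ?_
      · rw [← h1]
        rfl
      · refine ⟨fun h => ?_, fun h => ENNReal.mul_lt_top ENNReal.ofReal_lt_top h⟩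
        exact ENNReal.lt_top_of_mul_ne_top_right h.ne h2
    · exact (LscTrace.toFamily_isRestriction hwd _ p h).unique
        ((LscTrace.toFamily_isRestriction hwd φ p h').smul t)
  compat p φ := by
    by_cases h : φ.1.atProj (rep (A := A) p) < ∞
    · refine Eq.trans ?_ (dif_pos (show p ∈ (φ.toFamily hwd).Λ.carrier from h)).symm
      exact (stevens_pairing_eq hwd _ (φ.toFamily_isRestriction hwd p h)).symm
    · refine Eq.trans ?_ (dif_neg (show ¬p ∈ (φ.toFamily hwd).Λ.carrier from h)).symm
      exact not_lt_top_iff.1 h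

end StevensToElliott

end

theorem theorem1p1 {A : Type u} [NonUnitalCStarAlgebra A] [PartialOrder A] [StarOrderedRing A]
    (hid : IdealProperty A) (hwd : PairingWellDefined A) :
    ∃ (hE : (extendedElliott A).IsObject) (hS : (stevens A).IsObject),
      (∃ Φ : StevensIso ((extendedElliott A).toStevens hE) (stevens A),
        (∀ x, Φ.θ0 x = x) ∧ (∀ x, Φ.θ1 x = x) ∧
        ∀ (p : kZeroPos A) (φ : (extendedElliott A).FinPart p),
          IsRestriction φ.1 ((Φ.ξ p).symm (ElliottTuple.QuotPart.mk φ))) ∧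
      (∃ Ψ : ElliottIso ((stevens A).toElliott hS) (extendedElliott A),
        (∀ x, Ψ.θ0 x = x) ∧ (∀ x, Ψ.θ1 x = x) ∧
        ∀ φ : LscTrace A,
          (∀ p : kZeroPos A, p ∈ (Ψ.ζ φ).Λ.carrier ↔ φ.1.atProj (rep p) < ∞) ∧
          ∀ (p : kZeroPos A) (hp : p ∈ (Ψ.ζ φ).Λ.carrier),
            IsRestriction φ ((Ψ.ζ φ).τ p hp)) :=
  ⟨extendedElliott_isObject hwd, stevens_isObject hwd,
    ⟨stevensIso hwd, fun _ => rfl, fun _ => rfl, fun _ φ => quotRestrict_isRestriction φ⟩,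
    ⟨elliottIso hid hwd, fun _ => rfl, fun _ => rfl, fun φ =>
      ⟨fun _ => Iff.rfl, φ.toFamily_isRestriction hwd⟩⟩⟩
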